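/- **Problem.** Let $F(x)=\frac1m\sum_{i=1}^m f_i(x,y_i(x))$, $x\in\mathbb R^{d_x}$, with $y_i(x)=\arg\min_{y\in\mathbb R^{d_{y,i}}} g_i(x,y)$, $f_i(x,y)=\mathbb E_{\xi\sim\mathcal P_i}f_i(x,y;\xi)$, $g_i(x,y)=\mathbb E_{\zeta\sim\mathcal Q_i}g_i(x,y;\zeta)$. Assume, for all $i,x,y,\xi,\zeta$: 1. $\lambda\,\mathrm{Id}\preceq\nabla^2_{yy}g_i(x,y)\preceq L_g\,\mathrm{Id}$, where $\lambda,L_g>0$. 2. The stochastic derivatives $\nabla_xf_i(x,y;\xi)$, $\nabla_yf_i(x,y;\xi)$, $\nabla_yg_i(x,y;\zeta)$, $\nabla^2_{xy}g_i(x,y;\zeta)$, $\nabla^2_{yy}g_i(x,y;\zeta)$ exist, are Lipschitz in $(x,y)$ with constants $L_{fx},L_{fy},L_{gy},L_{gxy},L_{gyy}$, and have variance at most $\sigma^2$ (spectral norm for matrices). Moreover $\|\nabla_yf_i(x,y)\|\le C_{fy}$, and there is a vector field $a:\mathbb R^{d_x}\to\mathbb R^{d_x}$ with $\|\nabla_xf_i(x,y)-a(x)\|\le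 C_{fx}$ (for $a\equiv0$ this is the bound $\|\nabla_xf_i\|\le C_{fx}$). 3. $\|\nabla^2_{yy}g_i(x,y;\zeta)\|\le\tilde C_{gyy}$, where $\tilde C_{gyy}>0$. 4. (PL) $F$ has a minimizer $x^*$ and $\mu(F(x)-F(x^*))\le\|\nabla F(x)\|^2$ for all $x$, where $\mu>0$. Let $V=C_{fy}/\lambda$, $\mathcal V=\{\|v\|\le V\}$, $L_{\phi v}^2=\max\{4L_{gyy}^2V^2+2L_{fy}^2,\,4\tilde C_{gyy}^2\}$, $\phi_i(v,x,y)=\frac12v^\top\nabla^2_{yy}g_i(x,y)v-v^\top\nabla_yf_i(x,y)$ and $v_i(x,y)=\arg\min_v\phi_i(v,x,y)$. Fix $0<\tau\le\frac2{3L_g}$ and integers $1\le I\le m$, $B\ge1$. **Algorithm BSVRB$^{v2}$**, with parameters $(\alpha,\bar\alpha,\beta,\tau_\bullet,\bar\tau,\eta,T)$, started at $(x_1,y_1,v_1,s_1,u_1,z_1)$ with $x_0=x_1$, $y_0=y_1$, $v_0=v_1$. For $t=1,\dots,T$ draw a uniformly random $I$-element set $\mathcal I_t\subset\{1,\dots,m\}$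 and, for each $i\in\mathcal I_t$, mini-batches $\mathcal B_i^t\sim\mathcal P_i$ and $\tilde{\mathcal B}_i^t\sim\mathcal Q_i$ of $B$ i.i.d. samples each, all draws being independent. Write $h(\cdot;\mathcal B)$ for the average over a batch, $\nabla_v\phi_i(v,x,y;\mathcal B,\tilde{\mathcal B})=\nabla^2_{yy}g_i(x,y;\tilde{\mathcal B})v-\nabla_yf_i(x,y;\mathcal B)$, and $\gamma(a)=\frac{m-I}{I(1-a)}+1-a$. For $i\in\mathcal I_t$ set $$s_{i,t+1}=(1-\alpha)s_{i,t}+\alpha\nabla_yg_i(x_t,y_{i,t};\tilde{\mathcal B}_i^t)+\gamma(\alpha)\big[\nabla_yg_i(x_t,y_{i,t};\tilde{\mathcal B}_i^t)-\nabla_yg_i(x_{t-1},y_{i,t-1};\tilde{\mathcal B}_i^t)\big],$$ $$u_{i,t+1}=(1-\bar\alpha)u_{i,t}+\bar\alpha\nabla_v\phi_i(v_{i,t},x_t,y_{i,t};\mathcal B_i^t,\tilde{\mathcal B}_i^t)+\gamma(\bar\alpha)\big[\nabla_v\phi_i(v_{i,t},x_t,y_{i,t};\mathcal B_i^t,\tilde{\mathcal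 B}_i^t)-\nabla_v\phi_i(v_{i,t-1},x_{t-1},y_{i,t-1};\mathcal B_i^t,\tilde{\mathcal B}_i^t)\big];$$ for $i\notin\mathcal I_t$ leave $s_i,u_i$ unchanged. With $G_t=\frac1I\sum_{i\in\mathcal I_t}[\nabla_xf_i(x_t,y_{i,t};\mathcal B_i^t)-\nabla^2_{xy}g_i(x_t,y_{i,t};\tilde{\mathcal B}_i^t)v_{i,t}]$ and $\tilde G_t$ the same expression at $(x_{t-1},y_{t-1},v_{t-1})$, set $z_{t+1}=(1-\beta)(z_t-\tilde G_t)+G_t$, $y_{t+1}=y_t-\tau\tau_\bullet s_t$, $v_{i,t+1}=\Pi_{\mathcal V}[v_{i,t}-\bar\tau u_{i,t}]$ for all $i$, $x_{t+1}=x_t-\eta z_{t+1}$. The output is the tuple of variables at an independent uniformly random time $\tilde t\in\{1,\dots,T\}$. **RE-BSVRB$^{v2}$**: from a deterministic $\Theta_0=(x,y,v,s,u,z)$ with $v_i\in\mathcal V$, stage $k=1,2,\dots$ runs BSVRB$^{v2}$ from $\Theta_{k-1}$ with parameters $(\alpha_k,\bar\alpha_k,\beta_k,\tau_k,\bar\tau_k,\eta_k,T_k)$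 and fresh randomness, and outputs $\Theta_k$; $x_K$ is the $x$-component of $\Theta_K$. **Theorem.** There are positive constants $L_F,C_{\bar\tau},C_8',C_9',C_{10}',c_T$, depending only on $\lambda,L_g,L_{fx},L_{fy},L_{gy},L_{gxy},L_{gyy},C_{fx},C_{fy},\tilde C_{gyy},\sigma,\tau$, and for every $R\ge0$ a constant $c_1>0$ depending only on these and on $R$, such that the following holds for all $m,I,B,\mu$, all such problems, and all $\Theta_0$ as above with $F(x)-F(x^*)\le R$ and $$\Big\|z-\tfrac1m\sum_i[\nabla_xf_i(x,y_i)-\nabla_{xy}^2g_i(x,y_i)v_i]\Big\|^2+\tfrac1m\sum_i\Big(\|y_i-y_i(x)\|^2+\|v_i-v_i(x,y_i)\|^2+\|s_i-\nabla_yg_i(x,y_i)\|^2+\|u_i-\nabla_v\phi_i(v_i,x,y_i)\|^2\Big)\le R.$$ First, $F$ is differentiable and $\nabla F$ is $L_F$-Lipschitz. Secondly, let $0<\beta_1=\alpha_1=\bar\alpha_1\le\frac12$, $$\bar\tau_1=\min\Big\{\tfrac{\lambda}{8L_{\phi v}^2},\tfrac\lambda2,\tfrac1\lambda,\tfrac{\sqrt{C_{\bar\tau}}\,I\sqrt{\bar\alpha_1}}{m}\Big\},\quad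 \tau_1=\sqrt{C_8'}\sqrt{\min\{\bar\tau_1^2,\tfrac{I^2\alpha_1}{m^2}\}},\quad \eta_1=\min\Big\{\tfrac1{2L_F},\sqrt{C_{10}'}\min\{\sqrt m\,\tau_1,\sqrt m\,\bar\tau_1,\tfrac{\sqrt{\alpha_1}I}{m}\}\Big\},$$ $$T_1\ge c_1\max\Big\{\tfrac1{\mu\eta_1},\ \tfrac mI\cdot\tfrac{\min\{I,B\}}{\mu\beta_1^2},\ \tfrac{I^2\min\{I,B\}}{\mu\tau_1^3m^3}\Big\},\qquad \epsilon_1=\frac{7C_9'(\beta_1+\alpha_1+\bar\alpha_1)}{\mu\min\{I,B\}},\qquad \epsilon_k=\frac{\epsilon_1}{2^{k-1}},$$ and for $k\ge2$ let $0<\beta_k=\alpha_k=\bar\alpha_k\le\frac{\mu\epsilon_k\min\{I,B\}}{21C_9'}$, $\bar\tau_k\ge0$, $\bar\tau_k^2=\frac{C_{\bar\tau}I^2}{m^2}\bar\alpha_k$, $\tau_k=\sqrt{C_8'}\sqrt{\min\{\bar\tau_k^2,\tfrac{I^2\alpha_k}{m^2}\}}$, $\eta_k=\sqrt{C_{10}'}\sqrt{\min\{m\tau_k^2,m\bar\tau_k^2,\tfrac{\alpha_kI^2}{m^2}\}}$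 and $$T_k\ge c_T\max\Big\{\tfrac1{\mu\eta_k},\ \tfrac mI\cdot\tfrac1{\beta_k},\ \tfrac1{\tau_km},\ \tfrac1{\bar\tau_km}\Big\}.$$ Then for every $\epsilon>0$ and every integer $K\ge1$ with $K\ge1+\log_2(\epsilon_1/\epsilon)$ (so $K=O(\log(\epsilon_1/\epsilon))$ stages suffice), $F(x_K)-F(x^*)$ is integrable and $\mathbb E[F(x_K)-F(x^*)]\le\epsilon$. -/

import Mathlib

open MeasureTheory ProbabilityTheory
open scoped ENNReal

noncomputable section

namespace BSVRB

/-- The Euclidean space `ℝ^d`. -/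
abbrev Vec (d : ℕ) : Type := EuclideanSpace ℝ (Fin d)

/-! ### Partial derivatives of a function of two vectors -/

/-- `∇_x h(x, y)`. -/
def gradX {n d : ℕ} (h : Vec n → Vec d → ℝ) (x : Vec n) (y : Vec d) : Vec n :=
  gradient (fun x' => h x' y) x

/-- `∇_y h(x, y)`. -/
def gradY {n d : ℕ} (h : Vec n → Vec d → ℝ) (x : Vec n) (y : Vec d) : Vec d :=
  gradient (fun y' => h x y') y

/-- The Hessian `∇²_{yy} h(x, y)`, as an operator (so its norm is the spectral norm). -/
def hessYY {n d : ℕ} (h : Vec n → Vec d → ℝ) (x : Vec n) (y : Vec d) : Vec d →L[ℝ] Vec d :=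
  fderiv ℝ (fun y' => gradY h x y') y

/-- The `n × d` matrix `∇²_{xy} h(x, y)`: the transpose of the `x`-derivative of `∇_y h`. -/
def jacXY {n d : ℕ} (h : Vec n → Vec d → ℝ) (x : Vec n) (y : Vec d) : Vec d →L[ℝ] Vec n :=
  ContinuousLinearMap.adjoint (fderiv ℝ (fun x' => gradY h x' y) x)

/-- A global minimizer of `h` (meaningful whenever `h` has one). -/
def argminPt {E : Type*} [Nonempty E] (h : E → ℝ) : E :=
  Classical.epsilon fun y => ∀ y', h y ≤ h y'

/-- `L`-Lipschitz continuity with respect to the pair `(x, y)`, in the Euclidean norm. -/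
def LipJoint {n d : ℕ} {E : Type*} [NormedAddCommGroup E] (L : ℝ)
    (h : Vec n → Vec d → E) : Prop :=
  ∀ x y x' y', ‖h x y - h x' y'‖ ≤ L * √(‖x - x'‖ ^ 2 + ‖y - y'‖ ^ 2)

/-- `E_{ξ∼P} ‖h(ξ) - e‖² ≤ σ²` (as a Lebesgue integral, so that finiteness is asserted). -/
def VarLE {S E : Type*} [MeasurableSpace S] [NormedAddCommGroup E] (P : Measure S) (σ : ℝ)
    (h : S → E) (e : E) : Prop :=
  ∫⁻ ξ, ‖h ξ - e‖ₑ ^ 2 ∂P ≤ ENNReal.ofReal (σ ^ 2)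

/-- Average of a sample-dependent quantity over a mini-batch of `B` samples. -/
def batchMean {S E : Type*} [AddCommGroup E] [Module ℝ E] {B : ℕ} (h : S → E)
    (ξ : Fin B → S) : E :=
  (B : ℝ)⁻¹ • ∑ b, h (ξ b)

/-- Euclidean projection onto the closed ball of radius `r` centred at `0`. -/
def projBall {d : ℕ} (r : ℝ) (w : Vec d) : Vec d :=
  if ‖w‖ ≤ r then w else (r / ‖w‖) • w

/-! ### The multi-block bilevel problem -/

/-- Data of a multi-block bilevel problem with `m` blocks: dimensions, the sampling
distributions `P i`, `Q i`, and the stochastic objectives `f_i(x, y; ξ)`, `g_i(x, y; ζ)`. -/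
structure Problem (m : ℕ) (Ξ Z : Type*) [MeasurableSpace Ξ] [MeasurableSpace Z] where
  dx : ℕ
  dy : Fin m → ℕ
  P : Fin m → Measure Ξ
  Q : Fin m → Measure Z
  f : (i : Fin m) → Vec dx → Vec (dy i) → Ξ → ℝ
  g : (i : Fin m) → Vec dx → Vec (dy i) → Z → ℝ

/-- The constants of the assumptions. -/
structure Consts where
  lam : ℝ
  Lg : ℝ
  Lfx : ℝ
  Lfy : ℝ
  Lgy : ℝ
  Lgxy : ℝ
  Lgyy : ℝ
  Cfx : ℝ
  Cfy : ℝ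
  Cgyy : ℝ
  σ : ℝ

structure Consts.Valid (c : Consts) : Prop where
  lam_pos : 0 < c.lam
  Lg_pos : 0 < c.Lg
  Lfx_nonneg : 0 ≤ c.Lfx
  Lfy_nonneg : 0 ≤ c.Lfy
  Lgy_nonneg : 0 ≤ c.Lgy
  Lgxy_nonneg : 0 ≤ c.Lgxy
  Lgyy_nonneg : 0 ≤ c.Lgyy
  Cfx_nonneg : 0 ≤ c.Cfx
  Cfy_nonneg : 0 ≤ c.Cfy
  Cgyy_pos : 0 < c.Cgyy
  σ_nonneg : 0 ≤ c.σ

/-- Radius `V = C_{fy} / λ` of the ball `𝒱` onto which the `v`-variables are projected. -/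
def Consts.V (c : Consts) : ℝ := c.Cfy / c.lam

/-- Lipschitz constant `L_{φv}` of `∇_v φ_i(v, x, y; ξ, ζ)` on `𝒱`:
`L_{φv}² = max {4 L_{gyy}² V² + 2 L_{fy}², 4 C̃_{gyy}²}`. -/
def Consts.Lphi (c : Consts) : ℝ :=
  √(max (4 * c.Lgyy ^ 2 * c.V ^ 2 + 2 * c.Lfy ^ 2) (4 * c.Cgyy ^ 2))

namespace Problem

variable {m : ℕ} {Ξ Z : Type*} [MeasurableSpace Ξ] [MeasurableSpace Z]

/-- `f_i(·, ·; ξ)`. -/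
def fS (p : Problem m Ξ Z) (i : Fin m) (ξ : Ξ) : Vec p.dx → Vec (p.dy i) → ℝ :=
  fun x y => p.f i x y ξ

/-- `g_i(·, ·; ζ)`. -/
def gS (p : Problem m Ξ Z) (i : Fin m) (ζ : Z) : Vec p.dx → Vec (p.dy i) → ℝ :=
  fun x y => p.g i x y ζ

/-- `f_i(x, y) = E_{ξ∼P_i} f_i(x, y; ξ)`. -/
def fBar (p : Problem m Ξ Z) (i : Fin m) (x : Vec p.dx) (y : Vec (p.dy i)) : ℝ :=
  ∫ ξ, p.f i x y ξ ∂(p.P i)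

/-- `g_i(x, y) = E_{ζ∼Q_i} g_i(x, y; ζ)`. -/
def gBar (p : Problem m Ξ Z) (i : Fin m) (x : Vec p.dx) (y : Vec (p.dy i)) : ℝ :=
  ∫ ζ, p.g i x y ζ ∂(p.Q i)

/-- `y_i(x) = argmin_y g_i(x, y)`. -/
def ySol (p : Problem m Ξ Z) (i : Fin m) (x : Vec p.dx) : Vec (p.dy i) :=
  argminPt (p.gBar i x)

/-- `φ_i(v, x, y) = ½ vᵀ ∇²_{yy} g_i(x, y) v - vᵀ ∇_y f_i(x, y)`. -/
def phi (p : Problem m Ξ Z) (i : Fin m) (v : Vec (p.dy i)) (x : Vec p.dx)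
    (y : Vec (p.dy i)) : ℝ :=
  1 / 2 * inner ℝ v (hessYY (p.gBar i) x y v) - inner ℝ v (gradY (p.fBar i) x y)

/-- `v_i(x, y) = argmin_v φ_i(v, x, y)`. -/
def vSol (p : Problem m Ξ Z) (i : Fin m) (x : Vec p.dx) (y : Vec (p.dy i)) : Vec (p.dy i) :=
  argminPt fun v => p.phi i v x y

/-- The objective `F(x) = (1/m) ∑_i f_i(x, y_i(x))`. -/
def F (p : Problem m Ξ Z) (x : Vec p.dx) : ℝ :=
  (m : ℝ)⁻¹ * ∑ i, p.fBar i x (p.ySol i x)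

/-- The standing assumptions on the problem, with constants `c`. -/
structure Assumptions (p : Problem m Ξ Z) (c : Consts) : Prop where
  probP : ∀ i, IsProbabilityMeasure (p.P i)
  probQ : ∀ i, IsProbabilityMeasure (p.Q i)
  -- the expectations defining `f_i`, `g_i` exist
  f_meas : ∀ i x y, Measurable (p.f i x y)
  g_meas : ∀ i x y, Measurable (p.g i x y)
  f_int : ∀ i x y, Integrable (p.f i x y) (p.P i)
  g_int : ∀ i x y, Integrable (p.g i x y) (p.Q i)
  -- the stochastic derivatives that occur below exist
  f_diffX : ∀ i ξ y, Differentiable ℝ (fun x => p.fS i ξ x y)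
  f_diffY : ∀ i ξ x, Differentiable ℝ (fun y => p.fS i ξ x y)
  g_diffY : ∀ i ζ x, Differentiable ℝ (fun y => p.gS i ζ x y)
  g_gradY_diffX : ∀ i ζ y, Differentiable ℝ (fun x => gradY (p.gS i ζ) x y)
  g_gradY_diffY : ∀ i ζ x, Differentiable ℝ (fun y => gradY (p.gS i ζ) x y)
  -- `L_g I ⪰ ∇²_{yy} g_i ⪰ λ I`
  hess_ge : ∀ i x y w, c.lam * ‖w‖ ^ 2 ≤ inner ℝ w (hessYY (p.gBar i) x y w)
  hess_le : ∀ i x y w, inner ℝ w (hessYY (p.gBar i) x y w) ≤ c.Lg * ‖w‖ ^ 2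
  -- Lipschitz continuity of the stochastic derivatives
  lip_fx : ∀ i ξ, LipJoint c.Lfx (gradX (p.fS i ξ))
  lip_fy : ∀ i ξ, LipJoint c.Lfy (gradY (p.fS i ξ))
  lip_gy : ∀ i ζ, LipJoint c.Lgy (gradY (p.gS i ζ))
  lip_gxy : ∀ i ζ, LipJoint c.Lgxy (jacXY (p.gS i ζ))
  lip_gyy : ∀ i ζ, LipJoint c.Lgyy (hessYY (p.gS i ζ))
  -- the `x`-gradients of the upper-level functions are bounded up to a common vector field `a`
  -- (`a = 0` is plain boundedness), the `y`-gradients are bounded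
  bdd_fx : ∃ a : Vec p.dx → Vec p.dx, ∀ i x y, ‖gradX (p.fBar i) x y - a x‖ ≤ c.Cfx
  bdd_fy : ∀ i x y, ‖gradY (p.fBar i) x y‖ ≤ c.Cfy
  -- bounded variance of the stochastic derivatives
  var_fx : ∀ i x y, VarLE (p.P i) c.σ (fun ξ => gradX (p.fS i ξ) x y) (gradX (p.fBar i) x y)
  var_fy : ∀ i x y, VarLE (p.P i) c.σ (fun ξ => gradY (p.fS i ξ) x y) (gradY (p.fBar i) x y)
  var_gy : ∀ i x y, VarLE (p.Q i) c.σ (fun ζ => gradY (p.gS i ζ) x y) (gradY (p.gBar i) x y)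
  var_gxy : ∀ i x y, VarLE (p.Q i) c.σ (fun ζ => jacXY (p.gS i ζ) x y) (jacXY (p.gBar i) x y)
  var_gyy : ∀ i x y, VarLE (p.Q i) c.σ (fun ζ => hessYY (p.gS i ζ) x y) (hessYY (p.gBar i) x y)
  -- bounded stochastic Hessians
  bdd_gyy : ∀ i ζ x y, ‖hessYY (p.gS i ζ) x y‖ ≤ c.Cgyy

/-- The Polyak–Łojasiewicz condition with constant `μ`, where `xstar` minimizes `F`. -/
structure PL (p : Problem m Ξ Z) (μ : ℝ) (xstar : Vec p.dx) : Prop where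
  isMin : ∀ x, p.F xstar ≤ p.F x
  pl : ∀ x, μ * (p.F x - p.F xstar) ≤ ‖gradient p.F x‖ ^ 2

end Problem

/-! ### The single-loop algorithm `BSVRB^{v2}` -/

section Algorithm

variable {m : ℕ} {Ξ Z : Type*} [MeasurableSpace Ξ] [MeasurableSpace Z]

/-- The variables `(x_t, y_t, v_t, s_t, u_t, z_t)`. -/
structure State (p : Problem m Ξ Z) where
  x : Vec p.dx
  y : (i : Fin m) → Vec (p.dy i)
  v : (i : Fin m) → Vec (p.dy i)
  s : (i : Fin m) → Vec (p.dy i)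
  u : (i : Fin m) → Vec (p.dy i)
  z : Vec p.dx

/-- The parameters of one stage (`τ` in `stepY = τ_t` is the scaled step size; the fixed
factor `τ` of the `y`-update is separate). -/
structure StageParams where
  α : ℝ
  αbar : ℝ
  β : ℝ
  stepY : ℝ
  stepV : ℝ
  η : ℝ
  T : ℕ

/-- What is sampled in one iteration: the set of blocks, and for every block a mini-batch of
upper-level samples and a mini-batch of lower-level samples (only those of the sampled blocks
are used). -/
structure Draw (m B : ℕ) (Ξ Z : Type*) where
  blocks : Finset (Fin m)
  ξ : Fin m → Fin B → Ξ
  ζ : Fin m → Fin B → Z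

/-- The MSVR coefficient `γ = (m - I) / (I (1 - a)) + (1 - a)`. -/
def msvrGamma (m I : ℕ) (a : ℝ) : ℝ := ((m : ℝ) - I) / (I * (1 - a)) + (1 - a)

/-- The MSVR update of an estimator `h` from the stochastic values `hNow`, `hPrev` (same
mini-batch) at the current and the previous point. -/
def msvr {E : Type*} [AddCommGroup E] [Module ℝ E] (m I : ℕ) (a : ℝ) (h hNow hPrev : E) : E :=
  (1 - a) • h + a • hNow + msvrGamma m I a • (hNow - hPrev)

variable {B : ℕ}

/-- `∇_y g_i(x_t, y_{i,t}; B̃_i)`. -/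
def gyBatch (p : Problem m Ξ Z) (d : Draw m B Ξ Z) (w : State p) (i : Fin m) : Vec (p.dy i) :=
  batchMean (fun ζ => gradY (p.gS i ζ) w.x (w.y i)) (d.ζ i)

/-- `∇_v φ_i(v_{i,t}, x_t, y_{i,t}; B_i, B̃_i)
= ∇²_{yy} g_i(x_t, y_{i,t}; B̃_i) v_{i,t} - ∇_y f_i(x_t, y_{i,t}; B_i)`. -/
def phiBatch (p : Problem m Ξ Z) (d : Draw m B Ξ Z) (w : State p) (i : Fin m) : Vec (p.dy i) :=
  batchMean (fun ζ => hessYY (p.gS i ζ) w.x (w.y i)) (d.ζ i) (w.v i)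
    - batchMean (fun ξ => gradY (p.fS i ξ) w.x (w.y i)) (d.ξ i)

/-- `(1/I) ∑_{i ∈ 𝓘} [∇_x f_i(x, y_i; B_i) - ∇²_{xy} g_i(x, y_i; B̃_i) v_i]`; this is `G_t` at
the current variables and `G̃_t` at the previous ones. -/
def gEst (p : Problem m Ξ Z) (I : ℕ) (d : Draw m B Ξ Z) (w : State p) : Vec p.dx :=
  (I : ℝ)⁻¹ • ∑ i ∈ d.blocks,
    (batchMean (fun ξ => gradX (p.fS i ξ) w.x (w.y i)) (d.ξ i)
      - batchMean (fun ζ => jacXY (p.gS i ζ) w.x (w.y i)) (d.ζ i) (w.v i))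

/-- One iteration of `BSVRB^{v2}`: from the variables at times `t - 1` (`prev`) and `t` (`cur`)
to those at time `t + 1`; `r` is the radius of the ball `𝒱`. -/
def step (p : Problem m Ξ Z) (r τ : ℝ) (I : ℕ) (q : StageParams) (d : Draw m B Ξ Z)
    (prev cur : State p) : State p :=
  let zNew : Vec p.dx := (1 - q.β) • (cur.z - gEst p I d prev) + gEst p I d cur
  { x := cur.x - q.η • zNew
    y := fun i => cur.y i - (τ * q.stepY) • cur.s i
    v := fun i => projBall r (cur.v i - q.stepV • cur.u i)
    s := fun i =>
      if i ∈ d.blocks then msvr m I q.α (cur.s i) (gyBatch p d cur i) (gyBatch p d prev i)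
      else cur.s i
    u := fun i =>
      if i ∈ d.blocks then
        msvr m I q.αbar (cur.u i) (phiBatch p d cur i) (phiBatch p d prev i)
      else cur.u i
    z := zNew }

/-- The variables at times `n` and `n + 1`, started from `θ` (at times `0` and `1`); the draw
of iteration `t` is `d t`. -/
def pairAt (p : Problem m Ξ Z) (r τ : ℝ) (I : ℕ) (q : StageParams) (d : ℕ → Draw m B Ξ Z)
    (θ : State p) : ℕ → State p × State p
  | 0 => (θ, θ)
  | n + 1 =>
    let w := pairAt p r τ I q d θ n
    (w.2, step p r τ I q (d (n + 1)) w.1 w.2)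

/-- The variables at time `t ≥ 1`. -/
def iterate (p : Problem m Ξ Z) (r τ : ℝ) (I : ℕ) (q : StageParams) (d : ℕ → Draw m B Ξ Z)
    (θ : State p) (t : ℕ) : State p :=
  (pairAt p r τ I q d θ (t - 1)).2

/-- The restarted method: stage `k ≥ 1` runs with parameters `q k` and draws `d k` from the
output of stage `k - 1` and outputs its variables at time `tout k`; `restarted … k` is `Θ_k`. -/
def restarted (p : Problem m Ξ Z) (r τ : ℝ) (I : ℕ) (q : ℕ → StageParams)
    (d : ℕ → ℕ → Draw m B Ξ Z) (tout : ℕ → ℕ) (θ : State p) : ℕ → State p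
  | 0 => θ
  | k + 1 =>
    iterate p r τ I (q (k + 1)) (d (k + 1)) (restarted p r τ I q d tout θ k) (tout (k + 1))

/-- `(1/m) ∑_i [∇_x f_i(x, y_i) - ∇²_{xy} g_i(x, y_i) v_i]`, the quantity tracked by `z`. -/
def trackedGrad (p : Problem m Ξ Z) (w : State p) : Vec p.dx :=
  (m : ℝ)⁻¹ • ∑ i, (gradX (p.fBar i) w.x (w.y i) - jacXY (p.gBar i) w.x (w.y i) (w.v i))

/-- The total error `δ_z + (δ_y + δ_v + δ_s + δ_u) / m` of the variables `w`. -/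
def totalError (p : Problem m Ξ Z) (w : State p) : ℝ :=
  ‖w.z - trackedGrad p w‖ ^ 2
    + (m : ℝ)⁻¹ * ∑ i,
      (‖w.y i - p.ySol i w.x‖ ^ 2
        + ‖w.v i - p.vSol i w.x (w.y i)‖ ^ 2
        + ‖w.s i - gradY (p.gBar i) w.x (w.y i)‖ ^ 2
        + ‖w.u i - (hessYY (p.gBar i) w.x (w.y i) (w.v i) - gradY (p.fBar i) w.x (w.y i))‖ ^ 2)

end Algorithm

/-! ### The sampling -/

/-- Labels of the elementary random draws: stage `k`, iteration `t`, block `i`, position `b`. -/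
inductive DrawIdx (m B : ℕ) : Type
  | blocks (k t : ℕ) : DrawIdx m B
  | upper (k t : ℕ) (i : Fin m) (b : Fin B) : DrawIdx m B
  | lower (k t : ℕ) (i : Fin m) (b : Fin B) : DrawIdx m B
  | out (k : ℕ) : DrawIdx m B

section Sampling

variable {m B : ℕ} {Ξ Z Ω : Type*} [MeasurableSpace Ξ] [MeasurableSpace Z]

/-- All random draws of the restarted method. -/
structure Noise (m B : ℕ) (Ξ Z Ω : Type*) where
  blocks : ℕ → ℕ → Ω → Finset (Fin m)
  ξ : ℕ → ℕ → Fin m → Fin B → Ω → Ξ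
  ζ : ℕ → ℕ → Fin m → Fin B → Ω → Z
  tout : ℕ → Ω → ℕ

/-- The σ-algebra generated by one elementary draw. -/
abbrev Noise.sigma (N : Noise m B Ξ Z Ω) : DrawIdx m B → MeasurableSpace Ω
  | .blocks k t => MeasurableSpace.comap (N.blocks k t) ⊤
  | .upper k t i b => MeasurableSpace.comap (N.ξ k t i b) inferInstance
  | .lower k t i b => MeasurableSpace.comap (N.ζ k t i b) inferInstance
  | .out k => MeasurableSpace.comap (N.tout k) ⊤

/-- The draws of iteration `t` of stage `k`. -/
def Noise.draw (N : Noise m B Ξ Z Ω) (ω : Ω) (k t : ℕ) : Draw m B Ξ Z where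
  blocks := N.blocks k t ω
  ξ := fun i b => N.ξ k t i b ω
  ζ := fun i b => N.ζ k t i b ω

/-- The draws are mutually independent; each set of blocks is uniform among the `I`-element
subsets of the `m` blocks; the samples have laws `P i` and `Q i`; the output index of stage `k`
is uniform on `{1, …, T k}`. -/
structure Noise.IsSampling [MeasurableSpace Ω] (N : Noise m B Ξ Z Ω) (p : Problem m Ξ Z)
    (I : ℕ) (T : ℕ → ℕ) (pr : Measure Ω) : Prop where
  meas_blocks : ∀ k t S, MeasurableSet (N.blocks k t ⁻¹' {S})
  meas_ξ : ∀ k t i b, Measurable (N.ξ k t i b)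
  meas_ζ : ∀ k t i b, Measurable (N.ζ k t i b)
  meas_tout : ∀ k, Measurable (N.tout k)
  law_blocks : ∀ k t (S : Finset (Fin m)), S.card = I →
    pr (N.blocks k t ⁻¹' {S}) = ((m.choose I : ℕ) : ℝ≥0∞)⁻¹
  law_ξ : ∀ k t i b, pr.map (N.ξ k t i b) = p.P i
  law_ζ : ∀ k t i b, pr.map (N.ζ k t i b) = p.Q i
  law_tout : ∀ k, 1 ≤ k → ∀ t ∈ Finset.Icc 1 (T k),
    pr (N.tout k ⁻¹' {t}) = ((T k : ℕ) : ℝ≥0∞)⁻¹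
  indep : iIndep N.sigma pr

/-- The output `Θ_K` of the restarted method after `K` stages. -/
def output (p : Problem m Ξ Z) (r τ : ℝ) (I : ℕ) (q : ℕ → StageParams) (N : Noise m B Ξ Z Ω)
    (θ : State p) (K : ℕ) (ω : Ω) : State p :=
  restarted p r τ I q (N.draw ω) (fun k => N.tout k ω) θ K

end Sampling

/-! ### The parameters of the stages -/

/-- The constants `L_F`, `C_τ̄`, `C_8'`, `C_9'`, `C_10'` in the choice of the parameters, and the
constant `cT` in the stage lengths. -/
structure RConsts where
  LF : ℝ
  Ctau : ℝ
  C8 : ℝ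
  C9 : ℝ
  C10 : ℝ
  cT : ℝ

structure RConsts.Pos (C : RConsts) : Prop where
  LF_pos : 0 < C.LF
  Ctau_pos : 0 < C.Ctau
  C8_pos : 0 < C.C8
  C9_pos : 0 < C.C9
  C10_pos : 0 < C.C10
  cT_pos : 0 < C.cT

/-- `ε_k = ε_1 / 2^{k-1}` with `ε_1 = 7 C_9' (β_1 + α_1 + ᾱ_1) / (μ min{I, B})`, where `q` are
the parameters of the first stage. -/
def epsStage (C : RConsts) (μ : ℝ) (I B : ℕ) (q : StageParams) (k : ℕ) : ℝ :=
  7 * C.C9 * (q.β + q.α + q.αbar) / (μ * min (I : ℝ) B) / 2 ^ (k - 1)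

/-- The parameters of the first stage; `c₁` is the constant in its length. -/
structure FirstStage (c : Consts) (C : RConsts) (c₁ μ : ℝ) (m I B : ℕ) (q : StageParams) :
    Prop where
  β_pos : 0 < q.β
  β_le : q.β ≤ 1 / 2
  α_eq : q.α = q.β
  αbar_eq : q.αbar = q.β
  stepV_eq : q.stepV =
    min (min (c.lam / (8 * c.Lphi ^ 2)) (c.lam / 2))
      (min (1 / c.lam) (√C.Ctau * I * √q.αbar / m))
  stepY_eq : q.stepY = √C.C8 * √(min (q.stepV ^ 2) ((I : ℝ) ^ 2 * q.α / (m : ℝ) ^ 2))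
  η_eq : q.η =
    min (1 / (2 * C.LF))
      (√C.C10 * min (min (√(m : ℝ) * q.stepY) (√(m : ℝ) * q.stepV)) (√q.α * I / m))
  T_ge : c₁ * max (max (1 / (μ * q.η)) ((m : ℝ) / I * (min (I : ℝ) B / (μ * q.β ^ 2))))
      ((I : ℝ) ^ 2 * min (I : ℝ) B / (μ * q.stepY ^ 3 * (m : ℝ) ^ 3)) ≤ q.T

/-- The parameters of a stage `k ≥ 2`, where `ε = ε_k`. -/
structure LaterStage (C : RConsts) (μ ε : ℝ) (m I B : ℕ) (q : StageParams) : Prop where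
  β_pos : 0 < q.β
  β_le : q.β ≤ μ * ε * min (I : ℝ) B / (21 * C.C9)
  α_eq : q.α = q.β
  αbar_eq : q.αbar = q.β
  stepV_nonneg : 0 ≤ q.stepV
  stepV_eq : q.stepV ^ 2 = C.Ctau * (I : ℝ) ^ 2 / (m : ℝ) ^ 2 * q.αbar
  stepY_eq : q.stepY = √C.C8 * √(min (q.stepV ^ 2) ((I : ℝ) ^ 2 * q.α / (m : ℝ) ^ 2))
  η_eq : q.η = √C.C10 *
    √(min (min (m * q.stepY ^ 2) (m * q.stepV ^ 2)) (q.α * (I : ℝ) ^ 2 / (m : ℝ) ^ 2))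
  T_ge : C.cT * max (max (1 / (μ * q.η)) ((m : ℝ) / I * (1 / q.β)))
      (max (1 / (q.stepY * m)) (1 / (q.stepV * m))) ≤ q.T

end BSVRB

end

/-! ### Differentiation under the expectation -/

namespace BSVRB

open Filter Topology

/-! The theorem rests on one Lyapunov function. For previous variables `a` and current variables
`w`, `potential` adds to F(x) - F(x*) the step size η times a weighted sum of the errors of y and v
(distances to the exact lower-level solutions), of s, u and z (errors as estimators), and of the
last displacement. Put ρ = (I/m)√β. The steps of y and v are both κρ, and η ≤ κ_X ρ, with constants
κ and κ_X (`kap`, `kapX`). The weights have order 1/ρ for y and v, 1/ρ² for the displacement, 1/(β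
I/m) for s and u, and 1/β for z. With this scaling m, I and β cancel, and one iteration satisfies
E[new potential] + η · gain ≤ potential + η · noise · β / min{I, B} (`lintegral_potential_step_le`),
where the gain is ½‖∇F‖² plus all the errors and the displacement.

Four facts enter. The hypergradient formula (`hasGradientAt_F`) makes F smooth, so a step along z
decreases F by (η/2)‖∇F‖² + (η/4)‖z‖² up to (η/2)‖∇F - z‖². Strong convexity makes y and v contract,
perturbed by the errors of s and u and by the motion of their targets (`errY_step_le`,
`errV_step_le`). The correction γ in the estimators s and u is exactly such that the cross terms of
a drawn and an idle block cancel on average, so their errors contract at rate β I/m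
(`lintegral_msvr_le`). The estimator z contracts at rate β (`lintegral_storm_le`). What remains is
proportional to the displacement, hence to squared steps; it is absorbed by taking first κ and then
κ_X small.

Summing over a stage and using the uniform output time bounds the expected gain at the output by
`stageBound`: initial gap over ηT, initial errors times (m/I)/(βT), and stationary noise of order β
/ min{I, B}. The PL inequality turns the gain into an objective gap (factor 2/μ), and the gain also
dominates the total error (factor 6K). One bound thus reproduces both invariants of the restart, gap
at most ε_k and total error at most μ ε_k, with ε_k halved at every stage (`output_bounds`). The
first stage starts from R alone and reaches ε_1 because T_1 is long. There μ must be bounded by a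
constant: μ ≤ 3 L_F unless F is constant, and for constant F nothing is to be proved.

Expectations are Lebesgue integrals of nonnegative functions until the end, so that integrability is
a consequence rather than a side condition. -/

theorem hasFDerivAt_expectation {n : ℕ} {S F : Type*} [MeasurableSpace S] [NormedAddCommGroup F]
    [NormedSpace ℝ F] {u : Vec n → S → F} {P : Measure S} [IsProbabilityMeasure P]
    {L : ℝ} (hi : ∀ x, Integrable (u x) P)
    (hd : ∀ s, Differentiable ℝ (fun x => u x s))
    (hl : ∀ s x x', ‖fderiv ℝ (fun x => u x s) x - fderiv ℝ (fun x => u x s) x'‖ ≤ L * ‖x - x'‖)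
    {x : Vec n} (hD : Integrable (fun s => fderiv ℝ (fun x => u x s) x) P) :
    HasFDerivAt (fun x => ∫ s, u x s ∂P) (∫ s, fderiv ℝ (fun x => u x s) x ∂P) x := by
  refine hasFDerivAt_integral_of_dominated_of_fderiv_le
    (F' := fun x s => fderiv ℝ (fun x => u x s) x)
    -- On the unit ball around `x` the Lipschitz bound keeps the derivative within |L| of its value
    -- at `x`, which gives an integrable majorant.
    (bound := fun s => ‖fderiv ℝ (fun x => u x s) x‖ + |L|)
    (Metric.ball_mem_nhds x one_pos) (.of_forall fun x => (hi x).aestronglyMeasurable) (hi x)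
    hD.aestronglyMeasurable (.of_forall fun s x' hx' => ?_)
    (hD.norm.add (integrable_const _)) (.of_forall fun s x' _ => (hd s x').hasFDerivAt)
  have h1 := hl s x' x
  have h2 : L * ‖x' - x‖ ≤ |L| := by
    have h3 : ‖x' - x‖ ≤ 1 := by
      rw [← dist_eq_norm]; exact (Metric.mem_ball.1 hx').le
    calc L * ‖x' - x‖ ≤ |L| * ‖x' - x‖ := by gcongr; exact le_abs_self L
      _ ≤ |L| * 1 := by gcongr
      _ = |L| := mul_one _
  have h4 := norm_le_norm_add_norm_sub' (fderiv ℝ (fun x => u x s) x') (fderiv ℝ (fun x => u x s) x)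
  linarith

section ParametricExpectation

variable {n : ℕ} {S F : Type*} [MeasurableSpace S] [NormedAddCommGroup F] [InnerProductSpace ℝ F]
  [FiniteDimensional ℝ F] [MeasurableSpace F] [BorelSpace F]

/-- A directional derivative is the pointwise limit of the difference quotients k (u(x + w/k) -
u(x)), so measurability in the sample is inherited. -/
theorem measurable_fderiv_apply_param {u : Vec n → S → F} {x : Vec n}
    (hm : ∀ x, Measurable (u x)) (hd : ∀ s, DifferentiableAt ℝ (fun x => u x s) x) (w : Vec n) :
    Measurable (fun s => fderiv ℝ (fun x => u x s) x w) := by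
  have hlim : Tendsto (fun k : ℕ => fun s => (k : ℝ) • (u (x + (k : ℝ)⁻¹ • w) s - u x s)) atTop
      (𝓝 (fun s => fderiv ℝ (fun x => u x s) x w)) := by
    rw [tendsto_pi_nhds]
    intro s
    exact ((hd s).hasFDerivAt.lim_real w).comp tendsto_natCast_atTop_atTop
  exact measurable_of_tendsto_metrizable
    (fun k => ((hm _).sub (hm _)).const_smul (k : ℝ)) hlim

/-- In finite dimension an operator is a finite sum built from its columns. This upgrades pointwise
measurability to the strong measurability that Bochner integrals of Hessians and Jacobians require.
-/
theorem stronglyMeasurable_clm_param {D : S → Vec n →L[ℝ] F}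
    (hD : ∀ w, Measurable fun s => D s w) : StronglyMeasurable D := by
  have h : D = fun s => ∑ j : Fin n,
      ContinuousLinearMap.smulRightL ℝ (Vec n) F (EuclideanSpace.proj j)
        (D s (EuclideanSpace.single j 1)) := by
    funext s
    ext w
    have hw : w = ∑ j : Fin n, w j • EuclideanSpace.single j (1 : ℝ) := by
      ext k
      simp [Pi.single_apply]
    conv_lhs => rw [hw]
    simp [map_sum]
  rw [h]
  exact Finset.stronglyMeasurable_fun_sum _ fun j _ =>
    (ContinuousLinearMap.continuous _).comp_stronglyMeasurable (hD _).stronglyMeasurable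

/-- A strongly measurable map with finite second moment about a point is in `L²`. -/
theorem memLp_two_of_varLE {E : Type*} [NormedAddCommGroup E] {P : Measure S}
    [IsProbabilityMeasure P] {σ : ℝ} {h : S → E} {e : E} (hm : AEStronglyMeasurable h P)
    (hv : VarLE P σ h e) : MemLp h 2 P := by
  have h1 : MemLp (fun s => h s - e) 2 P := by
    refine ⟨hm.sub aestronglyMeasurable_const, ?_⟩
    rw [eLpNorm_lt_top_iff_lintegral_rpow_enorm_lt_top (by simp) (by simp)]
    refine lt_of_le_of_lt ?_ (lt_of_le_of_lt hv ENNReal.ofReal_lt_top)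
    simp
  have h2 := h1.add (memLp_const e)
  rwa [show ((fun s => h s - e) + fun _ => e) = h by ext; simp] at h2

theorem norm_gradient_sub {f g : Vec n → ℝ} (x y : Vec n) :
    ‖fderiv ℝ f x - fderiv ℝ g y‖ = ‖gradient f x - gradient g y‖ := by
  rw [gradient, gradient, ← map_sub, LinearIsometryEquiv.norm_map]

theorem measurable_gradient_param {u : Vec n → S → ℝ} {x : Vec n}
    (hm : ∀ x, Measurable (u x)) (hd : ∀ s, DifferentiableAt ℝ (fun x => u x s) x) :
    Measurable (fun s => gradient (fun x => u x s) x) :=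
  ((InnerProductSpace.toDual ℝ (Vec n)).symm.continuous.comp_stronglyMeasurable
    (stronglyMeasurable_clm_param (measurable_fderiv_apply_param hm hd))).measurable

theorem hasGradientAt_expectation {u : Vec n → S → ℝ} {P : Measure S} [IsProbabilityMeasure P]
    {L : ℝ} (hi : ∀ x, Integrable (u x) P)
    (hd : ∀ s, Differentiable ℝ (fun x => u x s))
    (hl : ∀ s x x', ‖gradient (fun x => u x s) x - gradient (fun x => u x s) x'‖ ≤ L * ‖x - x'‖)
    {x : Vec n} (hD : Integrable (fun s => gradient (fun x => u x s) x) P) :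
    HasGradientAt (fun x => ∫ s, u x s ∂P) (∫ s, gradient (fun x => u x s) x ∂P) x := by
  have hcomp : (fun s => fderiv ℝ (fun x => u x s) x)
      = fun s => InnerProductSpace.toDual ℝ (Vec n) (gradient (fun x => u x s) x) := by
    funext s; simp [gradient]
  have hD' : Integrable (fun s => fderiv ℝ (fun x => u x s) x) P := by
    rw [hcomp]
    exact (InnerProductSpace.toDual ℝ (Vec n)).toLinearIsometry.toContinuousLinearMap.integrable_comp
      hD
  have h := hasFDerivAt_expectation hi hd
    (fun s x x' => by rw [norm_gradient_sub]; exact hl s x x') hD'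
  rw [hasGradientAt_iff_hasFDerivAt]
  have h2 := (InnerProductSpace.toDual ℝ (Vec n)).toLinearIsometry.toContinuousLinearMap.integral_comp_comm
    hD
  rw [hcomp] at h
  exact h2 ▸ h

end ParametricExpectation

theorem LipJoint.left {n d : ℕ} {E : Type*} [NormedAddCommGroup E] {L : ℝ}
    {h : Vec n → Vec d → E} (hl : LipJoint L h) (x x' : Vec n) (y : Vec d) :
    ‖h x y - h x' y‖ ≤ L * ‖x - x'‖ := by
  simpa using hl x y x' y

theorem LipJoint.right {n d : ℕ} {E : Type*} [NormedAddCommGroup E] {L : ℝ}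
    {h : Vec n → Vec d → E} (hl : LipJoint L h) (x : Vec n) (y y' : Vec d) :
    ‖h x y - h x y'‖ ≤ L * ‖y - y'‖ := by
  simpa using hl x y x y'

namespace Problem.Assumptions

variable {m : ℕ} {Ξ Z : Type*} [MeasurableSpace Ξ] [MeasurableSpace Z] {p : Problem m Ξ Z}
  {c : Consts}

section Upper

variable (hp : p.Assumptions c) (i : Fin m) (x : Vec p.dx) (y : Vec (p.dy i))
include hp

theorem measurable_gradX_fS : Measurable fun ξ => gradX (p.fS i ξ) x y :=
  measurable_gradient_param (u := fun x ξ => p.fS i ξ x y) (fun x => hp.f_meas i x y)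
    (fun ξ => (hp.f_diffX i ξ y) x)

theorem memLp_gradX_fS : MemLp (fun ξ => gradX (p.fS i ξ) x y) 2 (p.P i) :=
  have := hp.probP i
  memLp_two_of_varLE (hp.measurable_gradX_fS i x y).aestronglyMeasurable (hp.var_fx i x y)

theorem hasGradientAt_fBar_left :
    HasGradientAt (fun x => p.fBar i x y) (∫ ξ, gradX (p.fS i ξ) x y ∂p.P i) x :=
  have := hp.probP i
  hasGradientAt_expectation (u := fun x ξ => p.fS i ξ x y) (fun x => hp.f_int i x y)
    (fun ξ => hp.f_diffX i ξ y) (fun ξ x x' => (hp.lip_fx i ξ).left x x' y)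
    ((hp.memLp_gradX_fS i x y).integrable one_le_two)

theorem gradX_fBar : gradX (p.fBar i) x y = ∫ ξ, gradX (p.fS i ξ) x y ∂p.P i :=
  (hp.hasGradientAt_fBar_left i x y).gradient

theorem measurable_gradY_fS : Measurable fun ξ => gradY (p.fS i ξ) x y :=
  measurable_gradient_param (u := fun y ξ => p.fS i ξ x y) (fun y => hp.f_meas i x y)
    (fun ξ => (hp.f_diffY i ξ x) y)

theorem memLp_gradY_fS : MemLp (fun ξ => gradY (p.fS i ξ) x y) 2 (p.P i) :=
  have := hp.probP i
  memLp_two_of_varLE (hp.measurable_gradY_fS i x y).aestronglyMeasurable (hp.var_fy i x y)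

theorem hasGradientAt_fBar_right :
    HasGradientAt (fun y => p.fBar i x y) (∫ ξ, gradY (p.fS i ξ) x y ∂p.P i) y :=
  have := hp.probP i
  hasGradientAt_expectation (u := fun y ξ => p.fS i ξ x y) (fun y => hp.f_int i x y)
    (fun ξ => hp.f_diffY i ξ x) (fun ξ y y' => (hp.lip_fy i ξ).right x y y')
    ((hp.memLp_gradY_fS i x y).integrable one_le_two)

theorem gradY_fBar : gradY (p.fBar i) x y = ∫ ξ, gradY (p.fS i ξ) x y ∂p.P i :=
  (hp.hasGradientAt_fBar_right i x y).gradient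

end Upper

section Lower

variable (hp : p.Assumptions c) (i : Fin m) (x : Vec p.dx) (y : Vec (p.dy i))
include hp

theorem measurable_gradY_gS : Measurable fun ζ => gradY (p.gS i ζ) x y :=
  measurable_gradient_param (u := fun y ζ => p.gS i ζ x y) (fun y => hp.g_meas i x y)
    (fun ζ => (hp.g_diffY i ζ x) y)

theorem memLp_gradY_gS : MemLp (fun ζ => gradY (p.gS i ζ) x y) 2 (p.Q i) :=
  have := hp.probQ i
  memLp_two_of_varLE (hp.measurable_gradY_gS i x y).aestronglyMeasurable (hp.var_gy i x y)

theorem integrable_gradY_gS : Integrable (fun ζ => gradY (p.gS i ζ) x y) (p.Q i) :=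
  have := hp.probQ i
  (hp.memLp_gradY_gS i x y).integrable one_le_two

theorem hasGradientAt_gBar_right :
    HasGradientAt (fun y => p.gBar i x y) (∫ ζ, gradY (p.gS i ζ) x y ∂p.Q i) y :=
  have := hp.probQ i
  hasGradientAt_expectation (u := fun y ζ => p.gS i ζ x y) (fun y => hp.g_int i x y)
    (fun ζ => hp.g_diffY i ζ x) (fun ζ y y' => (hp.lip_gy i ζ).right x y y')
    (hp.integrable_gradY_gS i x y)

theorem gradY_gBar : gradY (p.gBar i) x y = ∫ ζ, gradY (p.gS i ζ) x y ∂p.Q i :=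
  (hp.hasGradientAt_gBar_right i x y).gradient

theorem measurable_hessYY_gS_apply (v : Vec (p.dy i)) :
    Measurable fun ζ => hessYY (p.gS i ζ) x y v :=
  measurable_fderiv_apply_param (u := fun y ζ => gradY (p.gS i ζ) x y)
    (fun y => hp.measurable_gradY_gS i x y) (fun ζ => (hp.g_gradY_diffY i ζ x) y) v

theorem memLp_hessYY_gS : MemLp (fun ζ => hessYY (p.gS i ζ) x y) 2 (p.Q i) :=
  have := hp.probQ i
  memLp_two_of_varLE (stronglyMeasurable_clm_param
    (hp.measurable_hessYY_gS_apply i x y)).aestronglyMeasurable (hp.var_gyy i x y)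

theorem integrable_hessYY_gS : Integrable (fun ζ => hessYY (p.gS i ζ) x y) (p.Q i) :=
  have := hp.probQ i
  (hp.memLp_hessYY_gS i x y).integrable one_le_two

theorem hasFDerivAt_gradY_gBar_right :
    HasFDerivAt (fun y => gradY (p.gBar i) x y) (∫ ζ, hessYY (p.gS i ζ) x y ∂p.Q i) y := by
  have := hp.probQ i
  have h := hasFDerivAt_expectation (u := fun y ζ => gradY (p.gS i ζ) x y)
    (fun y => hp.integrable_gradY_gS i x y) (fun ζ => hp.g_gradY_diffY i ζ x)
    (fun ζ y y' => (hp.lip_gyy i ζ).right x y y') (hp.integrable_hessYY_gS i x y)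
  rwa [show (fun y => gradY (p.gBar i) x y) = fun y => ∫ ζ, gradY (p.gS i ζ) x y ∂p.Q i from
    funext fun y => hp.gradY_gBar i x y]

theorem hessYY_gBar : hessYY (p.gBar i) x y = ∫ ζ, hessYY (p.gS i ζ) x y ∂p.Q i :=
  (hp.hasFDerivAt_gradY_gBar_right i x y).fderiv

theorem hasFDerivAt_hessYY :
    HasFDerivAt (fun y => gradY (p.gBar i) x y) (hessYY (p.gBar i) x y) y := by
  rw [hp.hessYY_gBar]
  exact hp.hasFDerivAt_gradY_gBar_right i x y

theorem measurable_fderiv_gradY_gS_apply (w : Vec p.dx) :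
    Measurable fun ζ => fderiv ℝ (fun x => gradY (p.gS i ζ) x y) x w :=
  measurable_fderiv_apply_param (u := fun x ζ => gradY (p.gS i ζ) x y)
    (fun x => hp.measurable_gradY_gS i x y) (fun ζ => (hp.g_gradY_diffX i ζ y) x) w

theorem stronglyMeasurable_jacXY_gS : StronglyMeasurable fun ζ => jacXY (p.gS i ζ) x y :=
  ContinuousLinearMap.adjoint.continuous.comp_stronglyMeasurable
    (stronglyMeasurable_clm_param (hp.measurable_fderiv_gradY_gS_apply i x y))

theorem measurable_jacXY_gS_apply (v : Vec (p.dy i)) :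
    Measurable fun ζ => jacXY (p.gS i ζ) x y v :=
  ((ContinuousLinearMap.apply ℝ (Vec p.dx) v).continuous.comp_stronglyMeasurable
    (hp.stronglyMeasurable_jacXY_gS i x y)).measurable

theorem memLp_jacXY_gS : MemLp (fun ζ => jacXY (p.gS i ζ) x y) 2 (p.Q i) :=
  have := hp.probQ i
  memLp_two_of_varLE (hp.stronglyMeasurable_jacXY_gS i x y).aestronglyMeasurable
    (hp.var_gxy i x y)

theorem integrable_jacXY_gS : Integrable (fun ζ => jacXY (p.gS i ζ) x y) (p.Q i) :=
  have := hp.probQ i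
  (hp.memLp_jacXY_gS i x y).integrable one_le_two

theorem integrable_fderiv_gradY_gS :
    Integrable (fun ζ => fderiv ℝ (fun x => gradY (p.gS i ζ) x y) x) (p.Q i) := by
  refine (hp.integrable_jacXY_gS i x y).congr' (stronglyMeasurable_clm_param
    (hp.measurable_fderiv_gradY_gS_apply i x y)).aestronglyMeasurable (.of_forall fun ζ => ?_)
  simp [jacXY]

theorem hasFDerivAt_gradY_gBar_left :
    HasFDerivAt (fun x => gradY (p.gBar i) x y)
      (∫ ζ, fderiv ℝ (fun x => gradY (p.gS i ζ) x y) x ∂p.Q i) x := by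
  have := hp.probQ i
  have h := hasFDerivAt_expectation (u := fun x ζ => gradY (p.gS i ζ) x y) (x := x)
    (fun x => hp.integrable_gradY_gS i x y) (fun ζ => hp.g_gradY_diffX i ζ y)
    (fun ζ x x' => by
      have h1 := (hp.lip_gxy i ζ).left x x' y
      rwa [jacXY, jacXY, ← map_sub, LinearIsometryEquiv.norm_map] at h1)
    (hp.integrable_fderiv_gradY_gS i x y)
  rwa [show (fun x => gradY (p.gBar i) x y) = fun x => ∫ ζ, gradY (p.gS i ζ) x y ∂p.Q i from
    funext fun x => hp.gradY_gBar i x y]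

/-- Since the matrix is an adjoint, the expectation is moved through it weakly: both sides are
paired with an arbitrary `w`, and the derivative of ∇_y g in direction `w` is an expectation. -/
theorem jacXY_gBar_apply (v : Vec (p.dy i)) :
    jacXY (p.gBar i) x y v = ∫ ζ, jacXY (p.gS i ζ) x y v ∂p.Q i := by
  refine ext_inner_left ℝ fun w => ?_
  have h1 : Integrable (fun ζ => jacXY (p.gS i ζ) x y v) (p.Q i) :=
    (hp.integrable_jacXY_gS i x y).apply_continuousLinearMap v
  rw [← integral_inner h1, jacXY, ContinuousLinearMap.adjoint_inner_right,
    (hp.hasFDerivAt_gradY_gBar_left i x y).fderiv,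
    ContinuousLinearMap.integral_apply (hp.integrable_fderiv_gradY_gS i x y),
    real_inner_comm,
    ← integral_inner ((hp.integrable_fderiv_gradY_gS i x y).apply_continuousLinearMap w)]
  congr 1
  funext ζ
  rw [jacXY, ContinuousLinearMap.adjoint_inner_right, real_inner_comm]

theorem hasFDerivAt_adjoint_jacXY :
    HasFDerivAt (fun x => gradY (p.gBar i) x y)
      (ContinuousLinearMap.adjoint (jacXY (p.gBar i) x y)) x := by
  rw [jacXY, ContinuousLinearMap.adjoint_adjoint]
  exact (hp.hasFDerivAt_gradY_gBar_left i x y).differentiableAt.hasFDerivAt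

end Lower

end Problem.Assumptions

end BSVRB


/-! ### Expansions, strong convexity and first-order constants -/

namespace BSVRB

open Filter Topology

theorem LipJoint.integral {n d : ℕ} {S E : Type*} [MeasurableSpace S] [NormedAddCommGroup E]
    [NormedSpace ℝ E] {P : Measure S} [IsProbabilityMeasure P] {L : ℝ} {h : S → Vec n → Vec d → E}
    (hi : ∀ x y, Integrable (fun s => h s x y) P) (hl : ∀ s, LipJoint L (h s)) :
    LipJoint L (fun x y => ∫ s, h s x y ∂P) := by
  intro x y x' y'
  simp only
  rw [← integral_sub (hi x y) (hi x' y')]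
  refine (norm_integral_le_of_norm_le_const (.of_forall fun s => hl s x y x' y')).trans ?_
  simp

/-- First-order expansion of a function of two vectors with jointly Lipschitz partial
derivatives. -/
theorem norm_partial_expansion_le {n d : ℕ} {E : Type*} [NormedAddCommGroup E] [NormedSpace ℝ E]
    {h : Vec n → Vec d → E} {A : Vec n → Vec d → Vec n →L[ℝ] E} {B : Vec n → Vec d → Vec d →L[ℝ] E}
    {L : ℝ} (hL : 0 ≤ L) (hA : ∀ x y, HasFDerivAt (fun x => h x y) (A x y) x)
    (hB : ∀ x y, HasFDerivAt (fun y => h x y) (B x y) y)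
    (lA : LipJoint L A) (lB : LipJoint L B) (x x' : Vec n) (y y' : Vec d) :
    ‖h x' y' - h x y - A x y (x' - x) - B x y (y' - y)‖
      ≤ 2 * L * (‖x' - x‖ + ‖y' - y‖) ^ 2 := by
  -- First x moves at height y', then y moves at the old x. The x-derivative therefore sits at (x,
  -- y'), and carrying it back to (x, y) costs the mixed term `h3`.
  have h1 : ‖h x' y' - h x y' - A x y' (x' - x)‖ ≤ L * ‖x' - x‖ * ‖x' - x‖ := by
    refine Convex.norm_image_sub_le_of_norm_hasFDerivWithin_le' (𝕜 := ℝ) (f := fun x => h x y')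
      (f' := fun x => A x y') (s := segment ℝ x x')
      (fun w _ => (hA w y').hasFDerivWithinAt) (fun w hw => ?_)
      (convex_segment x x') (left_mem_segment ℝ x x') (right_mem_segment ℝ x x')
    refine (lA.left w x y').trans (mul_le_mul_of_nonneg_left ?_ hL)
    have := norm_sub_le_of_mem_segment hw
    exact this
  have h2 : ‖h x y' - h x y - B x y (y' - y)‖ ≤ L * ‖y' - y‖ * ‖y' - y‖ := by
    refine Convex.norm_image_sub_le_of_norm_hasFDerivWithin_le' (𝕜 := ℝ) (f := fun y => h x y)
      (f' := fun y => B x y) (s := segment ℝ y y')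
      (fun w _ => (hB x w).hasFDerivWithinAt) (fun w hw => ?_)
      (convex_segment y y') (left_mem_segment ℝ y y') (right_mem_segment ℝ y y')
    refine (lB.right x w y).trans (mul_le_mul_of_nonneg_left ?_ hL)
    have := norm_sub_le_of_mem_segment hw
    exact this
  have h3 : ‖(A x y' - A x y) (x' - x)‖ ≤ L * ‖y' - y‖ * ‖x' - x‖ :=
    (ContinuousLinearMap.le_opNorm _ _).trans
      (mul_le_mul_of_nonneg_right (lA.right x y' y) (norm_nonneg _))
  have h4 : h x' y' - h x y - A x y (x' - x) - B x y (y' - y)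
      = (h x' y' - h x y' - A x y' (x' - x)) + (h x y' - h x y - B x y (y' - y))
        + (A x y' - A x y) (x' - x) := by
    rw [sub_apply]; abel
  rw [h4]
  refine (norm_add₃_le).trans ?_
  nlinarith [norm_nonneg (x' - x), norm_nonneg (y' - y),
    mul_nonneg hL (mul_nonneg (norm_nonneg (x' - x)) (norm_nonneg (y' - y))),
    mul_nonneg hL (sq_nonneg ‖x' - x‖), mul_nonneg hL (sq_nonneg ‖y' - y‖)]

theorem hasGradientAt_of_sq_bound {n : ℕ} {f : Vec n → ℝ} {G x : Vec n} {C : ℝ}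
    (h : ∀ x', |f x' - f x - inner ℝ G (x' - x)| ≤ C * ‖x' - x‖ ^ 2) : HasGradientAt f G x := by
  rw [hasGradientAt_iff_isLittleO]
  have h1 : (fun x' => f x' - f x - inner ℝ G (x' - x)) =O[𝓝 x] fun x' => ‖x' - x‖ ^ 2 :=
    Asymptotics.IsBigO.of_bound C (.of_forall fun x' => by simpa using h x')
  refine h1.trans_isLittleO ?_
  have h2 : (fun w : Vec n => ‖w‖ ^ 2) =o[𝓝 0] fun w => w :=
    Asymptotics.isLittleO_norm_pow_id one_lt_two
  have h3 : Tendsto (fun x' => x' - x) (𝓝 x) (𝓝 0) := by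
    have h4 : Continuous fun x' : Vec n => x' - x := by fun_prop
    simpa using h4.tendsto x
  exact h2.comp_tendsto h3

theorem argminPt_spec {E : Type*} [Nonempty E] {h : E → ℝ} (hex : ∃ y, ∀ y', h y ≤ h y') :
    ∀ y', h (argminPt h) ≤ h y' :=
  Classical.epsilon_spec hex

section StronglyConvex

variable {d : ℕ} {g : Vec d → ℝ} {g' : Vec d → Vec d} {H : Vec d → Vec d →L[ℝ] Vec d} {lam : ℝ}

theorem inner_sub_ge_of_hessian_ge (hH : ∀ y, HasFDerivAt g' (H y) y)
    (hge : ∀ y w, lam * ‖w‖ ^ 2 ≤ inner ℝ w (H y w)) (y y' : Vec d) :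
    lam * ‖y - y'‖ ^ 2 ≤ inner ℝ (g' y - g' y') (y - y') := by
  set w := y - y' with hw
  have hl : ∀ t : ℝ, HasDerivAt (fun t : ℝ => y' + t • w) w t := fun t => by
    simpa using ((hasDerivAt_id t).smul_const w).const_add y'
  have hder : ∀ t : ℝ, HasDerivAt
      (fun t : ℝ => inner ℝ w (g' (y' + t • w)) - t * (lam * ‖w‖ ^ 2))
      (inner ℝ w (H (y' + t • w) w) - lam * ‖w‖ ^ 2) t := fun t => by
    have h1 := (hH (y' + t • w)).comp_hasDerivAt t (hl t)
    have h2 := (innerSL ℝ w).hasFDerivAt.comp_hasDerivAt t h1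
    simpa using! h2.sub ((hasDerivAt_id t).mul_const (lam * ‖w‖ ^ 2))
  have hmono : Monotone (fun t : ℝ => inner ℝ w (g' (y' + t • w)) - t * (lam * ‖w‖ ^ 2)) :=
    monotone_of_hasDerivAt_nonneg hder (fun t => sub_nonneg.2 (hge _ w))
  have h := hmono (zero_le_one' ℝ)
  simp only [zero_smul, add_zero, zero_mul, sub_zero, one_smul, one_mul] at h
  rw [show y' + w = y by simp [hw]] at h
  rw [inner_sub_left, real_inner_comm w, real_inner_comm w]
  linarith

/-- The difference of the two sides is monotone along the segment. No sign of `lam` is used, and a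
negative `lam` later yields the descent inequality. -/
theorem strongConvex_lower_bound (hg : ∀ y, HasGradientAt g (g' y) y)
    (hge : ∀ y y', lam * ‖y - y'‖ ^ 2 ≤ inner ℝ (g' y - g' y') (y - y')) (y y' : Vec d) :
    g y + inner ℝ (g' y) (y' - y) + lam / 2 * ‖y' - y‖ ^ 2 ≤ g y' := by
  set w := y' - y with hw
  have hl : ∀ t : ℝ, HasDerivAt (fun t : ℝ => y + t • w) w t := fun t => by
    simpa using ((hasDerivAt_id t).smul_const w).const_add y
  have hder : ∀ t : ℝ, HasDerivAt
      (fun t : ℝ => g (y + t • w) - t * inner ℝ (g' y) w - t ^ 2 * (lam / 2 * ‖w‖ ^ 2))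
      (inner ℝ (g' (y + t • w)) w - inner ℝ (g' y) w - 2 * t * (lam / 2 * ‖w‖ ^ 2)) t := fun t => by
    have h1 := (hg (y + t • w)).hasFDerivAt.comp_hasDerivAt t (hl t)
    have h2 := (h1.sub ((hasDerivAt_id t).mul_const (inner ℝ (g' y) w))).sub
      ((hasDerivAt_pow 2 t).mul_const (lam / 2 * ‖w‖ ^ 2))
    simpa using! h2
  have hmono : MonotoneOn
      (fun t : ℝ => g (y + t • w) - t * inner ℝ (g' y) w - t ^ 2 * (lam / 2 * ‖w‖ ^ 2))
      (Set.Ici 0) := by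
    refine monotoneOn_of_hasDerivWithinAt_nonneg (convex_Ici 0)
      (fun t _ => (hder t).continuousAt.continuousWithinAt)
      (fun t _ => (hder t).hasDerivWithinAt) (fun t ht => ?_)
    have ht' : 0 < t := by simpa using ht
    have h1 := hge (y + t • w) y
    rw [show y + t • w - y = t • w by abel, norm_smul, inner_smul_right, inner_sub_left,
      Real.norm_of_nonneg ht'.le] at h1
    have h2 : lam * (t * ‖w‖ ^ 2) ≤ inner ℝ (g' (y + t • w)) w - inner ℝ (g' y) w := by
      refine le_of_mul_le_mul_left ?_ ht'
      linarith [h1]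
    linarith
  have h := hmono (Set.mem_Ici.2 le_rfl) (Set.mem_Ici.2 zero_le_one) (zero_le_one' ℝ)
  simp only [zero_smul, add_zero, zero_mul, sub_zero, one_smul, one_mul, one_pow] at h
  rw [show y + w = y' by simp [hw]] at h
  simp at h
  linarith

/-- The quadratic lower bound at 0, with slope `b + 1` in place of `b` after completing the square,
leaves ‖y‖ plus a constant below g, so g is coercive. -/
theorem exists_isMin_of_strongConvex (hlam : 0 < lam) (hg : ∀ y, HasGradientAt g (g' y) y)
    (hge : ∀ y y', lam * ‖y - y'‖ ^ 2 ≤ inner ℝ (g' y - g' y') (y - y')) :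
    ∃ y, ∀ y', g y ≤ g y' := by
  have hc : Continuous g := continuous_iff_continuousAt.2 fun y => (hg y).continuousAt
  refine hc.exists_forall_le ?_
  set b := ‖g' 0‖ with hb
  have hlow : ∀ y, ‖y‖ + (g 0 - (b + 1) ^ 2 / (2 * lam)) ≤ g y := fun y => by
    have h1 := strongConvex_lower_bound hg hge 0 y
    have h2 := abs_le.1 (abs_real_inner_le_norm (g' 0) (y - 0))
    simp only [sub_zero] at h1 h2
    have h3 : (b + 1) * ‖y‖ ≤ lam / 2 * ‖y‖ ^ 2 + (b + 1) ^ 2 / (2 * lam) := by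
      have h4 : 0 ≤ (lam * ‖y‖ - (b + 1)) ^ 2 / (2 * lam) := by positivity
      have h5 : (lam * ‖y‖ - (b + 1)) ^ 2 / (2 * lam)
          = lam / 2 * ‖y‖ ^ 2 + (b + 1) ^ 2 / (2 * lam) - (b + 1) * ‖y‖ := by
        field_simp; ring
      linarith
    rw [← hb] at h2
    linarith [h2.1]
  exact tendsto_atTop_mono hlow
    ((tendsto_norm_cocompact_atTop (E := Vec d)).atTop_add tendsto_const_nhds)

end StronglyConvex

section Quadratic

variable {d : ℕ} {H : Vec d →L[ℝ] Vec d} {b : Vec d} {lam : ℝ}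

theorem exists_apply_eq_of_coercive (hlam : 0 < lam)
    (hge : ∀ w, lam * ‖w‖ ^ 2 ≤ inner ℝ w (H w)) : ∃ v, H v = b := by
  have hinj : Function.Injective (H : Vec d →ₗ[ℝ] Vec d) := by
    rw [injective_iff_map_eq_zero]
    intro w hw
    have h := hge w
    rw [show H w = 0 from hw, inner_zero_right] at h
    have h2 : ‖w‖ ^ 2 = 0 := le_antisymm (by nlinarith [sq_nonneg ‖w‖]) (sq_nonneg _)
    simpa using h2
  exact (LinearMap.injective_iff_surjective.1 hinj) b

/-- Completing the square at a solution of H v = b shows that every minimizer equals v; hence the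
minimizer picked by choice solves the linear system. -/
theorem argminPt_quadratic (hlam : 0 < lam) (hsymm : ∀ v w, inner ℝ (H v) w = inner ℝ v (H w))
    (hge : ∀ w, lam * ‖w‖ ^ 2 ≤ inner ℝ w (H w)) :
    H (argminPt fun v => 1 / 2 * inner ℝ v (H v) - inner ℝ v b) = b := by
  obtain ⟨v, hv⟩ := exists_apply_eq_of_coercive (b := b) hlam hge
  have key : ∀ w, 1 / 2 * inner ℝ w (H w) - inner ℝ w b
      = 1 / 2 * inner ℝ v (H v) - inner ℝ v b + 1 / 2 * inner ℝ (w - v) (H (w - v)) := fun w => by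
    have h1 : inner ℝ w (H v) = inner ℝ v (H w) := by rw [← hsymm, real_inner_comm]
    rw [← hv]
    simp only [map_sub, inner_sub_left, inner_sub_right]
    linarith
  have hmin := argminPt_spec (h := fun v => 1 / 2 * inner ℝ v (H v) - inner ℝ v b)
    ⟨v, fun w => by simp only [key w]; nlinarith [hge (w - v), sq_nonneg ‖w - v‖]⟩
  set a := argminPt fun v => 1 / 2 * inner ℝ v (H v) - inner ℝ v b
  have h1 := hmin v
  simp only [key a] at h1
  have h2 := hge (a - v)
  have h3 : ‖a - v‖ ^ 2 = 0 := le_antisymm (by nlinarith [sq_nonneg ‖a - v‖]) (sq_nonneg _)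
  have h4 : a = v := by simpa [sub_eq_zero] using h3
  rw [h4, hv]

end Quadratic

section AffineMaps

variable {n d : ℕ} {E : Type*} [NormedAddCommGroup E] [NormedSpace ℝ E]

/-- The splitting J(x,y)(v - v') + (J(x,y) - J(x',y'))v' uses the size of v' only, so just one of
the two points has to lie in the ball. -/
theorem norm_affine_sub_le {J : Vec n → Vec d → Vec d →L[ℝ] E} {b : Vec n → Vec d → E}
    {Lb LJ CJ V : ℝ} (hb : LipJoint Lb b) (hJ : LipJoint LJ J) (hC : ∀ x y, ‖J x y‖ ≤ CJ)
    (hLb : 0 ≤ Lb) (hLJ : 0 ≤ LJ)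
    {x x' : Vec n} {y y' v v' : Vec d} (hv' : ‖v'‖ ≤ V) :
    ‖(J x y v - b x y) - (J x' y' v' - b x' y')‖
      ≤ (Lb + LJ * V + CJ) * √(‖x - x'‖ ^ 2 + ‖y - y'‖ ^ 2 + ‖v - v'‖ ^ 2) := by
  set D := √(‖x - x'‖ ^ 2 + ‖y - y'‖ ^ 2 + ‖v - v'‖ ^ 2) with hD
  have hC0 : 0 ≤ CJ := (norm_nonneg _).trans (hC x y)
  have hD0 : 0 ≤ D := Real.sqrt_nonneg _
  have hxy : √(‖x - x'‖ ^ 2 + ‖y - y'‖ ^ 2) ≤ D :=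
    Real.sqrt_le_sqrt (by linarith [sq_nonneg ‖v - v'‖])
  have hvD : ‖v - v'‖ ≤ D :=
    Real.le_sqrt_of_sq_le (by linarith [sq_nonneg ‖x - x'‖, sq_nonneg ‖y - y'‖])
  have h1 : ‖b x y - b x' y'‖ ≤ Lb * D := (hb x y x' y').trans (by gcongr)
  have h2 : ‖(J x y - J x' y') v'‖ ≤ LJ * V * D := by
    calc ‖(J x y - J x' y') v'‖ ≤ ‖J x y - J x' y'‖ * ‖v'‖ := ContinuousLinearMap.le_opNorm _ _
      _ ≤ (LJ * D) * V := by
        gcongr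
        exact (hJ x y x' y').trans (by gcongr)
      _ = LJ * V * D := by ring
  have h3 : ‖J x y (v - v')‖ ≤ CJ * D :=
    (ContinuousLinearMap.le_opNorm _ _).trans (mul_le_mul (hC x y) hvD (norm_nonneg _) hC0)
  have h4 : (J x y v - b x y) - (J x' y' v' - b x' y')
      = J x y (v - v') + (J x y - J x' y') v' - (b x y - b x' y') := by
    rw [map_sub, sub_apply]; abel
  rw [h4]
  refine (norm_sub_le _ _).trans ?_
  have h5 := norm_add_le (J x y (v - v')) ((J x y - J x' y') v')
  linarith

end AffineMaps

/-- A common bound for all first-order constants of the problem. -/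
noncomputable def Consts.lip (c : Consts) : ℝ :=
  (1 + c.V) * (1 + c.Lfx + c.Lfy + c.Lgy + c.Lgxy + c.Lgyy + c.Cgyy + c.Cfx + c.σ)

/-- Lipschitz constant of the lower-level solution maps. -/
noncomputable def Consts.ratio (c : Consts) : ℝ := c.lip / c.lam

/-- Lipschitz constant of the hypergradient. -/
noncomputable def Consts.LFc (c : Consts) : ℝ := c.lip * (1 + c.ratio) ^ 2

/-- A common bound for all squared constants of the problem. -/
noncomputable def Consts.K (c : Consts) : ℝ := 4 * c.lip ^ 2 * (1 + c.ratio) ^ 2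

namespace Consts.Valid

variable {c : Consts} (hc : c.Valid)
include hc

theorem V_nonneg : 0 ≤ c.V := div_nonneg hc.Cfy_nonneg hc.lam_pos.le

/-- Each combination is dominated by terms of the expanded product defining `lip`; its factor 1 + V
accounts for the matrices that are multiplied by a vector of the ball. -/
theorem le_lip : 1 ≤ c.lip ∧ c.Lgy ≤ c.lip ∧ c.Lfy + c.Lgyy * c.V + c.Cgyy ≤ c.lip
    ∧ c.Lfx + c.Lgxy * c.V + c.Lgy ≤ c.lip ∧ c.Cfx + c.Lgy * c.V ≤ c.lip
    ∧ c.σ * (1 + c.V) ≤ c.lip ∧ c.Lfy + c.Lgyy * c.V ≤ c.lip := by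
  obtain ⟨h1, h2, h3, h4, h5, h6, h7, h8, h9, h10, h11⟩ := hc
  have hV : 0 ≤ c.V := div_nonneg h9 h1.le
  have p3 := mul_nonneg h3 hV
  have p4 := mul_nonneg h4 hV
  have p5 := mul_nonneg h5 hV
  have p6 := mul_nonneg h6 hV
  have p7 := mul_nonneg h7 hV
  have p8 := mul_nonneg h8 hV
  have p10 := mul_nonneg h10.le hV
  have p11 := mul_nonneg h11 hV
  unfold Consts.lip
  refine ⟨?_, ?_, ?_, ?_, ?_, ?_, ?_⟩ <;> nlinarith

theorem one_le_lip : 1 ≤ c.lip := hc.le_lip.1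

theorem ratio_nonneg : 0 ≤ c.ratio :=
  div_nonneg (zero_le_one.trans hc.one_le_lip) hc.lam_pos.le

theorem lip_sq_le_K : c.lip ^ 2 ≤ c.K := by
  have h := hc.ratio_nonneg
  have h2 : 1 ≤ (1 + c.ratio) ^ 2 := by nlinarith
  unfold Consts.K
  nlinarith [sq_nonneg c.lip]

theorem one_le_K : 1 ≤ c.K := by
  have := hc.lip_sq_le_K
  nlinarith [hc.one_le_lip]

theorem LFc_pos : 0 < c.LFc := by
  have := hc.ratio_nonneg
  have := hc.one_le_lip
  unfold Consts.LFc
  positivity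

end Consts.Valid

namespace Problem

variable {m : ℕ} {Ξ Z : Type*} [MeasurableSpace Ξ] [MeasurableSpace Z]

/-- `∇_v φ_i(v, x, y; ξ, ζ)`. -/
noncomputable def phS (p : Problem m Ξ Z) (i : Fin m) (ξ : Ξ) (ζ : Z) (x : Vec p.dx) (y v : Vec (p.dy i)) :
    Vec (p.dy i) :=
  hessYY (p.gS i ζ) x y v - gradY (p.fS i ξ) x y

/-- `∇_v φ_i(v, x, y)`. -/
noncomputable def phBar (p : Problem m Ξ Z) (i : Fin m) (x : Vec p.dx) (y v : Vec (p.dy i)) : Vec (p.dy i) :=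
  hessYY (p.gBar i) x y v - gradY (p.fBar i) x y

/-- The stochastic hypergradient surrogate of one block. -/
noncomputable def txS (p : Problem m Ξ Z) (i : Fin m) (ξ : Ξ) (ζ : Z) (x : Vec p.dx) (y v : Vec (p.dy i)) :
    Vec p.dx :=
  gradX (p.fS i ξ) x y - jacXY (p.gS i ζ) x y v

/-- The hypergradient surrogate of one block. -/
noncomputable def txBar (p : Problem m Ξ Z) (i : Fin m) (x : Vec p.dx) (y v : Vec (p.dy i)) : Vec p.dx :=
  gradX (p.fBar i) x y - jacXY (p.gBar i) x y v

namespace Assumptions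

variable {p : Problem m Ξ Z} {c : Consts} (hp : p.Assumptions c) (hc : c.Valid) (i : Fin m)

section Lipschitz
include hp

theorem lipJoint_gradX_fBar : LipJoint c.Lfx (gradX (p.fBar i)) := by
  have := hp.probP i
  rw [show gradX (p.fBar i) = fun x y => ∫ ξ, gradX (p.fS i ξ) x y ∂p.P i from
    funext₂ (hp.gradX_fBar i)]
  exact LipJoint.integral (fun x y => (hp.memLp_gradX_fS i x y).integrable one_le_two)
    (hp.lip_fx i)

theorem lipJoint_gradY_fBar : LipJoint c.Lfy (gradY (p.fBar i)) := by
  have := hp.probP i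
  rw [show gradY (p.fBar i) = fun x y => ∫ ξ, gradY (p.fS i ξ) x y ∂p.P i from
    funext₂ (hp.gradY_fBar i)]
  exact LipJoint.integral (fun x y => (hp.memLp_gradY_fS i x y).integrable one_le_two)
    (hp.lip_fy i)

theorem lipJoint_gradY_gBar : LipJoint c.Lgy (gradY (p.gBar i)) := by
  have := hp.probQ i
  rw [show gradY (p.gBar i) = fun x y => ∫ ζ, gradY (p.gS i ζ) x y ∂p.Q i from
    funext₂ (hp.gradY_gBar i)]
  exact LipJoint.integral (hp.integrable_gradY_gS i) (hp.lip_gy i)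

theorem lipJoint_hessYY_gBar : LipJoint c.Lgyy (hessYY (p.gBar i)) := by
  have := hp.probQ i
  rw [show hessYY (p.gBar i) = fun x y => ∫ ζ, hessYY (p.gS i ζ) x y ∂p.Q i from
    funext₂ (hp.hessYY_gBar i)]
  exact LipJoint.integral (hp.integrable_hessYY_gS i) (hp.lip_gyy i)

theorem jacXY_gBar (x : Vec p.dx) (y : Vec (p.dy i)) :
    jacXY (p.gBar i) x y = ∫ ζ, jacXY (p.gS i ζ) x y ∂p.Q i := by
  ext1 v
  rw [hp.jacXY_gBar_apply, ContinuousLinearMap.integral_apply (hp.integrable_jacXY_gS i x y)]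

theorem lipJoint_jacXY_gBar : LipJoint c.Lgxy (jacXY (p.gBar i)) := by
  have := hp.probQ i
  rw [show jacXY (p.gBar i) = fun x y => ∫ ζ, jacXY (p.gS i ζ) x y ∂p.Q i from
    funext₂ (hp.jacXY_gBar i)]
  exact LipJoint.integral (hp.integrable_jacXY_gS i) (hp.lip_gxy i)

theorem norm_hessYY_gBar_le (x : Vec p.dx) (y : Vec (p.dy i)) :
    ‖hessYY (p.gBar i) x y‖ ≤ c.Cgyy := by
  have := hp.probQ i
  rw [hp.hessYY_gBar]
  refine (norm_integral_le_of_norm_le_const (.of_forall fun ζ => hp.bdd_gyy i ζ x y)).trans ?_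
  simp

include hc

theorem norm_jacXY_gS_le (ζ : Z) (x : Vec p.dx) (y : Vec (p.dy i)) :
    ‖jacXY (p.gS i ζ) x y‖ ≤ c.Lgy := by
  rw [jacXY, LinearIsometryEquiv.norm_map]
  exact norm_fderiv_le_of_lip' ℝ hc.Lgy_nonneg
    (.of_forall fun x' => (hp.lip_gy i ζ).left x' x y)

theorem norm_jacXY_gBar_le (x : Vec p.dx) (y : Vec (p.dy i)) :
    ‖jacXY (p.gBar i) x y‖ ≤ c.Lgy := by
  rw [jacXY, LinearIsometryEquiv.norm_map]
  exact norm_fderiv_le_of_lip' ℝ hc.Lgy_nonneg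
    (.of_forall fun x' => (hp.lipJoint_gradY_gBar i).left x' x y)

theorem norm_phS_sub_le (ξ : Ξ) (ζ : Z) {x x' : Vec p.dx} {y y' v v' : Vec (p.dy i)}
    (hv' : ‖v'‖ ≤ c.V) : ‖p.phS i ξ ζ x y v - p.phS i ξ ζ x' y' v'‖
      ≤ c.lip * √(‖x - x'‖ ^ 2 + ‖y - y'‖ ^ 2 + ‖v - v'‖ ^ 2) :=
  (norm_affine_sub_le (hp.lip_fy i ξ) (hp.lip_gyy i ζ) (hp.bdd_gyy i ζ) hc.Lfy_nonneg
    hc.Lgyy_nonneg hv').trans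
    (mul_le_mul_of_nonneg_right hc.le_lip.2.2.1 (Real.sqrt_nonneg _))

theorem norm_phBar_sub_le {x x' : Vec p.dx} {y y' v v' : Vec (p.dy i)}
    (hv' : ‖v'‖ ≤ c.V) : ‖p.phBar i x y v - p.phBar i x' y' v'‖
      ≤ c.lip * √(‖x - x'‖ ^ 2 + ‖y - y'‖ ^ 2 + ‖v - v'‖ ^ 2) :=
  (norm_affine_sub_le (hp.lipJoint_gradY_fBar i) (hp.lipJoint_hessYY_gBar i)
    (hp.norm_hessYY_gBar_le i) hc.Lfy_nonneg hc.Lgyy_nonneg hv').trans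
    (mul_le_mul_of_nonneg_right hc.le_lip.2.2.1 (Real.sqrt_nonneg _))

theorem norm_txS_sub_le (ξ : Ξ) (ζ : Z) {x x' : Vec p.dx} {y y' v v' : Vec (p.dy i)}
    (hv' : ‖v'‖ ≤ c.V) : ‖p.txS i ξ ζ x y v - p.txS i ξ ζ x' y' v'‖
      ≤ c.lip * √(‖x - x'‖ ^ 2 + ‖y - y'‖ ^ 2 + ‖v - v'‖ ^ 2) := by
  rw [← norm_neg]
  refine (le_of_eq ?_).trans ((norm_affine_sub_le (hp.lip_fx i ξ) (hp.lip_gxy i ζ)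
    (hp.norm_jacXY_gS_le hc i ζ) hc.Lfx_nonneg hc.Lgxy_nonneg hv').trans
    (mul_le_mul_of_nonneg_right hc.le_lip.2.2.2.1 (Real.sqrt_nonneg _)))
  congr 1
  simp only [txS]
  abel

theorem norm_txBar_sub_le {x x' : Vec p.dx} {y y' v v' : Vec (p.dy i)}
    (hv' : ‖v'‖ ≤ c.V) : ‖p.txBar i x y v - p.txBar i x' y' v'‖
      ≤ c.lip * √(‖x - x'‖ ^ 2 + ‖y - y'‖ ^ 2 + ‖v - v'‖ ^ 2) := by
  rw [← norm_neg]
  refine (le_of_eq ?_).trans ((norm_affine_sub_le (hp.lipJoint_gradX_fBar i)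
    (hp.lipJoint_jacXY_gBar i) (hp.norm_jacXY_gBar_le hc i) hc.Lfx_nonneg hc.Lgxy_nonneg
    hv').trans
    (mul_le_mul_of_nonneg_right hc.le_lip.2.2.2.1 (Real.sqrt_nonneg _)))
  congr 1
  simp only [txBar]
  abel

end Lipschitz

end Assumptions

end Problem

end BSVRB


/-! ### Lower-level solutions and the hypergradient -/

namespace BSVRB

open Filter Topology

namespace Problem.Assumptions

variable {m : ℕ} {Ξ Z : Type*} [MeasurableSpace Ξ] [MeasurableSpace Z] {p : Problem m Ξ Z}
  {c : Consts} (hp : p.Assumptions c) (hc : c.Valid) (i : Fin m)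
include hp

theorem hasGradientAt_gBar (x : Vec p.dx) (y : Vec (p.dy i)) :
    HasGradientAt (p.gBar i x) (gradY (p.gBar i) x y) y := by
  rw [hp.gradY_gBar]
  exact hp.hasGradientAt_gBar_right i x y

/-- The Hessian is merely the derivative of the gradient, so its symmetry comes from Schwarz's
theorem. It identifies `vSol` with the solution of a linear system and lets v be moved across the
Hessian in the hypergradient formula. -/
theorem inner_hessYY_comm (x : Vec p.dx) (y v w : Vec (p.dy i)) :
    inner ℝ (hessYY (p.gBar i) x y v) w = inner ℝ v (hessYY (p.gBar i) x y w) := by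
  have h := second_derivative_symmetric (𝕜 := ℝ) (f := p.gBar i x)
    (f' := fun y => InnerProductSpace.toDual ℝ _ (gradY (p.gBar i) x y))
    (f'' := (InnerProductSpace.toDual ℝ
      (Vec (p.dy i))).toLinearIsometry.toContinuousLinearMap.comp (hessYY (p.gBar i) x y))
    (fun y => (hp.hasGradientAt_gBar i x y).hasFDerivAt)
    (((InnerProductSpace.toDual ℝ
      (Vec (p.dy i))).toLinearIsometry.toContinuousLinearMap.hasFDerivAt).comp y
      (hp.hasFDerivAt_hessYY i x y)) v w
  simp only [ContinuousLinearMap.comp_apply] at h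
  have h1 : inner ℝ (hessYY (p.gBar i) x y v) w = inner ℝ (hessYY (p.gBar i) x y w) v := h
  rw [h1, real_inner_comm]

theorem inner_gradY_sub_ge (x : Vec p.dx) (y y' : Vec (p.dy i)) :
    c.lam * ‖y - y'‖ ^ 2
      ≤ inner ℝ (gradY (p.gBar i) x y - gradY (p.gBar i) x y') (y - y') :=
  inner_sub_ge_of_hessian_ge (hp.hasFDerivAt_hessYY i x) (fun y w => hp.hess_ge i x y w) y y'

theorem inner_phBar_sub_ge (x : Vec p.dx) (y v v' : Vec (p.dy i)) :
    c.lam * ‖v - v'‖ ^ 2 ≤ inner ℝ (p.phBar i x y v - p.phBar i x y v') (v - v') := by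
  have h := hp.hess_ge i x y (v - v')
  rwa [phBar, phBar, sub_sub_sub_cancel_right, ← map_sub, real_inner_comm]

include hc

theorem gradY_ySol (x : Vec p.dx) : gradY (p.gBar i) x (p.ySol i x) = 0 := by
  have hmin := argminPt_spec (exists_isMin_of_strongConvex hc.lam_pos (hp.hasGradientAt_gBar i x)
    (hp.inner_gradY_sub_ge i x))
  have h1 : IsLocalMin (p.gBar i x) (p.ySol i x) := .of_forall hmin
  have h2 := h1.hasFDerivAt_eq_zero (hp.hasGradientAt_gBar i x (p.ySol i x)).hasFDerivAt
  simpa using h2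

theorem phBar_vSol (x : Vec p.dx) (y : Vec (p.dy i)) : p.phBar i x y (p.vSol i x y) = 0 := by
  rw [phBar, sub_eq_zero]
  exact argminPt_quadratic hc.lam_pos (hp.inner_hessYY_comm i x y) (fun w => hp.hess_ge i x y w)

theorem hessYY_vSol (x : Vec p.dx) (y : Vec (p.dy i)) :
    hessYY (p.gBar i) x y (p.vSol i x y) = gradY (p.fBar i) x y :=
  sub_eq_zero.1 (hp.phBar_vSol hc i x y)

theorem inner_gradY_ge (x : Vec p.dx) (y : Vec (p.dy i)) :
    c.lam * ‖y - p.ySol i x‖ ^ 2 ≤ inner ℝ (gradY (p.gBar i) x y) (y - p.ySol i x) := by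
  simpa [hp.gradY_ySol hc] using hp.inner_gradY_sub_ge i x y (p.ySol i x)

theorem norm_gradY_le (x : Vec p.dx) (y : Vec (p.dy i)) :
    ‖gradY (p.gBar i) x y‖ ≤ c.lip * ‖y - p.ySol i x‖ := by
  have h := (hp.lipJoint_gradY_gBar i).right x y (p.ySol i x)
  rw [hp.gradY_ySol hc, sub_zero] at h
  exact h.trans (mul_le_mul_of_nonneg_right hc.le_lip.2.1 (norm_nonneg _))

theorem inner_phBar_ge (x : Vec p.dx) (y v : Vec (p.dy i)) :
    c.lam * ‖v - p.vSol i x y‖ ^ 2 ≤ inner ℝ (p.phBar i x y v) (v - p.vSol i x y) := by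
  simpa [hp.phBar_vSol hc] using hp.inner_phBar_sub_ge i x y v (p.vSol i x y)

/-- Coercivity against the bound on the right-hand side: λ‖v‖² ≤ ⟨v, ∇_y f⟩ ≤ C_fy ‖v‖. This is why
projecting onto the ball of radius V never moves v away from its target. -/
theorem norm_vSol_le (x : Vec p.dx) (y : Vec (p.dy i)) : ‖p.vSol i x y‖ ≤ c.V := by
  set v := p.vSol i x y with hv
  have h1 := hp.hess_ge i x y v
  rw [hv, hp.hessYY_vSol hc, ← hv] at h1
  have h2 := (real_inner_le_norm v (gradY (p.fBar i) x y)).trans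
    (mul_le_mul_of_nonneg_left (hp.bdd_fy i x y) (norm_nonneg v))
  rw [Consts.V, le_div_iff₀ hc.lam_pos]
  rcases (norm_nonneg v).eq_or_lt with h0 | h0
  · rw [← h0, zero_mul]; exact hc.Cfy_nonneg
  · refine le_of_mul_le_mul_left ?_ h0
    nlinarith

theorem norm_phBar_le (x : Vec p.dx) (y v : Vec (p.dy i)) :
    ‖p.phBar i x y v‖ ≤ c.lip * ‖v - p.vSol i x y‖ := by
  have h := hp.norm_phBar_sub_le hc i (x := x) (x' := x) (y := y) (y' := y) (v := v)
    (hp.norm_vSol_le hc i x y)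
  rw [hp.phBar_vSol hc, sub_zero] at h
  simpa using h

theorem norm_ySol_sub_le (x x' : Vec p.dx) :
    ‖p.ySol i x - p.ySol i x'‖ ≤ c.ratio * ‖x - x'‖ := by
  have h1 := hp.inner_gradY_sub_ge i x (p.ySol i x) (p.ySol i x')
  -- The zero gradient at (x, y_i(x)) is exchanged for the zero gradient at (x', y_i(x')). Both
  -- remaining gradients are then taken at the same y, where only the change of x counts.
  rw [hp.gradY_ySol hc, ← hp.gradY_ySol hc i x'] at h1
  have h2 := (hp.lipJoint_gradY_gBar i).left x' x (p.ySol i x')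
  have h3 := real_inner_le_norm (gradY (p.gBar i) x' (p.ySol i x') -
    gradY (p.gBar i) x (p.ySol i x')) (p.ySol i x - p.ySol i x')
  have h4 : c.Lgy * ‖x' - x‖ ≤ c.lip * ‖x - x'‖ := by
    rw [norm_sub_rev]
    exact mul_le_mul_of_nonneg_right hc.le_lip.2.1 (norm_nonneg _)
  rw [Consts.ratio, div_mul_eq_mul_div, le_div_iff₀ hc.lam_pos]
  have h5 : 0 ≤ c.lip * ‖x - x'‖ :=
    mul_nonneg (zero_le_one.trans hc.one_le_lip) (norm_nonneg _)
  rcases (norm_nonneg (p.ySol i x - p.ySol i x')).eq_or_lt with h0 | h0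
  · rw [← h0, zero_mul]; exact h5
  · refine le_of_mul_le_mul_left ?_ h0
    nlinarith [mul_le_mul_of_nonneg_right (h2.trans h4) h0.le]

theorem norm_vSol_sub_le (x x' : Vec p.dx) (y y' : Vec (p.dy i)) :
    ‖p.vSol i x y - p.vSol i x' y'‖ ≤ c.ratio * √(‖x - x'‖ ^ 2 + ‖y - y'‖ ^ 2) := by
  set v := p.vSol i x y with hv
  set v' := p.vSol i x' y' with hv'
  have h1 := hp.inner_phBar_sub_ge i x y v v'
  rw [hv, hp.phBar_vSol hc, ← hp.phBar_vSol hc i x' y', ← hv, ← hv'] at h1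
  have h2 : ‖p.phBar i x' y' v' - p.phBar i x y v'‖ ≤ c.lip * √(‖x - x'‖ ^ 2 + ‖y - y'‖ ^ 2) := by
    have h := hp.norm_phBar_sub_le hc i (x := x) (x' := x') (y := y) (y' := y') (v := v') (v' := v')
      (hp.norm_vSol_le hc i x' y')
    rw [norm_sub_rev]
    simpa using h
  have h3 := real_inner_le_norm (p.phBar i x' y' v' - p.phBar i x y v') (v - v')
  rw [Consts.ratio, div_mul_eq_mul_div, le_div_iff₀ hc.lam_pos]
  have h5 : 0 ≤ c.lip * √(‖x - x'‖ ^ 2 + ‖y - y'‖ ^ 2) :=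
    mul_nonneg (zero_le_one.trans hc.one_le_lip) (Real.sqrt_nonneg _)
  rcases (norm_nonneg (v - v')).eq_or_lt with h0 | h0
  · rw [← h0, zero_mul]; exact h5
  · refine le_of_mul_le_mul_left ?_ h0
    nlinarith [mul_le_mul_of_nonneg_right h2 h0.le]

omit hp hc in
theorem sqrt_sq_add_sq_le {a b : ℝ} (ha : 0 ≤ a) (hb : 0 ≤ b) : √(a ^ 2 + b ^ 2) ≤ a + b :=
  Real.sqrt_le_iff.2 ⟨add_nonneg ha hb, by nlinarith [mul_nonneg ha hb]⟩

omit hp hc in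
theorem sqrt_add_three_sq_le {a b d : ℝ} (ha : 0 ≤ a) (hb : 0 ≤ b) (hd : 0 ≤ d) :
    √(a ^ 2 + b ^ 2 + d ^ 2) ≤ a + b + d :=
  Real.sqrt_le_iff.2 ⟨by positivity,
    by nlinarith [mul_nonneg ha hb, mul_nonneg ha hd, mul_nonneg hb hd]⟩

omit hc in
theorem hasGradientAt_fBar_ySol_aux (x x' : Vec p.dx) (y y' : Vec (p.dy i)) :
    |p.fBar i x' y' - p.fBar i x y - inner ℝ (gradX (p.fBar i) x y) (x' - x)
      - inner ℝ (gradY (p.fBar i) x y) (y' - y)|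
      ≤ 2 * (|c.Lfx| + |c.Lfy|) * (‖x' - x‖ + ‖y' - y‖) ^ 2 := by
  have h := norm_partial_expansion_le (h := p.fBar i) (L := |c.Lfx| + |c.Lfy|)
    (A := fun x y => InnerProductSpace.toDual ℝ _ (gradX (p.fBar i) x y))
    (B := fun x y => InnerProductSpace.toDual ℝ _ (gradY (p.fBar i) x y)) (by positivity)
    (fun x y => by
      rw [hp.gradX_fBar]; exact (hp.hasGradientAt_fBar_left i x y).hasFDerivAt)
    (fun x y => by
      rw [hp.gradY_fBar]; exact (hp.hasGradientAt_fBar_right i x y).hasFDerivAt)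
    (fun x y x' y' => by
      rw [← map_sub, LinearIsometryEquiv.norm_map]
      refine (hp.lipJoint_gradX_fBar i x y x' y').trans ?_
      gcongr
      linarith [le_abs_self c.Lfx, abs_nonneg c.Lfy])
    (fun x y x' y' => by
      rw [← map_sub, LinearIsometryEquiv.norm_map]
      refine (hp.lipJoint_gradY_fBar i x y x' y').trans ?_
      gcongr
      linarith [le_abs_self c.Lfy, abs_nonneg c.Lfx]) x x' y y'
  simpa using h

omit hc in
theorem gradY_gBar_expansion (x x' : Vec p.dx) (y y' : Vec (p.dy i)) :
    ‖gradY (p.gBar i) x' y' - gradY (p.gBar i) x y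
      - ContinuousLinearMap.adjoint (jacXY (p.gBar i) x y) (x' - x)
      - hessYY (p.gBar i) x y (y' - y)‖
      ≤ 2 * (|c.Lgxy| + |c.Lgyy|) * (‖x' - x‖ + ‖y' - y‖) ^ 2 :=
  norm_partial_expansion_le (h := gradY (p.gBar i)) (L := |c.Lgxy| + |c.Lgyy|)
    (A := fun x y => ContinuousLinearMap.adjoint (jacXY (p.gBar i) x y))
    (B := fun x y => hessYY (p.gBar i) x y) (by positivity)
    (fun x y => hp.hasFDerivAt_adjoint_jacXY i x y)
    (fun x y => hp.hasFDerivAt_hessYY i x y)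
    (fun x y x' y' => by
      rw [← map_sub, LinearIsometryEquiv.norm_map]
      refine (hp.lipJoint_jacXY_gBar i x y x' y').trans ?_
      gcongr
      linarith [le_abs_self c.Lgxy, abs_nonneg c.Lgyy])
    (fun x y x' y' => by
      refine (hp.lipJoint_hessYY_gBar i x y x' y').trans ?_
      gcongr
      linarith [le_abs_self c.Lgyy, abs_nonneg c.Lgxy]) x x' y y'

/-- Implicit differentiation: the gradient of `x ↦ f_i(x, y_i(x))`. -/
theorem hasGradientAt_fBar_ySol (x : Vec p.dx) :
    HasGradientAt (fun x => p.fBar i x (p.ySol i x))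
      (p.txBar i x (p.ySol i x) (p.vSol i x (p.ySol i x))) x := by
  set y := p.ySol i x with hy
  set v := p.vSol i x y with hv
  refine hasGradientAt_of_sq_bound
    (C := (2 * (|c.Lfx| + |c.Lfy|) + c.V * (2 * (|c.Lgxy| + |c.Lgyy|))) * (1 + c.ratio) ^ 2)
    fun x' => ?_
  set y' := p.ySol i x' with hy'
  have h1 := hp.hasGradientAt_fBar_ySol_aux i x x' y y'
  have h2 := hp.gradY_gBar_expansion i x x' y y'
  rw [hy', hp.gradY_ySol hc, hy, hp.gradY_ySol hc, ← hy, ← hy'] at h2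
  -- Since ∇_y g vanishes at both solutions, its expansion reduces to a remainder `r` that is
  -- quadratic in x' - x. Pairing `r` with v, where H v = ∇_y f, eliminates y' - y, so y_i need not
  -- be differentiated.
  set r := 0 - 0 - ContinuousLinearMap.adjoint (jacXY (p.gBar i) x y) (x' - x)
      - hessYY (p.gBar i) x y (y' - y) with hr
  have h3 : inner ℝ (gradY (p.fBar i) x y) (y' - y)
      = - inner ℝ (jacXY (p.gBar i) x y v) (x' - x) - inner ℝ v r := by
    rw [← hp.hessYY_vSol hc i x y, ← hv, hp.inner_hessYY_comm, hr,
      ← ContinuousLinearMap.adjoint_inner_right]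
    simp only [inner_sub_right, inner_zero_right]
    ring
  have h4 : p.fBar i x' y' - p.fBar i x y - inner ℝ (p.txBar i x y v) (x' - x)
      = (p.fBar i x' y' - p.fBar i x y - inner ℝ (gradX (p.fBar i) x y) (x' - x)
      - inner ℝ (gradY (p.fBar i) x y) (y' - y)) - inner ℝ v r := by
    rw [h3, txBar, inner_sub_left]; ring
  have h5 : |inner ℝ v r| ≤ c.V * (2 * (|c.Lgxy| + |c.Lgyy|) * (‖x' - x‖ + ‖y' - y‖) ^ 2) :=
    (abs_real_inner_le_norm v r).trans
      (mul_le_mul (hp.norm_vSol_le hc i x y) h2 (norm_nonneg _) hc.V_nonneg)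
  have h6 : (‖x' - x‖ + ‖y' - y‖) ^ 2 ≤ (1 + c.ratio) ^ 2 * ‖x' - x‖ ^ 2 := by
    rw [← mul_pow]
    have := hp.norm_ySol_sub_le hc i x' x
    gcongr
    linarith
  rw [h4]
  refine (abs_sub _ _).trans ?_
  have h7 : 0 ≤ 2 * (|c.Lfx| + |c.Lfy|) + c.V * (2 * (|c.Lgxy| + |c.Lgyy|)) := by
    have := hc.V_nonneg
    positivity
  nlinarith [mul_le_mul_of_nonneg_left h6 h7]

/-- The hypergradient formula. -/
theorem hasGradientAt_F (x : Vec p.dx) :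
    HasGradientAt p.F
      ((m : ℝ)⁻¹ • ∑ i, p.txBar i x (p.ySol i x) (p.vSol i x (p.ySol i x))) x := by
  rw [hasGradientAt_iff_hasFDerivAt, map_smul, map_sum]
  exact (HasFDerivAt.fun_sum fun i _ => (hp.hasGradientAt_fBar_ySol hc i x).hasFDerivAt).const_mul _

theorem differentiable_F : Differentiable ℝ p.F := fun x => (hp.hasGradientAt_F hc x).differentiableAt

theorem norm_txBar_ySol_sub_le (x x' : Vec p.dx) :
    ‖p.txBar i x (p.ySol i x) (p.vSol i x (p.ySol i x))
      - p.txBar i x' (p.ySol i x') (p.vSol i x' (p.ySol i x'))‖ ≤ c.LFc * ‖x - x'‖ := by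
  have h1 := hp.norm_txBar_sub_le hc i (x := x) (x' := x') (y := p.ySol i x) (y' := p.ySol i x')
    (v := p.vSol i x (p.ySol i x)) (hp.norm_vSol_le hc i x' (p.ySol i x'))
  have h2 := hp.norm_ySol_sub_le hc i x x'
  have h3 := hp.norm_vSol_sub_le hc i x x' (p.ySol i x) (p.ySol i x')
  have h4 := sqrt_sq_add_sq_le (norm_nonneg (x - x')) (norm_nonneg (p.ySol i x - p.ySol i x'))
  have h5 := sqrt_add_three_sq_le (norm_nonneg (x - x')) (norm_nonneg (p.ySol i x - p.ySol i x'))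
    (norm_nonneg (p.vSol i x (p.ySol i x) - p.vSol i x' (p.ySol i x')))
  have h6 := hc.ratio_nonneg
  have h7 := mul_le_mul_of_nonneg_left (h4.trans (add_le_add_right h2 _)) h6
  refine h1.trans ?_
  rw [Consts.LFc, mul_assoc]
  refine mul_le_mul_of_nonneg_left ?_ (zero_le_one.trans hc.one_le_lip)
  nlinarith

theorem norm_gradient_F_sub_le (x x' : Vec p.dx) :
    ‖gradient p.F x - gradient p.F x'‖ ≤ c.LFc * ‖x - x'‖ := by
  rw [(hp.hasGradientAt_F hc x).gradient, (hp.hasGradientAt_F hc x').gradient, ← smul_sub,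
    ← Finset.sum_sub_distrib, norm_smul, norm_inv, RCLike.norm_natCast]
  rcases Nat.eq_zero_or_pos m with h0 | h0
  · subst h0
    simpa using mul_nonneg hc.LFc_pos.le (norm_nonneg (x - x'))
  · have h1 := norm_sum_le_of_le Finset.univ
      (fun i (_ : i ∈ Finset.univ) => hp.norm_txBar_ySol_sub_le hc i x x')
    rw [Finset.sum_const, Finset.card_univ, Fintype.card_fin, nsmul_eq_mul] at h1
    rw [inv_mul_le_iff₀ (by exact_mod_cast h0)]
    exact h1

end Problem.Assumptions

end BSVRB


/-! ### Error measures and pathwise recursions -/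

namespace BSVRB

/-- The average of a function over the blocks. -/
noncomputable def avg {m : ℕ} (f : Fin m → ℝ) : ℝ := (m : ℝ)⁻¹ * ∑ i, f i

section Avg

variable {m : ℕ} {f g : Fin m → ℝ}

theorem avg_mono (h : ∀ i, f i ≤ g i) : avg f ≤ avg g :=
  mul_le_mul_of_nonneg_left (Finset.sum_le_sum fun i _ => h i) (by positivity)

theorem avg_nonneg (h : ∀ i, 0 ≤ f i) : 0 ≤ avg f :=
  mul_nonneg (by positivity) (Finset.sum_nonneg fun i _ => h i)

theorem avg_add (f g : Fin m → ℝ) : avg (fun i => f i + g i) = avg f + avg g := by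
  simp only [avg, Finset.sum_add_distrib, mul_add]

theorem avg_mul_left (a : ℝ) (f : Fin m → ℝ) : avg (fun i => a * f i) = a * avg f := by
  simp only [avg, ← Finset.mul_sum]
  ring

theorem avg_const (hm : 1 ≤ m) (a : ℝ) : avg (fun _ : Fin m => a) = a := by
  have : (m : ℝ) ≠ 0 := by positivity
  simp [avg, this]

theorem norm_sq_average_le {E : Type*} [NormedAddCommGroup E] [NormedSpace ℝ E] (f : Fin m → E) :
    ‖(m : ℝ)⁻¹ • ∑ i, f i‖ ^ 2 ≤ avg fun i => ‖f i‖ ^ 2 := by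
  rcases Nat.eq_zero_or_pos m with h0 | h0
  · subst h0; simp [avg]
  have hm : (0 : ℝ) < m := by exact_mod_cast h0
  have h1 : ‖∑ i, f i‖ ^ 2 ≤ m * ∑ i, ‖f i‖ ^ 2 := by
    calc ‖∑ i, f i‖ ^ 2 ≤ (∑ i, ‖f i‖) ^ 2 := by gcongr; exact norm_sum_le _ _
      _ ≤ _ := by simpa using sq_sum_le_card_mul_sum_sq (s := Finset.univ) (f := fun i => ‖f i‖)
  rw [norm_smul, mul_pow, norm_inv, RCLike.norm_natCast, avg]
  calc ((m : ℝ)⁻¹) ^ 2 * ‖∑ i, f i‖ ^ 2 ≤ ((m : ℝ)⁻¹) ^ 2 * (m * ∑ i, ‖f i‖ ^ 2) := by gcongr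
    _ = (m : ℝ)⁻¹ * ∑ i, ‖f i‖ ^ 2 := by field_simp

end Avg

section Geometry

theorem norm_sub_sq_le_two {E : Type*} [SeminormedAddCommGroup E] (a b e : E) : ‖a - e‖ ^ 2 ≤ 2 * ‖a - b‖ ^ 2 + 2 * ‖b - e‖ ^ 2 := by
  have h : ‖a - e‖ ≤ ‖a - b‖ + ‖b - e‖ := norm_sub_le_norm_sub_add_norm_sub a b e
  nlinarith [norm_nonneg (a - e), sq_nonneg (‖a - b‖ - ‖b - e‖), norm_nonneg (a - b),
    norm_nonneg (b - e)]

variable {E : Type*} [NormedAddCommGroup E] [InnerProductSpace ℝ E]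

/-- Expanding the square gives -2h⟨g, e⟩ ≤ -2h lam ‖e‖², and h K ≤ lam lets the quadratic term spend
only half of it. -/
theorem norm_sq_sub_smul_le {g e : E} {h lam K : ℝ} (hh : 0 ≤ h) (hK : h * K ≤ lam)
    (h1 : lam * ‖e‖ ^ 2 ≤ inner ℝ g e) (h2 : ‖g‖ ^ 2 ≤ K * ‖e‖ ^ 2) :
    ‖e - h • g‖ ^ 2 ≤ (1 - h * lam) * ‖e‖ ^ 2 := by
  rw [norm_sub_sq_real, norm_smul, inner_smul_right, real_inner_comm, Real.norm_of_nonneg hh]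
  have h3 : h * (h * ‖g‖ ^ 2) ≤ h * (lam * ‖e‖ ^ 2) := by
    refine mul_le_mul_of_nonneg_left ?_ hh
    nlinarith [sq_nonneg ‖e‖, mul_le_mul_of_nonneg_left h2 hh,
      mul_le_mul_of_nonneg_right hK (sq_nonneg ‖e‖)]
  nlinarith [mul_le_mul_of_nonneg_left h1 hh]

theorem sq_le_of_contraction {n a e w Q h lam : ℝ} (hh : 0 < h) (hlam : 0 < lam)
    (hr : h * lam ≤ 2) (hn : 0 ≤ n) (hle : n ≤ a + (h * e + w)) (ha : a ^ 2 ≤ (1 - h * lam) * Q)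
    (hQ : 0 ≤ Q) :
    n ^ 2 ≤ (1 - h * lam / 2) * Q + 8 * h / lam * e ^ 2 + 8 / (h * lam) * w ^ 2 := by
  set r := h * lam / 2 with hrd
  have hr0 : 0 < r := by positivity
  have hr1 : r ≤ 1 := by linarith
  set b := h * e + w with hb
  have h1 : n ^ 2 ≤ (a + b) ^ 2 := by gcongr
  have h2 : (a + b) ^ 2 ≤ (1 + r) * a ^ 2 + 2 / r * b ^ 2 := by
    have h3 : 2 * (a * b) ≤ r * a ^ 2 + 1 / r * b ^ 2 := by
      have h4 : 0 ≤ (r * a - b) ^ 2 / r := by positivity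
      have h5 : (r * a - b) ^ 2 / r = r * a ^ 2 + 1 / r * b ^ 2 - 2 * (a * b) := by
        field_simp; ring
      linarith
    have h6 : b ^ 2 ≤ 1 / r * b ^ 2 := by
      have : 1 ≤ 1 / r := by rw [le_div_iff₀ hr0]; linarith
      nlinarith [sq_nonneg b]
    have h7 : 2 / r * b ^ 2 = 1 / r * b ^ 2 + 1 / r * b ^ 2 := by ring
    nlinarith
  have h3 : (1 + r) * a ^ 2 ≤ (1 - r) * Q := by
    have h4 : a ^ 2 ≤ (1 - 2 * r) * Q := by rw [hrd]; linarith
    nlinarith [mul_le_mul_of_nonneg_left h4 (by linarith : 0 ≤ 1 + r), mul_nonneg hr0.le hQ,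
      mul_nonneg (sq_nonneg r) hQ]
  have h4 : 2 / r * b ^ 2 ≤ 2 / r * (2 * (h * e) ^ 2 + 2 * w ^ 2) := by
    gcongr
    rw [hb]
    nlinarith [sq_nonneg (h * e - w)]
  have h5 : 2 / r * (2 * (h * e) ^ 2 + 2 * w ^ 2)
      = 8 * h / lam * e ^ 2 + 8 / (h * lam) * w ^ 2 := by
    rw [hrd]; field_simp; ring
  linarith

theorem norm_projBall_le {d : ℕ} {r : ℝ} (hr : 0 ≤ r) (w : Vec d) : ‖projBall r w‖ ≤ r := by
  unfold projBall
  split_ifs with h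
  · exact h
  · have h0 : 0 < ‖w‖ := hr.trans_lt (not_le.1 h)
    rw [norm_smul, Real.norm_of_nonneg (by positivity), div_mul_cancel₀ _ h0.ne']

/-- For ‖a‖ > r put s = r / ‖a‖. The squared distances differ by (1 - s)((1 + s)‖a‖² - 2⟨a, b⟩),
which is nonnegative because s‖a‖ = r and ⟨a, b⟩ ≤ r‖a‖. -/
theorem norm_projBall_sub_le {d : ℕ} {r : ℝ} (hr : 0 ≤ r) (a : Vec d) {b : Vec d} (hb : ‖b‖ ≤ r) :
    ‖projBall r a - b‖ ≤ ‖a - b‖ := by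
  unfold projBall
  split_ifs with h
  · exact le_rfl
  · have hra := not_le.1 h
    have h0 : 0 < ‖a‖ := hr.trans_lt hra
    set s := r / ‖a‖ with hs
    have hs0 : 0 ≤ s := by positivity
    have hs1 : s ≤ 1 := (div_le_one h0).2 hra.le
    have hsa : s * ‖a‖ = r := div_mul_cancel₀ _ h0.ne'
    refine le_of_sq_le_sq ?_ (norm_nonneg _)
    rw [norm_sub_sq_real, norm_sub_sq_real, norm_smul, real_inner_smul_left,
      Real.norm_of_nonneg hs0]
    have h1 : inner ℝ a b ≤ ‖a‖ * r :=
      (real_inner_le_norm a b).trans (mul_le_mul_of_nonneg_left hb h0.le)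
    have h2 : 0 ≤ (1 - s) * ((1 + s) * ‖a‖ ^ 2 - 2 * inner ℝ a b) := by
      refine mul_nonneg (by linarith) ?_
      have : (1 + s) * ‖a‖ ^ 2 = ‖a‖ ^ 2 + r * ‖a‖ := by rw [← hsa]; ring
      nlinarith
    nlinarith

end Geometry

section States

variable {m : ℕ} {Ξ Z : Type*} [MeasurableSpace Ξ] [MeasurableSpace Z]

/-- Mean squared distance of the `y`-variables to the lower-level solutions. -/
noncomputable def errY (p : Problem m Ξ Z) (w : State p) : ℝ :=
  avg fun i => ‖w.y i - p.ySol i w.x‖ ^ 2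

/-- Mean squared distance of the `v`-variables to the solutions of the linear systems. -/
noncomputable def errV (p : Problem m Ξ Z) (w : State p) : ℝ :=
  avg fun i => ‖w.v i - p.vSol i w.x (w.y i)‖ ^ 2

/-- Mean squared error of the estimators `s` as estimators at the variables `a`. -/
noncomputable def errS (p : Problem m Ξ Z) (a w : State p) : ℝ :=
  avg fun i => ‖w.s i - gradY (p.gBar i) a.x (a.y i)‖ ^ 2

/-- Mean squared error of the estimators `u` as estimators at the variables `a`. -/
noncomputable def errU (p : Problem m Ξ Z) (a w : State p) : ℝ :=
  avg fun i => ‖w.u i - p.phBar i a.x (a.y i) (a.v i)‖ ^ 2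

/-- Squared error of `z` as an estimator at the variables `a`. -/
noncomputable def errZ (p : Problem m Ξ Z) (a w : State p) : ℝ := ‖w.z - trackedGrad p a‖ ^ 2

/-- Squared distance of the variables of one block. -/
noncomputable def blockDist (p : Problem m Ξ Z) (a w : State p) (i : Fin m) : ℝ :=
  ‖w.x - a.x‖ ^ 2 + ‖w.y i - a.y i‖ ^ 2 + ‖w.v i - a.v i‖ ^ 2

/-- Mean squared displacement between two states. -/
noncomputable def moved (p : Problem m Ξ Z) (a w : State p) : ℝ := avg (blockDist p a w)

variable {p : Problem m Ξ Z}

theorem errY_nonneg (w : State p) : 0 ≤ errY p w := avg_nonneg fun _ => sq_nonneg _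
theorem errV_nonneg (w : State p) : 0 ≤ errV p w := avg_nonneg fun _ => sq_nonneg _
theorem errS_nonneg (a w : State p) : 0 ≤ errS p a w := avg_nonneg fun _ => sq_nonneg _
theorem errU_nonneg (a w : State p) : 0 ≤ errU p a w := avg_nonneg fun _ => sq_nonneg _
theorem errZ_nonneg (a w : State p) : 0 ≤ errZ p a w := sq_nonneg _
theorem blockDist_nonneg (a w : State p) (i : Fin m) : 0 ≤ blockDist p a w i := by
  unfold blockDist; positivity
theorem moved_nonneg (a w : State p) : 0 ≤ moved p a w := avg_nonneg (blockDist_nonneg a w)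

theorem moved_self (w : State p) : moved p w w = 0 := by
  simp [moved, blockDist, avg]

theorem trackedGrad_eq (w : State p) :
    trackedGrad p w = (m : ℝ)⁻¹ • ∑ i, p.txBar i w.x (w.y i) (w.v i) := rfl

theorem totalError_eq (w : State p) :
    totalError p w = errZ p w w + (errY p w + errV p w + errS p w w + errU p w w) := by
  simp only [totalError, errZ, errY, errV, errS, errU, Problem.phBar, ← avg_add]
  rfl

variable {c : Consts} (hp : p.Assumptions c) (hc : c.Valid)

omit [MeasurableSpace Ξ] [MeasurableSpace Z] in
theorem sq_le_K_mul {c : Consts} (hc : c.Valid) {n D : ℝ} (hn : 0 ≤ n) (hD : 0 ≤ D)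
    (h : n ≤ c.lip * √D) : n ^ 2 ≤ c.K * D := by
  calc n ^ 2 ≤ (c.lip * √D) ^ 2 := by gcongr
    _ = c.lip ^ 2 * D := by rw [mul_pow, Real.sq_sqrt hD]
    _ ≤ c.K * D := by gcongr; exact hc.lip_sq_le_K

include hp hc

theorem norm_gradY_sub_sq_le (a w : State p) (i : Fin m) :
    ‖gradY (p.gBar i) w.x (w.y i) - gradY (p.gBar i) a.x (a.y i)‖ ^ 2
      ≤ c.K * blockDist p a w i := by
  refine sq_le_K_mul hc (norm_nonneg _) (blockDist_nonneg a w i) ?_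
  refine (hp.lipJoint_gradY_gBar i _ _ _ _).trans ?_
  refine mul_le_mul hc.le_lip.2.1 (Real.sqrt_le_sqrt ?_) (Real.sqrt_nonneg _)
    (zero_le_one.trans hc.one_le_lip)
  unfold blockDist
  linarith [sq_nonneg ‖w.v i - a.v i‖]

theorem norm_phBar_sub_sq_le (a w : State p) (i : Fin m) (ha : ‖a.v i‖ ≤ c.V) :
    ‖p.phBar i w.x (w.y i) (w.v i) - p.phBar i a.x (a.y i) (a.v i)‖ ^ 2
      ≤ c.K * blockDist p a w i :=
  sq_le_K_mul hc (norm_nonneg _) (blockDist_nonneg a w i) (hp.norm_phBar_sub_le hc i ha)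

theorem norm_txBar_sub_sq_le (a w : State p) (i : Fin m) (ha : ‖a.v i‖ ≤ c.V) :
    ‖p.txBar i w.x (w.y i) (w.v i) - p.txBar i a.x (a.y i) (a.v i)‖ ^ 2
      ≤ c.K * blockDist p a w i :=
  sq_le_K_mul hc (norm_nonneg _) (blockDist_nonneg a w i) (hp.norm_txBar_sub_le hc i ha)

/-- After an update an estimator tracks its target at the variables where the samples were
evaluated, one step behind. The next update uses it at the new variables, and the lag costs a
multiple of the displacement. -/
theorem errS_self_le (a w : State p) : errS p w w ≤ 2 * errS p a w + 2 * c.K * moved p a w := by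
  rw [errS, errS, moved, ← avg_mul_left, ← avg_mul_left, ← avg_add]
  refine avg_mono fun i => (norm_sub_sq_le_two _ (gradY (p.gBar i) a.x (a.y i)) _).trans ?_
  have := norm_gradY_sub_sq_le hp hc a w i
  rw [norm_sub_rev] at this
  linarith

theorem errU_self_le (a w : State p) (ha : ∀ i, ‖a.v i‖ ≤ c.V) :
    errU p w w ≤ 2 * errU p a w + 2 * c.K * moved p a w := by
  rw [errU, errU, moved, ← avg_mul_left, ← avg_mul_left, ← avg_add]
  refine avg_mono fun i => (norm_sub_sq_le_two _ (p.phBar i a.x (a.y i) (a.v i)) _).trans ?_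
  have := norm_phBar_sub_sq_le hp hc a w i (ha i)
  rw [norm_sub_rev] at this
  linarith

theorem errZ_self_le (a w : State p) (ha : ∀ i, ‖a.v i‖ ≤ c.V) :
    errZ p w w ≤ 2 * errZ p a w + 2 * c.K * moved p a w := by
  have h1 : ‖trackedGrad p a - trackedGrad p w‖ ^ 2 ≤ c.K * moved p a w := by
    rw [trackedGrad_eq, trackedGrad_eq, ← smul_sub, ← Finset.sum_sub_distrib, moved,
      ← avg_mul_left]
    refine (norm_sq_average_le _).trans (avg_mono fun i => ?_)
    rw [norm_sub_rev]
    exact norm_txBar_sub_sq_le hp hc a w i (ha i)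
  have h2 := norm_sub_sq_le_two w.z (trackedGrad p a) (trackedGrad p w)
  unfold errZ
  linarith

theorem totalError_le (a w : State p) (ha : ∀ i, ‖a.v i‖ ≤ c.V) :
    totalError p w ≤ errY p w + errV p w + 2 * (errS p a w + errU p a w + errZ p a w)
      + 6 * c.K * moved p a w := by
  rw [totalError_eq]
  linarith [errS_self_le hp hc a w, errU_self_le hp hc a w ha, errZ_self_le hp hc a w ha]

theorem avg_norm_s_sq_le (w : State p) :
    avg (fun i => ‖w.s i‖ ^ 2) ≤ 2 * errS p w w + 2 * c.K * errY p w := by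
  rw [errS, errY, ← avg_mul_left, ← avg_mul_left, ← avg_add]
  refine avg_mono fun i => ?_
  have h1 := norm_sub_sq_le_two (w.s i) (gradY (p.gBar i) w.x (w.y i)) 0
  have h2 := hp.norm_gradY_le hc i w.x (w.y i)
  have h3 := sq_le_K_mul hc (D := ‖w.y i - p.ySol i w.x‖ ^ 2) (norm_nonneg _) (sq_nonneg _)
    (by rwa [Real.sqrt_sq (norm_nonneg _)])
  rw [sub_zero, sub_zero] at h1
  linarith

theorem avg_norm_u_sq_le (w : State p) :
    avg (fun i => ‖w.u i‖ ^ 2) ≤ 2 * errU p w w + 2 * c.K * errV p w := by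
  rw [errU, errV, ← avg_mul_left, ← avg_mul_left, ← avg_add]
  refine avg_mono fun i => ?_
  have h1 := norm_sub_sq_le_two (w.u i) (p.phBar i w.x (w.y i) (w.v i)) 0
  have h2 := hp.norm_phBar_le hc i w.x (w.y i) (w.v i)
  have h3 := sq_le_K_mul hc (D := ‖w.v i - p.vSol i w.x (w.y i)‖ ^ 2) (norm_nonneg _) (sq_nonneg _)
    (by rwa [Real.sqrt_sq (norm_nonneg _)])
  rw [sub_zero, sub_zero] at h1
  linarith

omit hp in
theorem ratio_sq_le_K : c.ratio ^ 2 ≤ c.K := by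
  have h := hc.ratio_nonneg
  have h2 : 1 ≤ c.lip ^ 2 := by nlinarith [hc.one_le_lip]
  unfold Consts.K
  nlinarith [mul_nonneg (sub_nonneg.2 h2) (sq_nonneg (1 + c.ratio))]

/-- ∇F is the surrogate gradient at the exact solutions, so Lipschitz continuity splits the error
into those of y and v. The latter passes through v_i(x, y_i), which is where the factor 4(1 +
ratio)² of `Consts.K` comes from. -/
theorem gradient_F_error_le (w : State p) (hw : ∀ i, ‖w.v i‖ ≤ c.V) :
    ‖gradient p.F w.x - trackedGrad p w‖ ^ 2 ≤ c.K * (errY p w + errV p w) := by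
  rw [(hp.hasGradientAt_F hc w.x).gradient, trackedGrad_eq, ← smul_sub, ← Finset.sum_sub_distrib,
    errY, errV, ← avg_add, ← avg_mul_left]
  refine (norm_sq_average_le _).trans (avg_mono fun i => ?_)
  have h1 := hp.norm_txBar_sub_le hc i (x := w.x) (x' := w.x) (y := p.ySol i w.x) (y' := w.y i)
    (v := p.vSol i w.x (p.ySol i w.x)) (hw i)
  have h2 := hp.norm_vSol_sub_le hc i w.x w.x (p.ySol i w.x) (w.y i)
  rw [sub_self, norm_zero, zero_pow two_ne_zero, zero_add] at h1
  rw [sub_self, norm_zero, zero_pow two_ne_zero, zero_add, Real.sqrt_sq (norm_nonneg _)] at h2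
  have h3 := norm_sub_sq_le_two (p.vSol i w.x (p.ySol i w.x)) (p.vSol i w.x (w.y i)) (w.v i)
  rw [norm_sub_rev (p.ySol i w.x)] at h1 h2
  rw [norm_sub_rev (p.vSol i w.x (w.y i)) (w.v i)] at h3
  set A := ‖w.y i - p.ySol i w.x‖
  set B := ‖w.v i - p.vSol i w.x (w.y i)‖
  have hr := hc.ratio_nonneg
  have h4 : ‖p.vSol i w.x (p.ySol i w.x) - p.vSol i w.x (w.y i)‖ ^ 2 ≤ c.ratio ^ 2 * A ^ 2 := by
    rw [← mul_pow]; gcongr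
  have h5 : A ^ 2 + ‖p.vSol i w.x (p.ySol i w.x) - w.v i‖ ^ 2
      ≤ 4 * (1 + c.ratio) ^ 2 * (A ^ 2 + B ^ 2) := by
    nlinarith [sq_nonneg A, sq_nonneg B, mul_nonneg hr (sq_nonneg A), mul_nonneg hr (sq_nonneg B),
      mul_nonneg (sq_nonneg c.ratio) (sq_nonneg A), mul_nonneg (sq_nonneg c.ratio) (sq_nonneg B)]
  calc _ ≤ (c.lip * √(A ^ 2 + ‖p.vSol i w.x (p.ySol i w.x) - w.v i‖ ^ 2)) ^ 2 := by gcongr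
    _ = c.lip ^ 2 * (A ^ 2 + ‖p.vSol i w.x (p.ySol i w.x) - w.v i‖ ^ 2) := by
      rw [mul_pow, Real.sq_sqrt (by positivity)]
    _ ≤ c.lip ^ 2 * (4 * (1 + c.ratio) ^ 2 * (A ^ 2 + B ^ 2)) := by gcongr
    _ = c.K * (A ^ 2 + B ^ 2) := by unfold Consts.K; ring

/-- Descent inequality for `F`. -/
theorem F_descent (x z : Vec p.dx) {η : ℝ} (hη : 0 ≤ η) (hηL : η * c.LFc ≤ 1 / 2) :
    p.F (x - η • z) ≤ p.F x - η / 2 * ‖gradient p.F x‖ ^ 2 - η / 4 * ‖z‖ ^ 2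
      + η / 2 * ‖gradient p.F x - z‖ ^ 2 := by
  have hneg : ∀ y, HasGradientAt (fun y => -p.F y) (-gradient p.F y) y := fun y => by
    have h := (hp.differentiable_F hc y).hasGradientAt.hasFDerivAt.neg
    rw [hasGradientAt_iff_hasFDerivAt, map_neg]
    exact h
  -- For -F with the negative modulus -L_F the lower quadratic bound becomes the upper quadratic
  -- bound for F.
  have h := strongConvex_lower_bound (g := fun y => -p.F y) (g' := fun y => -gradient p.F y)
    (lam := -c.LFc) hneg (fun y y' => by
      have h1 := real_inner_le_norm (gradient p.F y - gradient p.F y') (y - y')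
      have h2 := mul_le_mul_of_nonneg_right (hp.norm_gradient_F_sub_le hc y y')
        (norm_nonneg (y - y'))
      rw [neg_sub_neg, ← neg_sub (gradient p.F y), inner_neg_left]
      nlinarith) x (x - η • z)
  have hs : x - η • z - x = -(η • z) := by abel
  simp only [hs, inner_neg_left, inner_neg_right, inner_smul_right, norm_neg, norm_smul,
    Real.norm_of_nonneg hη] at h
  -- Polarization of ⟨∇F, z⟩. The condition η L_F ≤ 1/2 lets the second-order term consume half of
  -- -(η/2)‖z‖².
  have h3 := norm_sub_sq_real (gradient p.F x) z
  nlinarith [mul_le_mul_of_nonneg_right (mul_le_mul_of_nonneg_left hηL hη) (sq_nonneg ‖z‖)]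

variable {B : ℕ} (τ : ℝ) (I : ℕ) (q : StageParams) (d : Draw m B Ξ Z) (a w : State p)

omit hp hc in
theorem norm_step_v_le (hc : c.Valid) (i : Fin m) : ‖(step p c.V τ I q d a w).v i‖ ≤ c.V :=
  norm_projBall_le hc.V_nonneg _

omit hp hc in
theorem norm_step_x_sub_sq (hη : 0 ≤ q.η) :
    ‖(step p c.V τ I q d a w).x - w.x‖ ^ 2
      = q.η ^ 2 * ‖(step p c.V τ I q d a w).z‖ ^ 2 := by
  have h : (step p c.V τ I q d a w).x - w.x = -(q.η • (step p c.V τ I q d a w).z) := by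
    simp only [step]; abel
  rw [h, norm_neg, norm_smul, mul_pow, Real.norm_of_nonneg hη]

/-- The new error is a contracted exact gradient step plus h times the error of s plus the shift of
y_i(x) due to the motion of x. -/
theorem errY_step_le {h : ℝ} (hh : 0 < h) (hτ : τ * q.stepY = h) (hK : h * c.K ≤ c.lam)
    (hr : h * c.lam ≤ 2) (hm : 1 ≤ m) :
    errY p (step p c.V τ I q d a w)
      ≤ (1 - h * c.lam / 2) * errY p w + 8 * h / c.lam * errS p w w
        + 8 * c.K / (h * c.lam) * ‖(step p c.V τ I q d a w).x - w.x‖ ^ 2 := by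
  set w' := step p c.V τ I q d a w with hw'
  have hlam := hc.lam_pos
  rw [← avg_const hm (8 * c.K / (h * c.lam) * ‖w'.x - w.x‖ ^ 2), errY, errY, errS,
    ← avg_mul_left, ← avg_mul_left, ← avg_add, ← avg_add]
  refine avg_mono fun i => ?_
  have hy : w'.y i = w.y i - h • w.s i := by rw [← hτ]; rfl
  have hK2 : ‖gradY (p.gBar i) w.x (w.y i)‖ ^ 2 ≤ c.K * ‖w.y i - p.ySol i w.x‖ ^ 2 :=
    sq_le_K_mul hc (norm_nonneg _) (sq_nonneg _)
      (by rw [Real.sqrt_sq (norm_nonneg _)]; exact hp.norm_gradY_le hc i w.x (w.y i))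
  have h1 := norm_sq_sub_smul_le hh.le hK (hp.inner_gradY_ge hc i w.x (w.y i)) hK2
  have h2 : ‖w'.y i - p.ySol i w'.x‖ ≤
      ‖w.y i - p.ySol i w.x - h • gradY (p.gBar i) w.x (w.y i)‖
      + (h * ‖w.s i - gradY (p.gBar i) w.x (w.y i)‖ + ‖p.ySol i w.x - p.ySol i w'.x‖) := by
    have e : w'.y i - p.ySol i w'.x
        = (w.y i - p.ySol i w.x - h • gradY (p.gBar i) w.x (w.y i))
          + (-(h • (w.s i - gradY (p.gBar i) w.x (w.y i))) + (p.ySol i w.x - p.ySol i w'.x)) := by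
      rw [hy, smul_sub]; abel
    rw [e]
    refine (norm_add_le _ _).trans (add_le_add_right ((norm_add_le _ _).trans ?_) _)
    rw [norm_neg, norm_smul, Real.norm_of_nonneg hh.le]
  have h3 := sq_le_of_contraction hh hlam hr (norm_nonneg _) h2 h1 (sq_nonneg _)
  have h4 : ‖p.ySol i w.x - p.ySol i w'.x‖ ^ 2 ≤ c.K * ‖w'.x - w.x‖ ^ 2 := by
    have := hp.norm_ySol_sub_le hc i w.x w'.x
    rw [norm_sub_rev w.x] at this
    calc _ ≤ (c.ratio * ‖w'.x - w.x‖) ^ 2 := by gcongr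
      _ = c.ratio ^ 2 * ‖w'.x - w.x‖ ^ 2 := by ring
      _ ≤ _ := by gcongr; exact ratio_sq_le_K hc
  have h5 : 8 / (h * c.lam) * ‖p.ySol i w.x - p.ySol i w'.x‖ ^ 2
      ≤ 8 / (h * c.lam) * (c.K * ‖w'.x - w.x‖ ^ 2) := by gcongr
  have h6 : 8 / (h * c.lam) * (c.K * ‖w'.x - w.x‖ ^ 2)
      = 8 * c.K / (h * c.lam) * ‖w'.x - w.x‖ ^ 2 := by ring
  linarith

/-- As for y, but the target v_i(x, y_i) moves with x and with y, which brings in the norm of s. The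
projection is harmless because the old target lies in the ball. -/
theorem errV_step_le {h : ℝ} (hh : 0 < h) (hτ : τ * q.stepY = h) (hv : q.stepV = h)
    (hK : h * c.K ≤ c.lam) (hr : h * c.lam ≤ 2) (hm : 1 ≤ m) :
    errV p (step p c.V τ I q d a w)
      ≤ (1 - h * c.lam / 2) * errV p w + 8 * h / c.lam * errU p w w
        + 8 * c.K / (h * c.lam) * (‖(step p c.V τ I q d a w).x - w.x‖ ^ 2
          + h ^ 2 * avg fun i => ‖w.s i‖ ^ 2) := by
  set w' := step p c.V τ I q d a w with hw'
  have hlam := hc.lam_pos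
  rw [← avg_const hm (‖w'.x - w.x‖ ^ 2), errV, errV, errU, ← avg_mul_left (h ^ 2), ← avg_add,
    ← avg_mul_left, ← avg_mul_left, ← avg_mul_left, ← avg_add, ← avg_add]
  refine avg_mono fun i => ?_
  have hy : w'.y i = w.y i - h • w.s i := by rw [← hτ]; rfl
  have hvi : w'.v i = projBall c.V (w.v i - h • w.u i) := by rw [← hv]; rfl
  have hK2 : ‖p.phBar i w.x (w.y i) (w.v i)‖ ^ 2 ≤ c.K * ‖w.v i - p.vSol i w.x (w.y i)‖ ^ 2 :=
    sq_le_K_mul hc (norm_nonneg _) (sq_nonneg _)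
      (by rw [Real.sqrt_sq (norm_nonneg _)]; exact hp.norm_phBar_le hc i w.x (w.y i) (w.v i))
  have h1 := norm_sq_sub_smul_le hh.le hK (hp.inner_phBar_ge hc i w.x (w.y i) (w.v i)) hK2
  have h2 : ‖w'.v i - p.vSol i w'.x (w'.y i)‖ ≤
      ‖w.v i - p.vSol i w.x (w.y i) - h • p.phBar i w.x (w.y i) (w.v i)‖
      + (h * ‖w.u i - p.phBar i w.x (w.y i) (w.v i)‖
        + ‖p.vSol i w.x (w.y i) - p.vSol i w'.x (w'.y i)‖) := by
    have e1 := norm_projBall_sub_le hc.V_nonneg (w.v i - h • w.u i)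
      (hp.norm_vSol_le hc i w.x (w.y i))
    have e2 : w.v i - h • w.u i - p.vSol i w.x (w.y i)
        = (w.v i - p.vSol i w.x (w.y i) - h • p.phBar i w.x (w.y i) (w.v i))
          + -(h • (w.u i - p.phBar i w.x (w.y i) (w.v i))) := by
      rw [smul_sub]; abel
    have e3 := norm_add_le (w.v i - p.vSol i w.x (w.y i) - h • p.phBar i w.x (w.y i) (w.v i))
      (-(h • (w.u i - p.phBar i w.x (w.y i) (w.v i))))
    rw [norm_neg, norm_smul, Real.norm_of_nonneg hh.le] at e3
    have e4 := norm_sub_le_norm_sub_add_norm_sub (w'.v i) (p.vSol i w.x (w.y i))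
      (p.vSol i w'.x (w'.y i))
    rw [e2, ← hvi] at e1
    linarith
  have h3 := sq_le_of_contraction hh hlam hr (norm_nonneg _) h2 h1 (sq_nonneg _)
  have h4 : ‖p.vSol i w.x (w.y i) - p.vSol i w'.x (w'.y i)‖ ^ 2
      ≤ c.K * (‖w'.x - w.x‖ ^ 2 + h ^ 2 * ‖w.s i‖ ^ 2) := by
    have e1 := hp.norm_vSol_sub_le hc i w.x w'.x (w.y i) (w'.y i)
    have e2 : ‖w.y i - w'.y i‖ ^ 2 = h ^ 2 * ‖w.s i‖ ^ 2 := by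
      rw [hy, sub_sub_cancel, norm_smul, mul_pow, Real.norm_of_nonneg hh.le]
    rw [e2, norm_sub_rev w.x] at e1
    calc _ ≤ (c.ratio * √(‖w'.x - w.x‖ ^ 2 + h ^ 2 * ‖w.s i‖ ^ 2)) ^ 2 := by gcongr
      _ = c.ratio ^ 2 * (‖w'.x - w.x‖ ^ 2 + h ^ 2 * ‖w.s i‖ ^ 2) := by
        rw [mul_pow, Real.sq_sqrt (by positivity)]
      _ ≤ _ := by gcongr; exact ratio_sq_le_K hc
  have h5 : 8 / (h * c.lam) * ‖p.vSol i w.x (w.y i) - p.vSol i w'.x (w'.y i)‖ ^ 2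
      ≤ 8 / (h * c.lam) * (c.K * (‖w'.x - w.x‖ ^ 2 + h ^ 2 * ‖w.s i‖ ^ 2)) := by gcongr
  have h6 : 8 / (h * c.lam) * (c.K * (‖w'.x - w.x‖ ^ 2 + h ^ 2 * ‖w.s i‖ ^ 2))
      = 8 * c.K / (h * c.lam) * (‖w'.x - w.x‖ ^ 2 + h ^ 2 * ‖w.s i‖ ^ 2) := by ring
  linarith

omit hp in
theorem moved_step_le {h : ℝ} (hh : 0 < h) (hτ : τ * q.stepY = h) (hv : q.stepV = h)
    (hm : 1 ≤ m) (hw : ∀ i, ‖w.v i‖ ≤ c.V) :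
    moved p w (step p c.V τ I q d a w)
      ≤ ‖(step p c.V τ I q d a w).x - w.x‖ ^ 2
        + h ^ 2 * (avg (fun i => ‖w.s i‖ ^ 2) + avg fun i => ‖w.u i‖ ^ 2) := by
  set w' := step p c.V τ I q d a w with hw'
  rw [← avg_const hm (‖w'.x - w.x‖ ^ 2), moved, ← avg_add, ← avg_mul_left, ← avg_add]
  refine avg_mono fun i => ?_
  have hy : w'.y i - w.y i = -(h • w.s i) := by
    rw [← hτ, show w'.y i = w.y i - (τ * q.stepY) • w.s i from rfl]; abel
  have hvi : ‖w'.v i - w.v i‖ ≤ h * ‖w.u i‖ := by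
    have e := norm_projBall_sub_le hc.V_nonneg (w.v i - h • w.u i) (hw i)
    rw [sub_sub_cancel_left, norm_neg, norm_smul, Real.norm_of_nonneg hh.le] at e
    rw [show w'.v i = projBall c.V (w.v i - q.stepV • w.u i) from rfl, hv]
    exact e
  have h1 : ‖w'.v i - w.v i‖ ^ 2 ≤ (h * ‖w.u i‖) ^ 2 := by gcongr
  unfold blockDist
  rw [hy, norm_neg, norm_smul, Real.norm_of_nonneg hh.le]
  nlinarith

end States

end BSVRB


/-! ### Second moments of mini-batches and of block sampling -/

namespace BSVRB

section SecondMoments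

variable {Ω : Type*} [MeasurableSpace Ω] {pr : Measure Ω} {d : ℕ}

theorem integrable_norm_sq {E : Type*} [NormedAddCommGroup E] {X : Ω → E} (hX : MemLp X 2 pr) :
    Integrable (fun ω => ‖X ω‖ ^ 2) pr :=
  (memLp_two_iff_integrable_sq_norm hX.aestronglyMeasurable).1 hX

/-- The second moment of a sum of pairwise independent centred random vectors. -/
theorem integral_norm_sum_sq [IsProbabilityMeasure pr] {J : Type*} (s : Finset J)
    {X : J → Ω → Vec d} (hX : ∀ j ∈ s, MemLp (X j) 2 pr) (h0 : ∀ j ∈ s, ∫ ω, X j ω ∂pr = 0)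
    (hind : ∀ j ∈ s, ∀ k ∈ s, j ≠ k → IndepFun (X j) (X k) pr) :
    ∫ ω, ‖∑ j ∈ s, X j ω‖ ^ 2 ∂pr = ∑ j ∈ s, ∫ ω, ‖X j ω‖ ^ 2 ∂pr := by
  classical
  have hi : ∀ j ∈ s, ∀ k ∈ s, Integrable (fun ω => inner ℝ (X j ω) (X k ω)) pr := by
    intro j hj k hk
    rcases eq_or_ne j k with rfl | hjk
    · simp only [real_inner_self_eq_norm_sq]
      exact integrable_norm_sq (hX j hj)
    · exact (hind j hj k hk hjk).integrable_bilin ((hX j hj).integrable one_le_two)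
        ((hX k hk).integrable one_le_two) (innerSL ℝ)
  have h1 : ∀ ω, ‖∑ j ∈ s, X j ω‖ ^ 2 = ∑ j ∈ s, ∑ k ∈ s, inner ℝ (X j ω) (X k ω) := fun ω => by
    rw [← real_inner_self_eq_norm_sq, sum_inner]
    simp only [inner_sum]
  simp only [h1]
  rw [integral_finsetSum _ fun j hj => integrable_finsetSum _ fun k hk => hi j hj k hk]
  refine Finset.sum_congr rfl fun j hj => ?_
  rw [integral_finsetSum _ fun k hk => hi j hj k hk, Finset.sum_eq_single_of_mem j hj]
  · simp only [real_inner_self_eq_norm_sq]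
  · intro k hk hkj
    have h2 := (hind j hj k hk hkj.symm).integral_bilin ((hX j hj).integrable one_le_two)
      ((hX k hk).integrable one_le_two) (innerSL ℝ)
    rw [h0 j hj, map_zero] at h2
    exact h2

theorem integral_norm_const_add_sq [IsProbabilityMeasure pr] {X : Ω → Vec d} (a : Vec d)
    (hX : MemLp X 2 pr) (h0 : ∫ ω, X ω ∂pr = 0) :
    ∫ ω, ‖a + X ω‖ ^ 2 ∂pr = ‖a‖ ^ 2 + ∫ ω, ‖X ω‖ ^ 2 ∂pr := by
  have hi := hX.integrable one_le_two
  have h1 : ∀ ω, ‖a + X ω‖ ^ 2 = (‖a‖ ^ 2 + 2 * inner ℝ a (X ω)) + ‖X ω‖ ^ 2 :=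
    fun ω => norm_add_sq_real a (X ω)
  have h2 : Integrable (fun ω => 2 * inner ℝ a (X ω)) pr := (hi.const_inner a).const_mul 2
  have h3 : Integrable (fun ω => ‖a‖ ^ 2 + 2 * inner ℝ a (X ω)) pr := (integrable_const _).add h2
  simp only [h1]
  rw [integral_add h3 (integrable_norm_sq hX), integral_add (integrable_const _) h2,
    integral_const_mul, integral_inner hi, h0]
  simp

theorem integral_norm_sub_mean_sq_le [IsProbabilityMeasure pr] {X : Ω → Vec d} {e : Vec d}
    (hX : MemLp X 2 pr) (he : ∫ ω, X ω ∂pr = e) :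
    ∫ ω, ‖X ω - e‖ ^ 2 ∂pr ≤ ∫ ω, ‖X ω‖ ^ 2 ∂pr := by
  have h := integral_norm_const_add_sq e (hX.sub (memLp_const e)) (by
    simp only [Pi.sub_apply]
    rw [integral_sub (hX.integrable one_le_two) (integrable_const _), he]; simp)
  simp only [Pi.sub_apply, add_sub_cancel] at h
  rw [h]
  linarith [sq_nonneg ‖e‖]

theorem norm_add_sq_le_two {E : Type*} [SeminormedAddCommGroup E] (a b : E) :
    ‖a + b‖ ^ 2 ≤ 2 * ‖a‖ ^ 2 + 2 * ‖b‖ ^ 2 := by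
  simpa using norm_sub_sq_le_two a 0 (-b)

/-- A stochastic oracle evaluated at a current and a previous point: values `h`, `h'` with means
`e`, `e'`, variance bound `K`, and squared increments bounded by `K * D`. -/
structure IsOracle {S : Type*} [MeasurableSpace S] (P : Measure S) (h h' : S → Vec d)
    (e e' : Vec d) (K D : ℝ) : Prop where
  meas : Measurable h
  meas' : Measurable h'
  memLp : MemLp h 2 P
  memLp' : MemLp h' 2 P
  mean : ∫ s, h s ∂P = e
  mean' : ∫ s, h' s ∂P = e'
  var : ∫ s, ‖h s - e‖ ^ 2 ∂P ≤ K
  incr : ∀ s, ‖h s - h' s‖ ^ 2 ≤ K * D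

namespace IsOracle

variable {S : Type*} [MeasurableSpace S] {P : Measure S}
  {h h' : S → Vec d} {e e' : Vec d} {K D : ℝ} (ho : IsOracle P h h' e e' K D)
include ho

theorem memLp_comb (α γ : ℝ) : MemLp (fun s => α • h s + γ • (h s - h' s)) 2 P :=
  (ho.memLp.const_smul α).add ((ho.memLp.sub ho.memLp').const_smul γ)

theorem measurable_comb (α γ : ℝ) : Measurable (fun s => α • h s + γ • (h s - h' s)) :=
  (ho.meas.const_smul α).add ((ho.meas.sub ho.meas').const_smul γ)

variable [IsProbabilityMeasure P]

theorem norm_mean_sub_sq_le : ‖e - e'‖ ^ 2 ≤ K * D := by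
  have i2 : MemLp (fun s => h s - h' s) 2 P := ho.memLp.sub ho.memLp'
  have hm : ∫ s, (h s - h' s) ∂P = e - e' := by
    rw [integral_sub (ho.memLp.integrable one_le_two) (ho.memLp'.integrable one_le_two), ho.mean,
      ho.mean']
  have i3 : MemLp (fun s => h s - h' s - (e - e')) 2 P := i2.sub (memLp_const _)
  have h2 := integral_norm_const_add_sq (e - e') i3 (by
    rw [integral_sub (i2.integrable one_le_two) (integrable_const _), hm]; simp)
  simp only [add_sub_cancel] at h2
  have h3 : ∫ s, ‖h s - h' s‖ ^ 2 ∂P ≤ K * D := by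
    have := integral_mono (integrable_norm_sq i2) (integrable_const (μ := P) (K * D))
      (fun s => ho.incr s)
    simpa using this
  have h4 : 0 ≤ ∫ s, ‖h s - h' s - (e - e')‖ ^ 2 ∂P := integral_nonneg fun _ => sq_nonneg _
  linarith

theorem mean_comb (α γ : ℝ) :
    ∫ s, (α • h s + γ • (h s - h' s)) ∂P = α • e + γ • (e - e') := by
  have i1 := ho.memLp.integrable one_le_two
  have i2 := ho.memLp'.integrable one_le_two
  have i3 : Integrable (fun s => γ • (h s - h' s)) P := (i1.sub i2).smul γ
  have i4 : Integrable (fun s => α • h s) P := i1.smul α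
  rw [integral_add i4 i3, integral_smul, integral_smul, integral_sub i1 i2, ho.mean,
    ho.mean']

/-- Centring does not increase a second moment, so the noise of the increment is at most K D. Only
the α-part carries the full variance, and this is the point of variance reduction. -/
theorem var_comb (α γ : ℝ) :
    ∫ s, ‖α • h s + γ • (h s - h' s) - (α • e + γ • (e - e'))‖ ^ 2 ∂P
      ≤ 2 * K * (α ^ 2 + γ ^ 2 * D) := by
  have i1 : MemLp (fun s => h s - e) 2 P := ho.memLp.sub (memLp_const e)
  have i2 : MemLp (fun s => h s - h' s) 2 P := ho.memLp.sub ho.memLp'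
  have i3 : MemLp (fun s => h s - h' s - (e - e')) 2 P := i2.sub (memLp_const _)
  have h1 : ∫ s, ‖h s - h' s - (e - e')‖ ^ 2 ∂P ≤ K * D := by
    refine (integral_norm_sub_mean_sq_le i2 (by
      rw [integral_sub (ho.memLp.integrable one_le_two) (ho.memLp'.integrable one_le_two), ho.mean,
      ho.mean'])).trans ?_
    have := integral_mono (integrable_norm_sq i2) (integrable_const (μ := P) (K * D))
      (fun s => ho.incr s)
    simpa using this
  have h2 : ∀ s, ‖α • h s + γ • (h s - h' s) - (α • e + γ • (e - e'))‖ ^ 2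
      ≤ 2 * α ^ 2 * ‖h s - e‖ ^ 2 + 2 * γ ^ 2 * ‖h s - h' s - (e - e')‖ ^ 2 := fun s => by
    have e1 : α • h s + γ • (h s - h' s) - (α • e + γ • (e - e'))
        = α • (h s - e) + γ • (h s - h' s - (e - e')) := by
      simp only [smul_sub]; abel
    rw [e1]
    refine (norm_add_sq_le_two _ _).trans (le_of_eq ?_)
    rw [norm_smul, norm_smul, mul_pow, mul_pow, Real.norm_eq_abs, Real.norm_eq_abs, sq_abs, sq_abs]
    ring
  have i4 : MemLp (fun s => α • h s + γ • (h s - h' s) - (α • e + γ • (e - e'))) 2 P :=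
    (ho.memLp_comb α γ).sub (memLp_const _)
  refine (integral_mono (integrable_norm_sq i4) (((integrable_norm_sq i1).const_mul _).add
    ((integrable_norm_sq i3).const_mul _)) h2).trans ?_
  rw [integral_add' ((integrable_norm_sq i1).const_mul _) ((integrable_norm_sq i3).const_mul _),
    integral_const_mul, integral_const_mul]
  nlinarith [mul_le_mul_of_nonneg_left ho.var (sq_nonneg α),
    mul_le_mul_of_nonneg_left h1 (sq_nonneg γ)]

end IsOracle

/-- The centred mini-batch combination of an oracle. -/
noncomputable def batchNoise {S : Type*} {B : ℕ} (h h' : S → Vec d) (e e' : Vec d) (α γ : ℝ)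
    (s : Fin B → S) : Vec d :=
  batchMean (fun s => α • h s + γ • (h s - h' s)) s - (α • e + γ • (e - e'))

theorem batchNoise_eq {S : Type*} {B : ℕ} (hB : 1 ≤ B) (h h' : S → Vec d) (e e' : Vec d) (α γ : ℝ)
    (s : Fin B → S) : batchNoise h h' e e' α γ s
      = (B : ℝ)⁻¹ • ∑ b, (α • h (s b) + γ • (h (s b) - h' (s b)) - (α • e + γ • (e - e'))) := by
  have hB0 : (B : ℝ) ≠ 0 := by positivity
  rw [batchNoise, batchMean]
  generalize α • e + γ • (e - e') = M
  rw [Finset.sum_sub_distrib, Finset.sum_const, Finset.card_univ,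
    Fintype.card_fin, smul_sub, ← Nat.cast_smul_eq_nsmul ℝ, smul_smul, inv_mul_cancel₀ hB0, one_smul]

section Batch

variable {S : Type*} [MeasurableSpace S] {P : Measure S} [IsProbabilityMeasure P]
  {h h' : S → Vec d} {e e' : Vec d} {K D : ℝ} {B : ℕ}
  (ho : IsOracle P h h' e e' K D) (hB : 1 ≤ B) {s : Fin B → Ω → S}
  (hs : ∀ b, Measurable (s b)) (hlaw : ∀ b, pr.map (s b) = P) (α γ : ℝ)
include ho hs hlaw

theorem memLp_batch_term (b : Fin B) :
    MemLp (fun ω => α • h (s b ω) + γ • (h (s b ω) - h' (s b ω)) - (α • e + γ • (e - e'))) 2 pr := by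
  have h1 := (ho.memLp_comb α γ).sub (memLp_const (α • e + γ • (e - e')))
  rw [← hlaw b] at h1
  exact h1.comp_of_map (hs b).aemeasurable

theorem integral_batch_term (b : Fin B) : ∫ ω, (α • h (s b ω) + γ • (h (s b ω) - h' (s b ω))
    - (α • e + γ • (e - e'))) ∂pr = 0 := by
  have hm := ((ho.measurable_comb α γ).sub_const (α • e + γ • (e - e'))).aestronglyMeasurable
    (μ := pr.map (s b))
  have h2 := integral_map (hs b).aemeasurable hm
  rw [← h2, hlaw b, integral_sub ((ho.memLp_comb α γ).integrable one_le_two) (integrable_const _),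
    ho.mean_comb]
  simp

include hB

theorem memLp_batchNoise :
    MemLp (fun ω => batchNoise h h' e e' α γ fun b => s b ω) 2 pr := by
  simp only [batchNoise_eq hB]
  have h1 := memLp_finsetSum (μ := pr) (p := 2) (Finset.univ : Finset (Fin B))
    fun b _ => memLp_batch_term ho hs hlaw α γ b
  exact h1.const_smul (B : ℝ)⁻¹

variable [IsProbabilityMeasure pr]

theorem integral_batchNoise :
    ∫ ω, (batchNoise h h' e e' α γ fun b => s b ω) ∂pr = 0 := by
  simp only [batchNoise_eq hB]
  rw [integral_smul, integral_finsetSum _ fun b _ =>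
    (memLp_batch_term ho hs hlaw α γ b).integrable one_le_two]
  simp [integral_batch_term ho hs hlaw α γ]

theorem integral_norm_batchNoise_sq_le (hind : ∀ b b', b ≠ b' → IndepFun (s b) (s b') pr) :
    ∫ ω, ‖batchNoise h h' e e' α γ fun b => s b ω‖ ^ 2 ∂pr
      ≤ 2 * K * (α ^ 2 + γ ^ 2 * D) / B := by
  have hB0 : (0 : ℝ) < B := by exact_mod_cast hB
  simp only [batchNoise_eq hB, norm_smul, mul_pow]
  rw [integral_const_mul, integral_norm_sum_sq _
    (fun b _ => memLp_batch_term ho hs hlaw α γ b)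
    (fun b _ => integral_batch_term ho hs hlaw α γ b)
    (fun b _ b' _ hbb => (hind b b' hbb).comp ((ho.measurable_comb α γ).sub_const _)
      ((ho.measurable_comb α γ).sub_const _))]
  have h1 : ∀ b, ∫ ω, ‖α • h (s b ω) + γ • (h (s b ω) - h' (s b ω))
      - (α • e + γ • (e - e'))‖ ^ 2 ∂pr ≤ 2 * K * (α ^ 2 + γ ^ 2 * D) := fun b => by
    have hm := (((ho.measurable_comb α γ).sub_const
      (α • e + γ • (e - e'))).norm.pow_const 2).aestronglyMeasurable (μ := pr.map (s b))
    have h2 := integral_map (hs b).aemeasurable hm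
    rw [← h2, hlaw b]
    exact ho.var_comb α γ
  have h2 := Finset.sum_le_sum fun b (_ : b ∈ Finset.univ) => h1 b
  rw [Finset.sum_const, Finset.card_univ, Fintype.card_fin, nsmul_eq_mul] at h2
  rw [norm_inv, RCLike.norm_natCast]
  calc _ ≤ ((B : ℝ)⁻¹) ^ 2 * (B * (2 * K * (α ^ 2 + γ ^ 2 * D))) := by gcongr
    _ = _ := by field_simp

end Batch

end SecondMoments

section BlockSampling

variable {m : ℕ}

/-- The average of a function over the `I`-element sets of blocks. -/
noncomputable def blockAvg (I : ℕ) (f : Finset (Fin m) → ℝ) : ℝ :=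
  ((m.choose I : ℕ) : ℝ)⁻¹ * ∑ S ∈ Finset.powersetCard I Finset.univ, f S

variable {I : ℕ}

theorem blockAvg_add (f g : Finset (Fin m) → ℝ) :
    blockAvg I (fun S => f S + g S) = blockAvg I f + blockAvg I g := by
  simp only [blockAvg, Finset.sum_add_distrib, mul_add]

theorem blockAvg_mul_left (a : ℝ) (f : Finset (Fin m) → ℝ) :
    blockAvg I (fun S => a * f S) = a * blockAvg I f := by
  simp only [blockAvg, ← Finset.mul_sum]
  ring

theorem blockAvg_sum {J : Type*} (s : Finset J) (f : J → Finset (Fin m) → ℝ) :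
    blockAvg I (fun S => ∑ j ∈ s, f j S) = ∑ j ∈ s, blockAvg I (f j) := by
  simp only [blockAvg, ← Finset.mul_sum]
  rw [Finset.sum_comm]

theorem blockAvg_const (hI : I ≤ m) (a : ℝ) : blockAvg I (fun _ : Finset (Fin m) => a) = a := by
  have h : ((m.choose I : ℕ) : ℝ) ≠ 0 := by exact_mod_cast (Nat.choose_pos hI).ne'
  simp only [blockAvg, Finset.sum_const, Finset.card_powersetCard, Finset.card_univ,
    Fintype.card_fin, nsmul_eq_mul]
  field_simp

theorem blockAvg_subset (T : Finset (Fin m)) (hT : T.card ≤ I) :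
    blockAvg I (fun S => if T ⊆ S then 1 else 0)
      = (((m - T.card).choose (I - T.card) : ℕ) : ℝ) / ((m.choose I : ℕ) : ℝ) := by
  have h := Finset.card_filter_powersetCard_subset T (Finset.univ : Finset (Fin m)) I
    (Finset.subset_univ _) hT
  rw [Finset.card_univ, Fintype.card_fin] at h
  rw [blockAvg, Finset.sum_ite, Finset.sum_const_zero, add_zero, Finset.sum_const, h, nsmul_eq_mul,
    mul_one, inv_mul_eq_div]

theorem blockAvg_mem (hI : 1 ≤ I) (hIm : I ≤ m) (i : Fin m) :
    blockAvg I (fun S => if i ∈ S then 1 else 0) = (I : ℝ) / m := by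
  have h := blockAvg_subset (I := I) {i} (by simpa using hI)
  simp only [Finset.singleton_subset_iff, Finset.card_singleton] at h
  rw [h]
  have hc : ((m.choose I : ℕ) : ℝ) ≠ 0 := by exact_mod_cast (Nat.choose_pos hIm).ne'
  have hm : (m : ℝ) ≠ 0 := by exact_mod_cast (by omega : m ≠ 0)
  rw [div_eq_div_iff hc hm]
  obtain ⟨I', rfl⟩ : ∃ I', I = I' + 1 := ⟨I - 1, by omega⟩
  obtain ⟨m', rfl⟩ : ∃ m', m = m' + 1 := ⟨m - 1, by omega⟩
  have h2 := Nat.add_one_mul_choose_eq m' I'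
  simp only [Nat.add_sub_cancel]
  have h3 : (((m' + 1) * m'.choose I' : ℕ) : ℝ) = (((m' + 1).choose (I' + 1) * (I' + 1) : ℕ) : ℝ) := by
    rw [h2]
  push_cast at h3 ⊢
  linarith

/-- All that matters about the probability of drawing a given pair is that it is the same for all
pairs and nonnegative; its value drops out of the variance bound. -/
theorem exists_blockAvg_pair (hI : 1 ≤ I) : ∃ q : ℝ, 0 ≤ q ∧ ∀ i j : Fin m, i ≠ j →
    blockAvg I (fun S => (if i ∈ S then 1 else 0) * (if j ∈ S then 1 else 0)) = q := by
  rcases Nat.lt_or_ge 1 I with h | h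
  · refine ⟨(((m - 2).choose (I - 2) : ℕ) : ℝ) / ((m.choose I : ℕ) : ℝ), by positivity, fun i j hij => ?_⟩
    have h2 := blockAvg_subset (I := I) {i, j} (by rw [Finset.card_pair hij]; exact h)
    rw [Finset.card_pair hij] at h2
    rw [← h2]
    congr 1
    funext S
    by_cases h1 : i ∈ S <;> by_cases h2 : j ∈ S <;> simp [h1, h2, Finset.insert_subset_iff]
  · refine ⟨0, le_rfl, fun i j hij => ?_⟩
    rw [blockAvg, Finset.sum_eq_zero, mul_zero]
    intro S hS
    have hc := (Finset.mem_powersetCard.1 hS).2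
    by_cases h1 : i ∈ S
    · by_cases h2 : j ∈ S
      · exact absurd (Finset.card_le_one.1 (by omega) i h1 j h2) hij
      · simp [h2]
    · simp [h1]

theorem sum_mem_eq {d : ℕ} (S : Finset (Fin m)) (a : Fin m → Vec d) :
    ∑ i ∈ S, a i = ∑ i, (if i ∈ S then (1 : ℝ) else 0) • a i := by
  simp [Finset.sum_ite_mem]

theorem blockAvg_inner_sum (hI : 1 ≤ I) (hIm : I ≤ m) {d : ℕ} (x : Vec d) {a : Fin m → Vec d}
    (ha : ∑ i, a i = 0) : blockAvg I (fun S => inner ℝ x (∑ i ∈ S, a i)) = 0 := by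
  have h : (fun S : Finset (Fin m) => inner ℝ x (∑ i ∈ S, a i))
      = fun S => ∑ i, inner ℝ x (a i) * (if i ∈ S then 1 else 0) := by
    funext S
    rw [sum_mem_eq, inner_sum]
    simp only [inner_smul_right]
    exact Finset.sum_congr rfl fun i _ => mul_comm _ _
  rw [h, blockAvg_sum]
  simp only [blockAvg_mul_left, blockAvg_mem hI hIm]
  rw [← Finset.sum_mul, ← inner_sum, ha, inner_zero_right, zero_mul]

/-- Variance of sampling without replacement. -/
theorem blockAvg_norm_sum_sq_le (hI : 1 ≤ I) (hIm : I ≤ m) {d : ℕ} {a : Fin m → Vec d}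
    (ha : ∑ i, a i = 0) :
    blockAvg I (fun S => ‖∑ i ∈ S, a i‖ ^ 2) ≤ (I : ℝ) / m * ∑ i, ‖a i‖ ^ 2 := by
  obtain ⟨q, hq, hpair⟩ := exists_blockAvg_pair (m := m) hI
  have h : (fun S : Finset (Fin m) => ‖∑ i ∈ S, a i‖ ^ 2)
      = fun S => ∑ i, ∑ j, inner ℝ (a i) (a j) *
          ((if i ∈ S then 1 else 0) * (if j ∈ S then 1 else 0)) := by
    funext S
    rw [sum_mem_eq, ← real_inner_self_eq_norm_sq, sum_inner]
    simp only [inner_sum, real_inner_smul_left, inner_smul_right]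
    exact Finset.sum_congr rfl fun i _ => Finset.sum_congr rfl fun j _ => by ring
  have hdiag : ∀ i : Fin m,
      blockAvg I (fun S => (if i ∈ S then (1 : ℝ) else 0) * (if i ∈ S then 1 else 0)) = I / m :=
    fun i => by
      rw [← blockAvg_mem hI hIm i]
      congr 1
      funext S
      split_ifs <;> simp
  -- Because the `a j` sum to zero, the off-diagonal terms with their common weight q add up to -q
  -- ‖a i‖². This is nonpositive and is discarded at the end.
  have hsum : ∀ i, ∑ j, inner ℝ (a i) (a j) *
      blockAvg I (fun S => (if i ∈ S then 1 else 0) * (if j ∈ S then 1 else 0))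
      = (I / m - q) * ‖a i‖ ^ 2 := fun i => by
    have h1 : ∀ j, inner ℝ (a i) (a j) *
        blockAvg I (fun S => (if i ∈ S then 1 else 0) * (if j ∈ S then 1 else 0))
        = q * inner ℝ (a i) (a j) + (if j = i then (I / m - q) * ‖a i‖ ^ 2 else 0) := fun j => by
      by_cases hij : j = i
      · subst hij
        rw [hdiag, if_pos rfl, real_inner_self_eq_norm_sq]; ring
      · rw [hpair i j (Ne.symm hij), if_neg hij]; ring
    simp only [h1]
    rw [Finset.sum_add_distrib, ← Finset.mul_sum, ← inner_sum, ha, inner_zero_right]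
    simp
  rw [h, blockAvg_sum]
  simp only [blockAvg_sum, blockAvg_mul_left]
  rw [Finset.sum_congr rfl fun i _ => hsum i, ← Finset.mul_sum]
  exact mul_le_mul_of_nonneg_right (by linarith) (Finset.sum_nonneg fun i _ => sq_nonneg _)

theorem blockAvg_ite_mem (hI : 1 ≤ I) (hIm : I ≤ m) (i : Fin m) (a b : ℝ) :
    blockAvg I (fun S => if i ∈ S then a else b) = I / m * a + (1 - I / m) * b := by
  have h : (fun S : Finset (Fin m) => if i ∈ S then a else b)
      = fun S => b + (a - b) * (if i ∈ S then 1 else 0) := by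
    funext S
    split_ifs <;> ring
  rw [h, blockAvg_add, blockAvg_const hIm, blockAvg_mul_left, blockAvg_mem hI hIm]
  ring

end BlockSampling

end BSVRB


/-! ### One-step bounds for the MSVR and STORM estimators -/

namespace BSVRB

theorem batchMean_comb {S : Type*} {B : ℕ} {E : Type*} [AddCommGroup E] [Module ℝ E] (h h' : S → E) (α γ : ℝ)
    (s : Fin B → S) : batchMean (fun s => α • h s + γ • (h s - h' s)) s
      = α • batchMean h s + γ • (batchMean h s - batchMean h' s) := by
  simp only [batchMean, Finset.sum_add_distrib, Finset.sum_sub_distrib, ← Finset.smul_sum, smul_add,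
    smul_sub, smul_comm (B : ℝ)⁻¹]

/-- Here p = I/m is the probability that a block is drawn and r = m/I. The coefficient k = (r -
1)/(1 - α) satisfies p(1 - α)k = 1 - p, so the inner products `ed` of the drawn and the idle case
cancel. From α ≤ 1/2 follows k ≤ 2(r - 1); the constant 13 consists of 5 for the mean increment and
8 for its noise. -/
theorem msvr_scalar_bound {α K D e d ed nz p n r : ℝ} (hα : 0 < α) (hα' : α ≤ 1 / 2)
    (hp : 0 < p) (hp1 : p ≤ 1) (hr : r = 1 / p) (hD : 0 ≤ D) (hK : 0 ≤ K) (he : 0 ≤ e) (hn : 0 ≤ n)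
    (hn1 : n ≤ 1) (hd : d ≤ K * D)
    (hnz : nz ≤ 2 * K * (α ^ 2 + ((r - 1) / (1 - α) + (1 - α)) ^ 2 * D) * n) :
    p * ((1 - α) ^ 2 * e + 2 * ((1 - α) * ((r - 1) / (1 - α))) * ed
      + ((r - 1) / (1 - α)) ^ 2 * d + nz) + (1 - p) * (e - 2 * ed + d)
      ≤ (1 - α * p) * e + 13 * K * r * D + 2 * K * p * α ^ 2 * n := by
  have h1 : (1 - α) * ((r - 1) / (1 - α)) = r - 1 := by
    field_simp [(by linarith : (1 - α) ≠ 0)]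
  have hpr : p * r = 1 := by rw [hr]; field_simp
  have hr1 : 1 ≤ r := by rw [hr, le_div_iff₀ hp]; linarith
  set k := (r - 1) / (1 - α) with hk
  have hk0 : 0 ≤ k := div_nonneg (by linarith) (by linarith)
  have hk1 : k ≤ 2 * (r - 1) := by
    rw [hk, div_le_iff₀ (by linarith)]; nlinarith
  rw [h1]
  have hKD : 0 ≤ K * D := mul_nonneg hK hD
  have a1 : p * k ^ 2 ≤ 4 * r := by
    have : k ^ 2 ≤ (2 * r) ^ 2 := by gcongr; linarith
    have h2 := mul_le_mul_of_nonneg_left this hp.le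
    have h3 : p * (2 * r) ^ 2 = 4 * (p * r) * r := by ring
    rw [h3, hpr] at h2; linarith
  have a2 : p * (k + (1 - α)) ^ 2 ≤ 4 * r := by
    have : (k + (1 - α)) ^ 2 ≤ (2 * r) ^ 2 := by gcongr <;> linarith
    have h2 := mul_le_mul_of_nonneg_left this hp.le
    have h3 : p * (2 * r) ^ 2 = 4 * (p * r) * r := by ring
    rw [h3, hpr] at h2; linarith
  have b1 : p * k ^ 2 * d + (1 - p) * d ≤ 5 * r * (K * D) := by
    have h2 : 0 ≤ p * k ^ 2 + (1 - p) := by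
      have : 0 ≤ p * k ^ 2 := by positivity
      linarith
    have h3 : p * k ^ 2 + (1 - p) ≤ 5 * r := by linarith
    calc p * k ^ 2 * d + (1 - p) * d = (p * k ^ 2 + (1 - p)) * d := by ring
      _ ≤ (p * k ^ 2 + (1 - p)) * (K * D) := by gcongr
      _ ≤ 5 * r * (K * D) := by gcongr
  have b2 : p * nz ≤ 2 * K * p * α ^ 2 * n + 8 * r * (K * D) := by
    have h2 := mul_le_mul_of_nonneg_left hnz hp.le
    have h3 : p * (2 * K * (α ^ 2 + (k + (1 - α)) ^ 2 * D) * n)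
        = 2 * K * p * α ^ 2 * n + 2 * (K * D) * (p * (k + (1 - α)) ^ 2) * n := by ring
    have h4 : 2 * (K * D) * (p * (k + (1 - α)) ^ 2) * n ≤ 2 * (K * D) * (4 * r) * 1 := by gcongr
    linarith
  have b3 : p * ((1 - α) ^ 2 * e) + (1 - p) * e ≤ (1 - α * p) * e := by
    have : (1 - α) ^ 2 ≤ 1 - α := by nlinarith
    nlinarith [mul_le_mul_of_nonneg_right this (mul_nonneg hp.le he)]
  have b4 : p * (2 * (r - 1) * ed) = 2 * (1 - p) * ed := by
    have : p * (2 * (r - 1) * ed) = 2 * (p * r - p) * ed := by ring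
    rw [this, hpr]
  nlinarith

section Iteration

variable {Ω S : Type*} [MeasurableSpace Ω] [MeasurableSpace S] {pr : Measure Ω}
  {m B I : ℕ}

/-- The σ-algebra generated by all mini-batches of one iteration. -/
abbrev sampleSigma (smp : Fin m → Fin B → Ω → S) : MeasurableSpace Ω :=
  ⨆ i, ⨆ b, MeasurableSpace.comap (smp i b) inferInstance

theorem measurable_smp_sampleSigma {Ω S : Type*} [MeasurableSpace S] {m B : ℕ}
    {smp : Fin m → Fin B → Ω → S} (i : Fin m) (b : Fin B) :
    Measurable[sampleSigma smp] (smp i b) :=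
  Measurable.of_comap_le (le_iSup₂_of_le (f := fun i b => MeasurableSpace.comap (smp i b) inferInstance)
    i b le_rfl)

/-- The randomness of one iteration: a uniform `I`-element set of blocks and, independently,
independent samples of laws `Pl i`. -/
structure IsIteration (pr : Measure Ω) (blocks : Ω → Finset (Fin m)) (smp : Fin m → Fin B → Ω → S)
    (Pl : Fin m → Measure S) (I : ℕ) : Prop where
  meas_blocks : ∀ A, MeasurableSet (blocks ⁻¹' {A})
  meas_smp : ∀ i b, Measurable (smp i b)
  law_blocks : ∀ A : Finset (Fin m), A.card = I → pr (blocks ⁻¹' {A}) = ((m.choose I : ℕ) : ℝ≥0∞)⁻¹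
  law_smp : ∀ i b, pr.map (smp i b) = Pl i
  indep_smp : ∀ i b b', b ≠ b' → IndepFun (smp i b) (smp i b') pr
  indep_batch : ∀ i i', i ≠ i' → IndepFun (fun ω b => smp i b ω) (fun ω b => smp i' b ω) pr
  indep_blocks : Indep (MeasurableSpace.comap blocks ⊤) (sampleSigma smp) pr

theorem measurable_norm_const_add_sq {d : ℕ} {X : Ω → Vec d} (hX : Measurable X) (a : Vec d) :
    Measurable fun ω => ‖a + X ω‖ ^ 2 :=
  ((measurable_const.add hX).norm).pow_const 2

theorem measurable_norm_const_add_sum_sq {d : ℕ} {J : Type*} (A : Finset J) {X : J → Ω → Vec d}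
    (hX : ∀ j, Measurable (X j)) (r : ℝ) (a : Vec d) :
    Measurable fun ω => ‖a + ∑ j ∈ A, r • X j ω‖ ^ 2 :=
  measurable_norm_const_add_sq (Finset.measurable_fun_sum A fun j _ => (hX j).const_smul r) a

variable {blocks : Ω → Finset (Fin m)} {smp : Fin m → Fin B → Ω → S} {Pl : Fin m → Measure S}

theorem measurable_batchMean {E : Type*} [NormedAddCommGroup E] [NormedSpace ℝ E]
    [MeasurableSpace E] [BorelSpace E] [SecondCountableTopology E] {h : S → E} (hh : Measurable h)
    {Ω' : Type*} [MeasurableSpace Ω'] {s : Fin B → Ω' → S} (hs : ∀ b, Measurable (s b)) :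
    Measurable fun ω => batchMean h fun b => s b ω := by
  unfold batchMean
  exact (Finset.measurable_fun_sum _ fun b _ => hh.comp (hs b)).const_smul _

theorem measurable_batchNoise {d : ℕ} {h h' : S → Vec d} (hh : Measurable h) (hh' : Measurable h')
    (e e' : Vec d) (α γ : ℝ) {Ω' : Type*} [MeasurableSpace Ω'] {s : Fin B → Ω' → S}
    (hs : ∀ b, Measurable (s b)) :
    Measurable fun ω => batchNoise h h' e e' α γ fun b => s b ω :=
  (measurable_batchMean ((hh.const_smul α).add ((hh.sub hh').const_smul γ)) hs).sub_const _

namespace IsIteration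

variable (hit : IsIteration pr blocks smp Pl I)
include hit

theorem sampleSigma_le : sampleSigma smp ≤ ‹MeasurableSpace Ω› :=
  iSup₂_le fun i b => (hit.meas_smp i b).comap_le

theorem ae_card [IsProbabilityMeasure pr] (hI : I ≤ m) : ∀ᵐ ω ∂pr, (blocks ω).card = I := by
  have h1 : pr (⋃ A ∈ Finset.powersetCard I Finset.univ, blocks ⁻¹' {A}) = 1 := by
    rw [measure_biUnion_finset (fun A _ A' _ hne => by
        refine Disjoint.preimage _ ?_
        simpa using hne) (fun A _ => hit.meas_blocks A),
      Finset.sum_congr rfl fun A hA => hit.law_blocks A (Finset.mem_powersetCard.1 hA).2,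
      Finset.sum_const, Finset.card_powersetCard, Finset.card_univ, Fintype.card_fin, nsmul_eq_mul]
    exact ENNReal.mul_inv_cancel (by exact_mod_cast (Nat.choose_pos hI).ne')
      (ENNReal.natCast_ne_top _)
  have h2 : ∀ᵐ ω ∂pr, ω ∈ ⋃ A ∈ Finset.powersetCard I Finset.univ, blocks ⁻¹' {A} :=
    (mem_ae_iff_prob_eq_one (Finset.measurableSet_biUnion _ fun A _ => hit.meas_blocks A)).2 h1
  filter_upwards [h2] with ω hω
  simp only [Set.mem_iUnion, Set.mem_preimage, Set.mem_singleton_iff] at hω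
  obtain ⟨A, hA, hω⟩ := hω
  rw [hω]
  exact (Finset.mem_powersetCard.1 hA).2

/-- Conditioning on the set of blocks. -/
theorem lintegral_blocks [IsProbabilityMeasure pr] (hI : I ≤ m) {G : Finset (Fin m) → Ω → ℝ≥0∞}
    (hG : ∀ A, Measurable[sampleSigma smp] (G A)) :
    ∫⁻ ω, G (blocks ω) ω ∂pr = ∑ A ∈ Finset.powersetCard I Finset.univ,
      ((m.choose I : ℕ) : ℝ≥0∞)⁻¹ * ∫⁻ ω, G A ω ∂pr := by
  have hGm : ∀ A, Measurable (G A) := fun A => (hG A).mono hit.sampleSigma_le le_rfl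
  -- Almost surely the drawn set has I elements. Evaluation at the random set is then a finite sum,
  -- and each indicator is independent of the samples.
  have h1 : ∀ᵐ ω ∂pr, G (blocks ω) ω = ∑ A ∈ Finset.powersetCard I Finset.univ,
      (blocks ⁻¹' {A}).indicator 1 ω * G A ω := by
    filter_upwards [hit.ae_card hI] with ω hω
    rw [Finset.sum_eq_single_of_mem (blocks ω) (Finset.mem_powersetCard.2 ⟨Finset.subset_univ _, hω⟩)]
    · simp
    · intro A _ hA
      rw [Set.indicator_of_notMem, zero_mul]
      exact fun h => hA h.symm
  have h2 : ∀ A ∈ Finset.powersetCard I Finset.univ,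
      Measurable fun ω => (blocks ⁻¹' {A}).indicator 1 ω * G A ω := fun A _ =>
    (measurable_one.indicator (hit.meas_blocks A)).mul (hGm A)
  rw [lintegral_congr_ae h1, lintegral_finsetSum _ h2]
  refine Finset.sum_congr rfl fun A hA => ?_
  have hb : MeasurableSpace.comap blocks ⊤ ≤ ‹MeasurableSpace Ω› := by
    rintro _ ⟨t, -, rfl⟩
    rw [← Set.biUnion_of_singleton t, Set.preimage_iUnion₂]
    exact .biUnion (Set.to_countable t) fun A _ => hit.meas_blocks A
  rw [lintegral_mul_eq_lintegral_mul_lintegral_of_independent_measurableSpace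
    (f := (blocks ⁻¹' {A}).indicator 1) hb
    hit.sampleSigma_le hit.indep_blocks
    (fun t _ => ⟨({A} : Set (Finset (Fin m))).indicator (1 : Finset (Fin m) → ℝ≥0∞) ⁻¹' t, trivial, rfl⟩) (hG A),
    lintegral_indicator_one (hit.meas_blocks A), hit.law_blocks A (Finset.mem_powersetCard.1 hA).2]

theorem lintegral_blocks_le [IsProbabilityMeasure pr] (hI : I ≤ m)
    {g : Finset (Fin m) → Ω → ℝ} {r : Finset (Fin m) → ℝ} (hg0 : ∀ A ω, 0 ≤ g A ω)
    (hgm : ∀ A, Measurable[sampleSigma smp] (g A))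
    (hgi : ∀ A, Integrable (g A) pr) (hr : ∀ A, A.card = I → ∫ ω, g A ω ∂pr ≤ r A) :
    ∫⁻ ω, ENNReal.ofReal (g (blocks ω) ω) ∂pr ≤ ENNReal.ofReal (blockAvg I r) := by
  rw [hit.lintegral_blocks hI fun A => (hgm A).ennreal_ofReal]
  have hr0 : ∀ A, A.card = I → 0 ≤ r A := fun A hA => (integral_nonneg (hg0 A)).trans (hr A hA)
  have h1 : ENNReal.ofReal (blockAvg I r) = ∑ A ∈ Finset.powersetCard I Finset.univ,
      ((m.choose I : ℕ) : ℝ≥0∞)⁻¹ * ENNReal.ofReal (r A) := by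
    rw [blockAvg, ENNReal.ofReal_mul (by positivity), ENNReal.ofReal_sum_of_nonneg
      fun A hA => hr0 A (Finset.mem_powersetCard.1 hA).2, Finset.mul_sum,
      ENNReal.ofReal_inv_of_pos (by exact_mod_cast Nat.choose_pos hI), ENNReal.ofReal_natCast]
  rw [h1]
  refine Finset.sum_le_sum fun A hA => ?_
  gcongr
  rw [← ofReal_integral_eq_lintegral_ofReal (hgi A) (.of_forall (hg0 A))]
  exact ENNReal.ofReal_le_ofReal (hr A (Finset.mem_powersetCard.1 hA).2)

/-- One-step error bound for the MSVR estimator of a block. -/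
theorem lintegral_msvr_le [IsProbabilityMeasure pr] (hI : 1 ≤ I) (hIm : I ≤ m) (hB : 1 ≤ B)
    {d : ℕ} (i : Fin m) [IsProbabilityMeasure (Pl i)] {h h' : S → Vec d} {e e' : Vec d} {K D : ℝ}
    (hK : 0 ≤ K) (hD : 0 ≤ D) (ho : IsOracle (Pl i) h h' e e' K D) {α : ℝ} (hα : 0 < α)
    (hα' : α ≤ 1 / 2) (s : Vec d) :
    ∫⁻ ω, ENNReal.ofReal (‖(if i ∈ blocks ω then msvr m I α s (batchMean h fun b => smp i b ω)
      (batchMean h' fun b => smp i b ω) else s) - e‖ ^ 2) ∂pr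
      ≤ ENNReal.ofReal ((1 - α * (I / m)) * ‖s - e'‖ ^ 2 + 13 * K * (m / I) * D
        + 2 * K * (I / m) * α ^ 2 * (1 / B)) := by
  have hI0 : (0 : ℝ) < I := by exact_mod_cast hI
  have hm0 : (0 : ℝ) < m := by exact_mod_cast hI.trans hIm
  have hB0 : (1 : ℝ) ≤ B := by exact_mod_cast hB
  -- `k` is what γ contains beyond the usual STORM coefficient 1 - α; it compensates for the
  -- iterations in which the block is idle.
  set k : ℝ := ((m : ℝ) / I - 1) / (1 - α) with hk
  have hγ : msvrGamma m I α = k + (1 - α) := by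
    rw [msvrGamma, hk]
    field_simp
  set N : Ω → Vec d := fun ω => batchNoise h h' e e' α (k + (1 - α)) fun b => smp i b ω with hN
  have hmem : MemLp N 2 pr :=
    memLp_batchNoise ho hB (hit.meas_smp i) (hit.law_smp i) α (k + (1 - α))
  -- The mean error of a drawn block. An idle block keeps `s`, with error (s - e') - (e - e')
  -- against the new target.
  set A₀ : Vec d := (1 - α) • (s - e') + k • (e - e') with hA₀
  set g : Finset (Fin m) → Ω → ℝ := fun A ω =>
    if i ∈ A then ‖A₀ + N ω‖ ^ 2 else ‖(s - e') - (e - e')‖ ^ 2 with hg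
  have hgoal : ∀ ω, ‖(if i ∈ blocks ω then msvr m I α s (batchMean h fun b => smp i b ω)
      (batchMean h' fun b => smp i b ω) else s) - e‖ ^ 2 = g (blocks ω) ω := fun ω => by
    simp only [hg]
    split_ifs with hi
    · congr 2
      rw [hN, hA₀, msvr, hγ]
      simp only [batchNoise, batchMean_comb]
      module
    · congr 2
      abel
  simp only [hgoal]
  have hNs : Measurable[sampleSigma smp] N :=
    @measurable_batchNoise S _ B d h h' ho.meas ho.meas' e e' α (k + (1 - α)) Ω (sampleSigma smp)
      (smp i) (measurable_smp_sampleSigma i)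
  have hr : ∀ A, A.card = I → ∫ ω, g A ω ∂pr ≤ (if i ∈ A then ‖A₀‖ ^ 2
      + 2 * K * (α ^ 2 + (k + (1 - α)) ^ 2 * D) / B else ‖(s - e') - (e - e')‖ ^ 2) := by
    intro A _
    simp only [hg]
    split_ifs with hi
    · rw [integral_norm_const_add_sq A₀ hmem (integral_batchNoise ho hB (hit.meas_smp i)
        (hit.law_smp i) α (k + (1 - α)))]
      gcongr
      exact integral_norm_batchNoise_sq_le ho hB (hit.meas_smp i) (hit.law_smp i) _ _
        (hit.indep_smp i)
    · simp
  refine (hit.lintegral_blocks_le hIm (fun A ω => ?_) (fun A => ?_) (fun A => ?_) hr).trans ?_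
  · simp only [hg]; split_ifs <;> positivity
  · simp only [hg]
    split_ifs
    · exact @measurable_norm_const_add_sq Ω (sampleSigma smp) d N hNs A₀
    · exact measurable_const
  · simp only [hg]
    split_ifs
    · exact integrable_norm_sq ((memLp_const A₀).add hmem)
    · exact integrable_const _
  rw [blockAvg_ite_mem hI hIm]
  refine ENNReal.ofReal_le_ofReal ?_
  have h1 := norm_add_sq_real ((1 - α) • (s - e')) (k • (e - e'))
  have h2 := norm_sub_sq_real (s - e') (e - e')
  rw [norm_smul, norm_smul, mul_pow, mul_pow, Real.norm_eq_abs, Real.norm_eq_abs, sq_abs, sq_abs,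
    real_inner_smul_left, inner_smul_right, ← hA₀] at h1
  have h3 := msvr_scalar_bound (α := α) (K := K) (D := D) (e := ‖s - e'‖ ^ 2) (d := ‖e - e'‖ ^ 2)
    (ed := inner ℝ (s - e') (e - e')) (nz := 2 * K * (α ^ 2 + (k + (1 - α)) ^ 2 * D) / B)
    (p := I / m) (n := 1 / B) (r := m / I) hα hα' (by positivity)
    ((div_le_one hm0).2 (by exact_mod_cast hIm)) (by rw [one_div_div]) hD hK (sq_nonneg _)
    (by positivity) ((div_le_one (by positivity)).2 hB0) ho.norm_mean_sub_sq_le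
    (le_of_eq (by rw [← hk]; ring))
  rw [← hk] at h3
  rw [h1, h2]
  refine le_trans (le_of_eq ?_) h3
  ring

set_option maxHeartbeats 1000000 in
/-- One-step error bound for the STORM estimator. -/
theorem lintegral_storm_le [IsProbabilityMeasure pr] (hI : 1 ≤ I) (hIm : I ≤ m) (hB : 1 ≤ B)
    {d : ℕ} [∀ i, IsProbabilityMeasure (Pl i)] {h h' : Fin m → S → Vec d} {e e' : Fin m → Vec d}
    {K : ℝ} {D : Fin m → ℝ} (hK : 0 ≤ K) (hD : ∀ i, 0 ≤ D i)
    (ho : ∀ i, IsOracle (Pl i) (h i) (h' i) (e i) (e' i) K (D i)) (q : Vec d)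
    (hq : ∀ i, ‖e i - q‖ ^ 2 ≤ K) {β : ℝ} (hβ : 0 < β) (hβ' : β ≤ 1 / 2) (z : Vec d) :
    ∫⁻ ω, ENNReal.ofReal (‖((1 - β) • (z - (I : ℝ)⁻¹ • ∑ i ∈ blocks ω,
      batchMean (h' i) fun b => smp i b ω) + (I : ℝ)⁻¹ • ∑ i ∈ blocks ω,
        batchMean (h i) fun b => smp i b ω) - (m : ℝ)⁻¹ • ∑ i, e i‖ ^ 2) ∂pr
      ≤ ENNReal.ofReal ((1 - β) * ‖z - (m : ℝ)⁻¹ • ∑ i, e' i‖ ^ 2 + 4 * K * avg D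
        + 4 * K * β ^ 2 * (1 / min (I : ℝ) B)) := by
  have hI0 : (1 : ℝ) ≤ I := by exact_mod_cast hI
  have hm0 : (0 : ℝ) < m := by exact_mod_cast hI.trans hIm
  have hB0 : (1 : ℝ) ≤ B := by exact_mod_cast hB
  set N : Fin m → Ω → Vec d := fun i ω =>
    batchNoise (h i) (h' i) (e i) (e' i) β (1 - β) fun b => smp i b ω with hN
  -- `H i` is the mean contribution of block i to the recursion and `Hm` its average over blocks; H
  -- i - Hm is the part that is random only through the choice of blocks.
  set H : Fin m → Vec d := fun i => β • e i + (1 - β) • (e i - e' i) with hH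
  set Hm : Vec d := (m : ℝ)⁻¹ • ∑ i, H i with hHm
  set x₀ : Vec d := z - (m : ℝ)⁻¹ • ∑ i, e' i with hx₀
  have hsum0 : ∑ i, (H i - Hm) = 0 := by
    rw [Finset.sum_sub_distrib, Finset.sum_const, Finset.card_univ, Fintype.card_fin, hHm,
      ← Nat.cast_smul_eq_nsmul ℝ, smul_smul, mul_inv_cancel₀ hm0.ne', one_smul, sub_self]
  -- The error for a fixed set of blocks after averaging over the samples: the contracted old error
  -- plus the block-sampling error. The mini-batch noise is centred and adds its second moment.
  set c₀ : Finset (Fin m) → Vec d := fun A => (1 - β) • x₀ + (I : ℝ)⁻¹ • ∑ i ∈ A, (H i - Hm)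
    with hc₀
  set g : Finset (Fin m) → Ω → ℝ := fun A ω => ‖c₀ A + ∑ i ∈ A, (I : ℝ)⁻¹ • N i ω‖ ^ 2 with hg
  have hmem : ∀ i, MemLp (fun ω => (I : ℝ)⁻¹ • N i ω) 2 pr := fun i =>
    (memLp_batchNoise (ho i) hB (hit.meas_smp i) (hit.law_smp i) β (1 - β)).const_smul (I : ℝ)⁻¹
  have hmemS : ∀ A : Finset (Fin m), MemLp (fun ω => ∑ i ∈ A, (I : ℝ)⁻¹ • N i ω) 2 pr := fun A =>
    memLp_finsetSum A fun i _ => hmem i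
  have hmean : ∀ i, ∫ ω, (I : ℝ)⁻¹ • N i ω ∂pr = 0 := fun i => by
    rw [integral_smul, integral_batchNoise (ho i) hB (hit.meas_smp i) (hit.law_smp i) β (1 - β),
      smul_zero]
  have hNs : ∀ i, Measurable[sampleSigma smp] (N i) := fun i =>
    @measurable_batchNoise S _ B d (h i) (h' i) (ho i).meas (ho i).meas' (e i) (e' i) β (1 - β) Ω
      (sampleSigma smp) (smp i) (measurable_smp_sampleSigma i)
  have hind : ∀ i i', i ≠ i' →
      IndepFun (fun ω => (I : ℝ)⁻¹ • N i ω) (fun ω => (I : ℝ)⁻¹ • N i' ω) pr := by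
    intro i i' hne
    have hb : ∀ i, Measurable fun s : Fin B → S =>
        (I : ℝ)⁻¹ • batchNoise (h i) (h' i) (e i) (e' i) β (1 - β) fun b => s b := fun i =>
      (measurable_batchNoise (ho i).meas (ho i).meas' (e i) (e' i) β (1 - β)
        (fun b => measurable_pi_apply b)).const_smul (I : ℝ)⁻¹
    exact (hit.indep_batch i i' hne).comp (hb i) (hb i')
  have hgoal : ∀ᵐ ω ∂pr, ENNReal.ofReal (‖((1 - β) • (z - (I : ℝ)⁻¹ • ∑ i ∈ blocks ω,
      batchMean (h' i) fun b => smp i b ω) + (I : ℝ)⁻¹ • ∑ i ∈ blocks ω,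
        batchMean (h i) fun b => smp i b ω) - (m : ℝ)⁻¹ • ∑ i, e i‖ ^ 2)
      = ENNReal.ofReal (g (blocks ω) ω) := by
    filter_upwards [hit.ae_card hIm] with ω hω
    congr 3
    have e1 : ∑ i ∈ blocks ω, (I : ℝ)⁻¹ • N i ω = (I : ℝ)⁻¹ • (∑ i ∈ blocks ω,
        (batchMean (h i) fun b => smp i b ω)) - (1 - β) • (I : ℝ)⁻¹ • (∑ i ∈ blocks ω,
        (batchMean (h' i) fun b => smp i b ω)) - (I : ℝ)⁻¹ • ∑ i ∈ blocks ω, H i := by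
      simp only [hN, hH, batchNoise, batchMean_comb, Finset.smul_sum, ← Finset.sum_sub_distrib]
      refine Finset.sum_congr rfl fun i _ => ?_
      module
    have e2 : ∑ i ∈ blocks ω, (H i - Hm) = (∑ i ∈ blocks ω, H i) - (I : ℝ) • Hm := by
      rw [Finset.sum_sub_distrib, Finset.sum_const, hω, ← Nat.cast_smul_eq_nsmul ℝ]
    have e3 : Hm = (m : ℝ)⁻¹ • (∑ i, e i) - (1 - β) • (m : ℝ)⁻¹ • ∑ i, e' i := by
      simp only [hHm, hH, Finset.smul_sum, ← Finset.sum_sub_distrib]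
      refine Finset.sum_congr rfl fun i _ => ?_
      module
    have e4 : (I : ℝ)⁻¹ • (∑ i ∈ blocks ω, H i - (I : ℝ) • Hm)
        = (I : ℝ)⁻¹ • (∑ i ∈ blocks ω, H i) - Hm := by
      rw [smul_sub, smul_smul, inv_mul_cancel₀ (by positivity), one_smul]
    rw [hc₀]
    simp only
    rw [e1, e2, e4, e3, hx₀]
    module
  rw [lintegral_congr_ae hgoal]
  have hr : ∀ A, A.card = I → ∫ ω, g A ω ∂pr ≤ ‖c₀ A‖ ^ 2 + ∑ i ∈ A, ((I : ℝ)⁻¹) ^ 2 *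
      (2 * K * (β ^ 2 + (1 - β) ^ 2 * D i) / B) := by
    intro A _
    simp only [hg]
    rw [integral_norm_const_add_sq (c₀ A) (hmemS A) (by
      rw [integral_finsetSum _ fun i _ => (hmem i).integrable one_le_two]
      exact Finset.sum_eq_zero fun i _ => hmean i),
      integral_norm_sum_sq A (fun i _ => hmem i) (fun i _ => hmean i)
        (fun i _ i' _ hne => hind i i' hne)]
    gcongr with i hi
    simp only [norm_smul, mul_pow]
    rw [integral_const_mul, norm_inv, RCLike.norm_natCast]
    gcongr
    exact integral_norm_batchNoise_sq_le (ho i) hB (hit.meas_smp i) (hit.law_smp i) _ _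
      (hit.indep_smp i)
  refine (hit.lintegral_blocks_le hIm (fun A ω => sq_nonneg _) (fun A => ?_) (fun A => ?_)
    hr).trans ?_
  · exact @measurable_norm_const_add_sum_sq Ω (sampleSigma smp) d _ A N hNs (I : ℝ)⁻¹ (c₀ A)
  · exact integrable_norm_sq ((memLp_const (c₀ A)).add (hmemS A))
  refine ENNReal.ofReal_le_ofReal ?_
  -- The expansion isolates the inner product with the old error, whose average over the sets A
  -- vanishes because the H i - Hm sum to zero.
  have t1 : ∀ A : Finset (Fin m), ‖c₀ A‖ ^ 2 + ∑ i ∈ A, ((I : ℝ)⁻¹) ^ 2 *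
      (2 * K * (β ^ 2 + (1 - β) ^ 2 * D i) / B)
      = ((1 - β) ^ 2 * ‖x₀‖ ^ 2 + (2 * (1 - β) * (I : ℝ)⁻¹) * inner ℝ x₀ (∑ i ∈ A, (H i - Hm)))
        + (((I : ℝ)⁻¹) ^ 2 * ‖∑ i ∈ A, (H i - Hm)‖ ^ 2
          + ∑ i, (((I : ℝ)⁻¹) ^ 2 * (2 * K * (β ^ 2 + (1 - β) ^ 2 * D i) / B))
            * (if i ∈ A then 1 else 0)) := fun A => by
    have e1 : ∑ i, (((I : ℝ)⁻¹) ^ 2 * (2 * K * (β ^ 2 + (1 - β) ^ 2 * D i) / B))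
            * (if i ∈ A then (1 : ℝ) else 0)
          = ∑ i ∈ A, ((I : ℝ)⁻¹) ^ 2 * (2 * K * (β ^ 2 + (1 - β) ^ 2 * D i) / B) := by
      simp [Finset.sum_ite_mem]
    rw [e1, hc₀]
    simp only
    rw [norm_add_sq_real, norm_smul, norm_smul, mul_pow, mul_pow, Real.norm_eq_abs, sq_abs,
      Real.norm_eq_abs, sq_abs, real_inner_smul_left, inner_smul_right]
    ring
  simp only [t1]
  rw [blockAvg_add, blockAvg_add, blockAvg_add, blockAvg_const hIm, blockAvg_mul_left,
    blockAvg_mul_left, blockAvg_inner_sum hI hIm _ hsum0, blockAvg_sum]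
  simp only [blockAvg_mul_left, blockAvg_mem hI hIm]
  have u1 := blockAvg_norm_sum_sq_le hI hIm hsum0
  have u2 : ∑ i, ‖H i - Hm‖ ^ 2 ≤ ∑ i, (2 * K * (β ^ 2 + D i)) := by
    -- The mean minimizes the sum of squares, so any other centre is an upper bound. The centre β q
    -- is why it suffices that the block gradients are close to a common vector.
    have v1 : ∑ i, ‖H i - Hm‖ ^ 2 ≤ ∑ i, ‖H i - β • q‖ ^ 2 := by
      have w1 : ∀ i, ‖H i - β • q‖ ^ 2
          = ‖H i - Hm‖ ^ 2 + 2 * inner ℝ (H i - Hm) (Hm - β • q) + ‖Hm - β • q‖ ^ 2 := fun i => by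
        rw [← norm_add_sq_real]; congr 2; abel
      simp only [w1]
      rw [Finset.sum_add_distrib, Finset.sum_add_distrib, ← Finset.mul_sum, ← sum_inner, hsum0,
        inner_zero_left, mul_zero, add_zero]
      have : 0 ≤ ∑ _i : Fin m, ‖Hm - β • q‖ ^ 2 := Finset.sum_nonneg fun _ _ => sq_nonneg _
      linarith
    refine v1.trans (Finset.sum_le_sum fun i _ => ?_)
    have w1 : H i - β • q = β • (e i - q) + (1 - β) • (e i - e' i) := by
      simp only [hH]; module
    rw [w1]
    refine (norm_add_sq_le_two _ _).trans ?_
    rw [norm_smul, norm_smul, mul_pow, mul_pow, Real.norm_eq_abs, sq_abs, Real.norm_eq_abs, sq_abs]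
    have w2 := (ho i).norm_mean_sub_sq_le
    have w3 : (1 - β) ^ 2 * ‖e i - e' i‖ ^ 2 ≤ 1 * (K * D i) := by
      gcongr
      nlinarith
    have w4 := mul_le_mul_of_nonneg_left (hq i) (sq_nonneg β)
    nlinarith
  have u3 : ∑ i, ((I : ℝ)⁻¹) ^ 2 * (2 * K * (β ^ 2 + (1 - β) ^ 2 * D i) / B) * ((I : ℝ) / m)
      ≤ ((I : ℝ)⁻¹ / m) * ((1 / B) * ∑ i, 2 * K * (β ^ 2 + D i)) := by
    rw [Finset.mul_sum, Finset.mul_sum]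
    refine Finset.sum_le_sum fun i _ => ?_
    have w1 : (1 - β) ^ 2 * D i ≤ 1 * D i := by
      have := hD i
      gcongr
      nlinarith
    calc _ = ((I : ℝ)⁻¹ / m) * ((1 / B) * (2 * K * (β ^ 2 + (1 - β) ^ 2 * D i))) := by
          field_simp
      _ ≤ _ := by gcongr; linarith
  have u4 : ∑ i, 2 * K * (β ^ 2 + D i) = m * (2 * K * (β ^ 2 + avg D)) := by
    rw [← Finset.mul_sum, Finset.sum_add_distrib, avg]
    simp only [Finset.sum_const, Finset.card_univ, Fintype.card_fin, nsmul_eq_mul]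
    field_simp
  have u5 : ((I : ℝ)⁻¹) ^ 2 * blockAvg I (fun S => ‖∑ i ∈ S, (H i - Hm)‖ ^ 2)
      ≤ (1 / I) * (2 * K * (β ^ 2 + avg D)) := by
    calc _ ≤ ((I : ℝ)⁻¹) ^ 2 * ((I : ℝ) / m * (m * (2 * K * (β ^ 2 + avg D)))) := by
          gcongr
          exact u1.trans (by gcongr; rw [← u4]; exact u2)
      _ = _ := by field_simp
  have hDa : 0 ≤ avg D := avg_nonneg hD
  have u6 : ((I : ℝ)⁻¹ / m) * ((1 / B) * ∑ i, 2 * K * (β ^ 2 + D i))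
      ≤ (1 / I) * (2 * K * (β ^ 2 + avg D)) := by
    rw [u4]
    have hB1 : 1 / (B : ℝ) ≤ 1 := (div_le_one (by positivity)).2 hB0
    calc _ = (1 / I) * ((1 / B) * (2 * K * (β ^ 2 + avg D))) := by field_simp
      _ ≤ (1 / I) * (1 * (2 * K * (β ^ 2 + avg D))) := by gcongr
      _ = _ := by rw [one_mul]
  -- On the β² terms the factor 1/I is kept, in the form 1/min{I, B}. On the displacement terms it
  -- is bounded by 1.
  have hmin : 1 / (I : ℝ) ≤ 1 / min (I : ℝ) B :=
    one_div_le_one_div_of_le (by positivity) (min_le_left _ _)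
  have hI1 : 1 / (I : ℝ) ≤ 1 := (div_le_one (by positivity)).2 hI0
  have u7 : (1 / (I : ℝ)) * (K * β ^ 2) ≤ (1 / min (I : ℝ) B) * (K * β ^ 2) := by gcongr
  have u8 : (1 / (I : ℝ)) * (K * avg D) ≤ 1 * (K * avg D) := by gcongr
  have u9 : (1 - β) ^ 2 * ‖x₀‖ ^ 2 ≤ (1 - β) * ‖x₀‖ ^ 2 := by
    gcongr
    nlinarith
  nlinarith

end IsIteration

end Iteration

end BSVRB


/-! ### The oracles of the problem and the independence of the draws -/

namespace BSVRB

section Oracles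

theorem integral_norm_sub_sq_le_of_varLE {S E : Type*} [MeasurableSpace S] [NormedAddCommGroup E]
    {P : Measure S} {σ : ℝ} {h : S → E} {e : E} (hm : AEStronglyMeasurable h P)
    (hv : VarLE P σ h e) : ∫ s, ‖h s - e‖ ^ 2 ∂P ≤ σ ^ 2 := by
  have hm2 : AEStronglyMeasurable (fun s => ‖h s - e‖ ^ 2) P :=
    (hm.sub aestronglyMeasurable_const).norm.pow 2
  rw [integral_eq_lintegral_of_nonneg_ae (.of_forall fun s => sq_nonneg _) hm2]
  refine ENNReal.toReal_le_of_le_ofReal (sq_nonneg σ) (le_trans (le_of_eq ?_) hv)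
  congr 1
  funext s
  rw [ENNReal.ofReal_pow (norm_nonneg _), ofReal_norm]

variable {Ξ Z : Type*} [MeasurableSpace Ξ] [MeasurableSpace Z] {P : Measure Ξ} {Q : Measure Z}
  [IsProbabilityMeasure P] [IsProbabilityMeasure Q] {n d : ℕ}
  {A : Z → Vec d →L[ℝ] Vec n} {b : Ξ → Vec n} {A₀ : Vec d →L[ℝ] Vec n} {b₀ : Vec n} {σ V : ℝ}
  {v : Vec d}

theorem memLp_affine_sample (hA : MemLp A 2 Q) (hb : MemLp b 2 P) :
    MemLp (fun s : Ξ × Z => A s.2 v - b s.1) 2 (P.prod Q) := by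
  have h1 : MemLp (fun ζ => A ζ v) 2 Q :=
    (ContinuousLinearMap.apply ℝ (Vec n) v).comp_memLp' hA
  exact (h1.comp_measurePreserving measurePreserving_snd).sub
    (hb.comp_measurePreserving measurePreserving_fst)

theorem integral_affine_sample (hA : MemLp A 2 Q) (hb : MemLp b 2 P)
    (hA₀ : ∫ ζ, A ζ v ∂Q = A₀ v) (hb₀ : ∫ ξ, b ξ ∂P = b₀) :
    ∫ s : Ξ × Z, (A s.2 v - b s.1) ∂(P.prod Q) = A₀ v - b₀ := by
  have h1 : MemLp (fun ζ => A ζ v) 2 Q :=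
    (ContinuousLinearMap.apply ℝ (Vec n) v).comp_memLp' hA
  have h2 := (h1.comp_measurePreserving (measurePreserving_snd (μ := P))).integrable one_le_two
  have h3 := (hb.comp_measurePreserving (measurePreserving_fst (ν := Q))).integrable one_le_two
  have h4 := integral_sub h2 h3
  simp only [Function.comp_apply] at h4
  rw [h4, integral_fun_snd (fun ζ => A ζ v), integral_fun_fst (fun ξ => b ξ), hA₀, hb₀]
  simp

/-- The operator norm separates the matrix noise from v, whose norm is at most V, so the two
variance bounds add without any use of the independence of the two samples. -/
theorem integral_affine_var_le (hA : MemLp A 2 Q) (hb : MemLp b 2 P) (vA : VarLE Q σ A A₀)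
    (vb : VarLE P σ b b₀) (hv : ‖v‖ ≤ V) :
    ∫ s : Ξ × Z, ‖(A s.2 v - b s.1) - (A₀ v - b₀)‖ ^ 2 ∂(P.prod Q) ≤ 2 * (V ^ 2 + 1) * σ ^ 2 := by
  have i1 := (integrable_norm_sq (hA.sub (memLp_const A₀))).const_mul (2 * V ^ 2)
  have i2 := (integrable_norm_sq (hb.sub (memLp_const b₀))).const_mul 2
  simp only [Pi.sub_apply] at i1 i2
  have i1' := i1.comp_snd P
  have i2' := i2.comp_fst Q
  have hle : ∀ s : Ξ × Z, ‖(A s.2 v - b s.1) - (A₀ v - b₀)‖ ^ 2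
      ≤ 2 * V ^ 2 * ‖A s.2 - A₀‖ ^ 2 + 2 * ‖b s.1 - b₀‖ ^ 2 := fun s => by
    have e : (A s.2 v - b s.1) - (A₀ v - b₀) = (A s.2 - A₀) v + -(b s.1 - b₀) := by
      rw [sub_apply]; abel
    rw [e]
    refine (norm_add_sq_le_two _ _).trans ?_
    rw [norm_neg]
    have h1 : ‖(A s.2 - A₀) v‖ ≤ ‖A s.2 - A₀‖ * V :=
      (ContinuousLinearMap.le_opNorm _ _).trans (mul_le_mul_of_nonneg_left hv (norm_nonneg _))
    have h2 : ‖(A s.2 - A₀) v‖ ^ 2 ≤ (‖A s.2 - A₀‖ * V) ^ 2 := by gcongr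
    nlinarith
  refine (integral_mono (integrable_norm_sq ((memLp_affine_sample hA hb).sub
    (memLp_const (A₀ v - b₀)))) (i1'.add i2') hle).trans ?_
  rw [integral_add' i1' i2', integral_fun_snd (fun ζ => 2 * V ^ 2 * ‖A ζ - A₀‖ ^ 2),
    integral_fun_fst (fun ξ => 2 * ‖b ξ - b₀‖ ^ 2), integral_const_mul, integral_const_mul]
  have h1 := integral_norm_sub_sq_le_of_varLE hA.aestronglyMeasurable vA
  have h2 := integral_norm_sub_sq_le_of_varLE hb.aestronglyMeasurable vb
  simp only [probReal_univ, one_smul]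
  nlinarith [mul_le_mul_of_nonneg_left h1 (sq_nonneg V)]

end Oracles

section ProblemOracles

variable {m : ℕ} {Ξ Z : Type*} [MeasurableSpace Ξ] [MeasurableSpace Z] {p : Problem m Ξ Z}
  {c : Consts}

/-- The law of one upper-level and one lower-level sample. -/
noncomputable def Problem.law (p : Problem m Ξ Z) (i : Fin m) : Measure (Ξ × Z) :=
  (p.P i).prod (p.Q i)

theorem var_const_le_K (hc : c.Valid) : 2 * (c.V ^ 2 + 1) * c.σ ^ 2 ≤ c.K := by
  have h1 := hc.le_lip.2.2.2.2.2.1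
  have h2 : (c.σ * (1 + c.V)) ^ 2 ≤ c.lip ^ 2 := by
    have := hc.σ_nonneg
    have := hc.V_nonneg
    gcongr
  have h3 := hc.ratio_nonneg
  have h4 : 1 ≤ (1 + c.ratio) ^ 2 := by nlinarith
  unfold Consts.K
  nlinarith [sq_nonneg c.lip, hc.V_nonneg, mul_nonneg (sq_nonneg c.σ) hc.V_nonneg,
    mul_nonneg (sub_nonneg.2 h4) (sq_nonneg c.lip)]

theorem sigma_sq_le_K (hc : c.Valid) : c.σ ^ 2 ≤ c.K := by
  refine le_trans ?_ (var_const_le_K hc)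
  nlinarith [mul_nonneg (sq_nonneg c.σ) (sq_nonneg c.V), sq_nonneg c.σ]

variable (hp : p.Assumptions c) (hc : c.Valid)
include hp

theorem Problem.Assumptions.isProbabilityMeasure_law (i : Fin m) :
    IsProbabilityMeasure (p.law i) := by
  have := hp.probP i
  have := hp.probQ i
  unfold Problem.law
  infer_instance

include hc

theorem isOracle_gradY (a w : State p) (i : Fin m) :
    IsOracle (p.law i) (fun s => gradY (p.gS i s.2) w.x (w.y i))
      (fun s => gradY (p.gS i s.2) a.x (a.y i)) (gradY (p.gBar i) w.x (w.y i))
      (gradY (p.gBar i) a.x (a.y i)) c.K (blockDist p a w i) := by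
  have := hp.probP i
  have := hp.probQ i
  have mem : ∀ w : State p, MemLp (fun s : Ξ × Z => gradY (p.gS i s.2) w.x (w.y i)) 2 (p.law i) :=
    fun w => (hp.memLp_gradY_gS i w.x (w.y i)).comp_measurePreserving measurePreserving_snd
  have mean : ∀ w : State p, ∫ s : Ξ × Z, gradY (p.gS i s.2) w.x (w.y i) ∂(p.law i)
      = gradY (p.gBar i) w.x (w.y i) := fun w => by
    rw [Problem.law, integral_fun_snd (fun ζ => gradY (p.gS i ζ) w.x (w.y i)), hp.gradY_gBar]
    simp
  refine ⟨(hp.measurable_gradY_gS i _ _).comp measurable_snd,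
    (hp.measurable_gradY_gS i _ _).comp measurable_snd, mem w, mem a, mean w, mean a, ?_,
    fun s => ?_⟩
  · rw [Problem.law, integral_fun_snd (fun ζ => ‖gradY (p.gS i ζ) w.x (w.y i)
      - gradY (p.gBar i) w.x (w.y i)‖ ^ 2)]
    simp only [probReal_univ, one_smul]
    exact (integral_norm_sub_sq_le_of_varLE (hp.measurable_gradY_gS i _ _).aestronglyMeasurable
      (hp.var_gy i _ _)).trans (sigma_sq_le_K hc)
  · refine sq_le_K_mul hc (norm_nonneg _) (blockDist_nonneg a w i) ?_
    refine (hp.lip_gy i s.2 _ _ _ _).trans ?_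
    refine mul_le_mul hc.le_lip.2.1 (Real.sqrt_le_sqrt ?_) (Real.sqrt_nonneg _)
      (zero_le_one.trans hc.one_le_lip)
    unfold blockDist
    linarith [sq_nonneg ‖w.v i - a.v i‖]

theorem isOracle_ph (a w : State p) (i : Fin m) (ha : ‖a.v i‖ ≤ c.V) (hw : ‖w.v i‖ ≤ c.V) :
    IsOracle (p.law i) (fun s => p.phS i s.1 s.2 w.x (w.y i) (w.v i))
      (fun s => p.phS i s.1 s.2 a.x (a.y i) (a.v i)) (p.phBar i w.x (w.y i) (w.v i))
      (p.phBar i a.x (a.y i) (a.v i)) c.K (blockDist p a w i) := by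
  have := hp.probP i
  have := hp.probQ i
  have meas : ∀ w : State p, Measurable (fun s : Ξ × Z => p.phS i s.1 s.2 w.x (w.y i) (w.v i)) :=
    fun w => ((hp.measurable_hessYY_gS_apply i _ _ _).comp measurable_snd).sub
      ((hp.measurable_gradY_fS i _ _).comp measurable_fst)
  have mem : ∀ w : State p, MemLp (fun s : Ξ × Z => p.phS i s.1 s.2 w.x (w.y i) (w.v i)) 2
      (p.law i) := fun w =>
    memLp_affine_sample (hp.memLp_hessYY_gS i _ _) (hp.memLp_gradY_fS i _ _)
  have hess : ∀ w : State p, ∫ ζ, hessYY (p.gS i ζ) w.x (w.y i) (w.v i) ∂(p.Q i)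
      = hessYY (p.gBar i) w.x (w.y i) (w.v i) := fun w => by
    rw [hp.hessYY_gBar, ContinuousLinearMap.integral_apply (hp.integrable_hessYY_gS i _ _)]
  have mean : ∀ w : State p, ∫ s : Ξ × Z, p.phS i s.1 s.2 w.x (w.y i) (w.v i) ∂(p.law i)
      = p.phBar i w.x (w.y i) (w.v i) := fun w =>
    integral_affine_sample (hp.memLp_hessYY_gS i _ _) (hp.memLp_gradY_fS i _ _) (hess w)
      (hp.gradY_fBar i _ _).symm
  have var : ∫ s : Ξ × Z, ‖p.phS i s.1 s.2 w.x (w.y i) (w.v i)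
      - p.phBar i w.x (w.y i) (w.v i)‖ ^ 2 ∂(p.law i) ≤ c.K :=
    (integral_affine_var_le (hp.memLp_hessYY_gS i _ _) (hp.memLp_gradY_fS i _ _)
      (hp.var_gyy i _ _) (hp.var_fy i _ _) hw).trans (var_const_le_K hc)
  exact ⟨meas w, meas a, mem w, mem a, mean w, mean a, var,
    fun s => sq_le_K_mul hc (norm_nonneg _) (blockDist_nonneg a w i)
      (hp.norm_phS_sub_le hc i s.1 s.2 ha)⟩

theorem isOracle_tx (a w : State p) (i : Fin m) (ha : ‖a.v i‖ ≤ c.V) (hw : ‖w.v i‖ ≤ c.V) :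
    IsOracle (p.law i) (fun s => p.txS i s.1 s.2 w.x (w.y i) (w.v i))
      (fun s => p.txS i s.1 s.2 a.x (a.y i) (a.v i)) (p.txBar i w.x (w.y i) (w.v i))
      (p.txBar i a.x (a.y i) (a.v i)) c.K (blockDist p a w i) := by
  have := hp.probP i
  have := hp.probQ i
  have meas : ∀ w : State p, Measurable (fun s : Ξ × Z => p.txS i s.1 s.2 w.x (w.y i) (w.v i)) :=
    fun w => ((hp.measurable_gradX_fS i _ _).comp measurable_fst).sub
      ((hp.measurable_jacXY_gS_apply i _ _ _).comp measurable_snd)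
  have neg : ∀ w : State p, (fun s : Ξ × Z => p.txS i s.1 s.2 w.x (w.y i) (w.v i))
      = fun s => -(jacXY (p.gS i s.2) w.x (w.y i) (w.v i) - gradX (p.fS i s.1) w.x (w.y i)) :=
    fun w => funext fun s => by rw [Problem.txS]; abel
  have mem : ∀ w : State p, MemLp (fun s : Ξ × Z => p.txS i s.1 s.2 w.x (w.y i) (w.v i)) 2
      (p.law i) := fun w => by
    rw [neg]
    exact (memLp_affine_sample (hp.memLp_jacXY_gS i _ _) (hp.memLp_gradX_fS i _ _)).neg
  have mean : ∀ w : State p, ∫ s : Ξ × Z, p.txS i s.1 s.2 w.x (w.y i) (w.v i) ∂(p.law i)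
      = p.txBar i w.x (w.y i) (w.v i) := fun w => by
    rw [neg, integral_neg, Problem.law,
      integral_affine_sample (hp.memLp_jacXY_gS i _ _) (hp.memLp_gradX_fS i _ _)
      (hp.jacXY_gBar_apply i _ _ _).symm (hp.gradX_fBar i _ _).symm, Problem.txBar]
    abel
  refine ⟨meas w, meas a, mem w, mem a, mean w, mean a, ?_,
    fun s => sq_le_K_mul hc (norm_nonneg _) (blockDist_nonneg a w i)
      (hp.norm_txS_sub_le hc i s.1 s.2 ha)⟩
  refine le_trans (le_of_eq ?_) ((integral_affine_var_le (hp.memLp_jacXY_gS i _ _)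
    (hp.memLp_gradX_fS i _ _) (hp.var_gxy i w.x (w.y i)) (hp.var_fx i w.x (w.y i)) hw).trans
    (var_const_le_K hc))
  rw [Problem.law]
  congr 1
  funext s
  rw [← norm_neg]
  congr 2
  rw [Problem.txS, Problem.txBar]
  abel

/-- The centre is the common field a(x). The Jacobian term is bounded by L_gy V, so the
heterogeneity of the blocks is at most `K`, however large the gradients themselves are. -/
theorem exists_norm_txBar_sub_sq_le (w : State p) (hw : ∀ i, ‖w.v i‖ ≤ c.V) :
    ∃ q : Vec p.dx, ∀ i, ‖p.txBar i w.x (w.y i) (w.v i) - q‖ ^ 2 ≤ c.K := by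
  obtain ⟨a, ha⟩ := hp.bdd_fx
  refine ⟨a w.x, fun i => ?_⟩
  have h1 : ‖p.txBar i w.x (w.y i) (w.v i) - a w.x‖ ≤ c.lip := by
    have e : p.txBar i w.x (w.y i) (w.v i) - a w.x
        = (gradX (p.fBar i) w.x (w.y i) - a w.x) - jacXY (p.gBar i) w.x (w.y i) (w.v i) := by
      rw [Problem.txBar]; abel
    have h2 : ‖jacXY (p.gBar i) w.x (w.y i) (w.v i)‖ ≤ c.Lgy * c.V :=
      (ContinuousLinearMap.le_opNorm _ _).trans
        (mul_le_mul (hp.norm_jacXY_gBar_le hc i _ _) (hw i) (norm_nonneg _) hc.Lgy_nonneg)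
    rw [e]
    linarith [norm_sub_le (gradX (p.fBar i) w.x (w.y i) - a w.x)
      (jacXY (p.gBar i) w.x (w.y i) (w.v i)), ha i w.x (w.y i), hc.le_lip.2.2.2.2.1]
  calc _ ≤ c.lip ^ 2 := by gcongr
    _ ≤ c.K := hc.lip_sq_le_K

end ProblemOracles

section Sampling

variable {m B : ℕ} {Ξ Z Ω : Type*} [MeasurableSpace Ξ] [MeasurableSpace Z]

/-- The σ-algebra generated by a set of elementary draws. -/
abbrev Noise.sigmaOf (N : Noise m B Ξ Z Ω) (s : Set (DrawIdx m B)) : MeasurableSpace Ω :=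
  ⨆ j ∈ s, N.sigma j

/-- The draws before iteration `t` of stage `k`. -/
def DrawIdx.past (k t : ℕ) : Set (DrawIdx m B) := {j | match j with
  | .blocks k' t' => k' < k ∨ k' = k ∧ t' < t
  | .upper k' t' _ _ => k' < k ∨ k' = k ∧ t' < t
  | .lower k' t' _ _ => k' < k ∨ k' = k ∧ t' < t
  | .out k' => k' < k}

/-- The draws of iteration `t` of stage `k`. -/
def DrawIdx.now (k t : ℕ) : Set (DrawIdx m B) := {j | match j with
  | .blocks k' t' => k' = k ∧ t' = t
  | .upper k' t' _ _ => k' = k ∧ t' = t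
  | .lower k' t' _ _ => k' = k ∧ t' = t
  | .out _ => False}

/-- The label `.out k` lies in neither set: the output time of the running stage is independent of
its iterations as well. -/
theorem DrawIdx.disjoint_past_now (k t : ℕ) :
    Disjoint (DrawIdx.past k t : Set (DrawIdx m B)) (DrawIdx.now k t) := by
  rw [Set.disjoint_left]
  rintro (⟨k', t'⟩ | ⟨k', t', i, b⟩ | ⟨k', t', i, b⟩ | k') h h' <;>
    simp only [DrawIdx.past, DrawIdx.now, Set.mem_ofPred_eq] at h h' <;> omega

theorem DrawIdx.past_subset_succ (k t : ℕ) :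
    (DrawIdx.past k t : Set (DrawIdx m B)) ⊆ DrawIdx.past k (t + 1) := by
  rintro (⟨k', t'⟩ | ⟨k', t', i, b⟩ | ⟨k', t', i, b⟩ | k') h <;>
    simp only [DrawIdx.past, Set.mem_ofPred_eq] at h ⊢ <;> omega

theorem DrawIdx.now_subset_past (k t : ℕ) :
    (DrawIdx.now k t : Set (DrawIdx m B)) ⊆ DrawIdx.past k (t + 1) := by
  rintro (⟨k', t'⟩ | ⟨k', t', i, b⟩ | ⟨k', t', i, b⟩ | k') h <;>
    simp only [DrawIdx.past, DrawIdx.now, Set.mem_ofPred_eq] at h ⊢ <;> omega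

theorem DrawIdx.past_subset_next (k t : ℕ) :
    (DrawIdx.past k t : Set (DrawIdx m B)) ⊆ DrawIdx.past (k + 1) 1 := by
  rintro (⟨k', t'⟩ | ⟨k', t', i, b⟩ | ⟨k', t', i, b⟩ | k') h <;>
    simp only [DrawIdx.past, Set.mem_ofPred_eq] at h ⊢ <;> omega

variable {N : Noise m B Ξ Z Ω}

theorem Noise.sigmaOf_mono {s t : Set (DrawIdx m B)} (h : s ⊆ t) : N.sigmaOf s ≤ N.sigmaOf t :=
  biSup_mono h

theorem Noise.sigma_le_sigmaOf {s : Set (DrawIdx m B)} {j : DrawIdx m B} (h : j ∈ s) :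
    N.sigma j ≤ N.sigmaOf s :=
  le_biSup N.sigma h

variable [MeasurableSpace Ω] {pr : Measure Ω} {p : Problem m Ξ Z} {I : ℕ} {T : ℕ → ℕ}

namespace Noise.IsSampling

variable (hN : N.IsSampling p I T pr)
include hN

theorem measurable_blocks (k t : ℕ) : Measurable[_, ⊤] (N.blocks k t) := by
  rintro s -
  rw [← Set.biUnion_of_singleton s, Set.preimage_iUnion₂]
  exact .biUnion (Set.to_countable s) fun A _ => hN.meas_blocks k t A

theorem sigma_le (j : DrawIdx m B) : N.sigma j ≤ ‹MeasurableSpace Ω› := by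
  cases j with
  | blocks k t =>
    rintro _ ⟨s, hs, rfl⟩
    exact hN.measurable_blocks k t hs
  | upper k t i b => exact (hN.meas_ξ k t i b).comap_le
  | lower k t i b => exact (hN.meas_ζ k t i b).comap_le
  | out k => exact (hN.meas_tout k).comap_le

theorem sigmaOf_le (s : Set (DrawIdx m B)) : N.sigmaOf s ≤ ‹MeasurableSpace Ω› :=
  iSup₂_le fun j _ => hN.sigma_le j

theorem indep_sigmaOf {s t : Set (DrawIdx m B)} (h : Disjoint s t) :
    Indep (N.sigmaOf s) (N.sigmaOf t) pr :=
  indep_iSup_of_disjoint hN.sigma_le hN.indep h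

theorem indepFun {s t : Set (DrawIdx m B)} (h : Disjoint s t) {E F : Type*} [MeasurableSpace E]
    [MeasurableSpace F] {X : Ω → E} {Y : Ω → F} (hX : Measurable[N.sigmaOf s] X)
    (hY : Measurable[N.sigmaOf t] Y) : IndepFun X Y pr := by
  rw [IndepFun_iff_Indep]
  exact indep_of_indep_of_le_left (indep_of_indep_of_le_right (hN.indep_sigmaOf h) hY.comap_le)
    hX.comap_le

omit [MeasurableSpace Ω] hN in
theorem measurable_ξ {s : Set (DrawIdx m B)} {k t : ℕ} {i : Fin m} {b : Fin B}
    (h : DrawIdx.upper k t i b ∈ s) : Measurable[N.sigmaOf s] (N.ξ k t i b) :=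
  Measurable.of_comap_le (Noise.sigma_le_sigmaOf (N := N) h)

omit [MeasurableSpace Ω] hN in
theorem measurable_ζ {s : Set (DrawIdx m B)} {k t : ℕ} {i : Fin m} {b : Fin B}
    (h : DrawIdx.lower k t i b ∈ s) : Measurable[N.sigmaOf s] (N.ζ k t i b) :=
  Measurable.of_comap_le (Noise.sigma_le_sigmaOf (N := N) h)

omit [MeasurableSpace Ω] hN in
theorem measurable_sample {s : Set (DrawIdx m B)} {k t : ℕ} {i : Fin m} {b : Fin B}
    (h : DrawIdx.upper k t i b ∈ s) (h' : DrawIdx.lower k t i b ∈ s) :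
    Measurable[N.sigmaOf s] (fun ω => (N.ξ k t i b ω, N.ζ k t i b ω)) :=
  Measurable.prodMk (measurable_ξ h) (measurable_ζ h')

omit [MeasurableSpace Ω] hN in
theorem measurable_batch {s : Set (DrawIdx m B)} {k t : ℕ} {i : Fin m}
    (h : ∀ b, DrawIdx.upper k t i b ∈ s) (h' : ∀ b, DrawIdx.lower k t i b ∈ s) :
    Measurable[N.sigmaOf s] (fun ω b => (N.ξ k t i b ω, N.ζ k t i b ω)) :=
  @measurable_pi_lambda Ω (Fin B) (fun _ => Ξ × Z) (N.sigmaOf s) inferInstance _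
    fun b => measurable_sample (h b) (h' b)

theorem map_sample [IsProbabilityMeasure pr] (k t : ℕ) (i : Fin m) (b : Fin B) :
    pr.map (fun ω => (N.ξ k t i b ω, N.ζ k t i b ω)) = p.law i := by
  have h : IndepFun (N.ξ k t i b) (N.ζ k t i b) pr :=
    hN.indepFun (s := {.upper k t i b}) (t := {.lower k t i b}) (by simp)
      (measurable_ξ rfl) (measurable_ζ rfl)
  rw [(indepFun_iff_map_prod_eq_prod_map_map (hN.meas_ξ k t i b).aemeasurable
    (hN.meas_ζ k t i b).aemeasurable).1 h, hN.law_ξ, hN.law_ζ]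
  rfl

theorem indepFun_sample (k t : ℕ) (i : Fin m) {b b' : Fin B} (hb : b ≠ b') :
    IndepFun (fun ω => (N.ξ k t i b ω, N.ζ k t i b ω))
      (fun ω => (N.ξ k t i b' ω, N.ζ k t i b' ω)) pr :=
  hN.indepFun (s := {.upper k t i b, .lower k t i b}) (t := {.upper k t i b', .lower k t i b'})
    (by simp [hb.symm]) (measurable_sample (by simp) (by simp))
    (measurable_sample (by simp) (by simp))

theorem indepFun_batch (k t : ℕ) {i i' : Fin m} (hi : i ≠ i') :
    IndepFun (fun ω b => (N.ξ k t i b ω, N.ζ k t i b ω))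
      (fun ω b => (N.ξ k t i' b ω, N.ζ k t i' b ω)) pr := by
  refine hN.indepFun (s := {j | ∃ b, j = .upper k t i b ∨ j = .lower k t i b})
    (t := {j | ∃ b, j = .upper k t i' b ∨ j = .lower k t i' b}) ?_
    (measurable_batch (fun b => ⟨b, .inl rfl⟩) fun b => ⟨b, .inr rfl⟩)
    (measurable_batch (fun b => ⟨b, .inl rfl⟩) fun b => ⟨b, .inr rfl⟩)
  rw [Set.disjoint_left]
  rintro j ⟨b, rfl | rfl⟩ ⟨b', h | h⟩ <;> simp [hi] at h

theorem indep_blocks_samples (k t : ℕ) :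
    Indep (MeasurableSpace.comap (N.blocks k t) ⊤)
      (sampleSigma (fun i b ω => (N.ξ k t i b ω, N.ζ k t i b ω))) pr := by
  have h := hN.indep_sigmaOf (s := {.blocks k t})
    (t := {j | ∃ i b, j = .upper k t i b ∨ j = .lower k t i b}) (by
      rw [Set.disjoint_left]
      rintro j rfl ⟨i, b, h | h⟩ <;> simp at h)
  have h1 : sampleSigma (fun i b ω => (N.ξ k t i b ω, N.ζ k t i b ω))
      ≤ N.sigmaOf {j | ∃ i b, j = .upper k t i b ∨ j = .lower k t i b} :=
    iSup₂_le fun i b => (measurable_sample (N := N)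
      (s := {j | ∃ i b, j = .upper k t i b ∨ j = .lower k t i b})
      ⟨i, b, .inl rfl⟩ ⟨i, b, .inr rfl⟩).comap_le
  have h2 : MeasurableSpace.comap (N.blocks k t) ⊤ ≤ N.sigmaOf {.blocks k t} :=
    Noise.sigma_le_sigmaOf (N := N) (j := .blocks k t) rfl
  exact indep_of_indep_of_le_left (indep_of_indep_of_le_right h h1) h2

theorem isIteration [IsProbabilityMeasure pr] (k t : ℕ) :
    IsIteration pr (N.blocks k t) (fun i b ω => (N.ξ k t i b ω, N.ζ k t i b ω)) p.law I where
  meas_blocks := hN.meas_blocks k t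
  meas_smp i b := (hN.meas_ξ k t i b).prodMk (hN.meas_ζ k t i b)
  law_blocks := hN.law_blocks k t
  law_smp := hN.map_sample k t
  indep_smp i _ _ hb := hN.indepFun_sample k t i hb
  indep_batch _ _ hi := hN.indepFun_batch k t hi
  indep_blocks := hN.indep_blocks_samples k t

end Noise.IsSampling

end Sampling

end BSVRB


/-! ### Measurability of the iteration and of the errors -/

namespace BSVRB

theorem LipJoint.continuous {n d : ℕ} {E : Type*} [NormedAddCommGroup E] {L : ℝ}
    {h : Vec n → Vec d → E} (hl : LipJoint L h) : Continuous fun w : Vec n × Vec d => h w.1 w.2 := by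
  refine continuous_iff_continuousAt.2 fun w => ?_
  rw [ContinuousAt, tendsto_iff_norm_sub_tendsto_zero]
  refine squeeze_zero (fun _ => norm_nonneg _) (fun w' => hl w'.1 w'.2 w.1 w.2) ?_
  have : Continuous fun w' : Vec n × Vec d =>
      L * √(‖w'.1 - w.1‖ ^ 2 + ‖w'.2 - w.2‖ ^ 2) := by fun_prop
  simpa using this.tendsto w

variable {m B : ℕ} {Ξ Z : Type*} [MeasurableSpace Ξ] [MeasurableSpace Z] {p : Problem m Ξ Z}
  {c : Consts}

section Spaces

/-- The variables as a tuple. -/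
def State.toProd (w : State p) : Vec p.dx × ((i : Fin m) → Vec (p.dy i)) ×
    ((i : Fin m) → Vec (p.dy i)) × ((i : Fin m) → Vec (p.dy i)) × ((i : Fin m) → Vec (p.dy i)) ×
    Vec p.dx :=
  (w.x, w.y, w.v, w.s, w.u, w.z)

instance State.instMeasurableSpace : MeasurableSpace (State p) :=
  MeasurableSpace.comap State.toProd inferInstance

/-- The draws of one iteration as a tuple, the set of blocks through its indicator. -/
def Draw.toProd (d : Draw m B Ξ Z) : (Fin m → Prop) × (Fin m → Fin B → Ξ) × (Fin m → Fin B → Z) :=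
  (fun i => i ∈ d.blocks, d.ξ, d.ζ)

instance Draw.instMeasurableSpace : MeasurableSpace (Draw m B Ξ Z) :=
  MeasurableSpace.comap Draw.toProd inferInstance

theorem State.measurable_toProd : Measurable (State.toProd (p := p)) :=
  comap_measurable _

theorem Draw.measurable_toProd : Measurable (Draw.toProd (m := m) (B := B) (Ξ := Ξ) (Z := Z)) :=
  comap_measurable _

variable {A : Type*} {_ : MeasurableSpace A} {w : A → State p} {d : A → Draw m B Ξ Z}

theorem State.measurable_mk (hx : Measurable fun a => (w a).x)
    (hy : ∀ i, Measurable fun a => (w a).y i) (hv : ∀ i, Measurable fun a => (w a).v i)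
    (hs : ∀ i, Measurable fun a => (w a).s i) (hu : ∀ i, Measurable fun a => (w a).u i)
    (hz : Measurable fun a => (w a).z) : Measurable w :=
  measurable_comap_iff.2 <| hx.prodMk <| (measurable_pi_lambda _ hy).prodMk <|
    (measurable_pi_lambda _ hv).prodMk <| (measurable_pi_lambda _ hs).prodMk <|
    (measurable_pi_lambda _ hu).prodMk hz

theorem Draw.measurable_mk (hb : ∀ i, Measurable fun a => i ∈ (d a).blocks)
    (hξ : ∀ i b, Measurable fun a => (d a).ξ i b) (hζ : ∀ i b, Measurable fun a => (d a).ζ i b) :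
    Measurable d :=
  measurable_comap_iff.2 <| (measurable_pi_lambda _ hb).prodMk <|
    (measurable_pi_lambda _ fun i => measurable_pi_lambda _ (hξ i)).prodMk
      (measurable_pi_lambda _ fun i => measurable_pi_lambda _ (hζ i))

variable (hw : Measurable w) (hd : Measurable d)

section
include hw

theorem State.measurable_x : Measurable fun a => (w a).x :=
  (measurable_fst.comp State.measurable_toProd).comp hw

theorem State.measurable_y (i : Fin m) : Measurable fun a => (w a).y i :=
  ((measurable_pi_apply i).comp
    ((measurable_fst.comp measurable_snd).comp State.measurable_toProd)).comp hw

theorem State.measurable_v (i : Fin m) : Measurable fun a => (w a).v i :=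
  ((measurable_pi_apply i).comp
    ((measurable_fst.comp (measurable_snd.comp measurable_snd)).comp State.measurable_toProd)).comp hw

theorem State.measurable_s (i : Fin m) : Measurable fun a => (w a).s i :=
  ((measurable_pi_apply i).comp
    ((measurable_fst.comp (measurable_snd.comp (measurable_snd.comp measurable_snd))).comp
      State.measurable_toProd)).comp hw

theorem State.measurable_u (i : Fin m) : Measurable fun a => (w a).u i :=
  ((measurable_pi_apply i).comp ((measurable_fst.comp (measurable_snd.comp
    (measurable_snd.comp (measurable_snd.comp measurable_snd)))).comp
      State.measurable_toProd)).comp hw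

theorem State.measurable_z : Measurable fun a => (w a).z :=
  ((measurable_snd.comp (measurable_snd.comp (measurable_snd.comp
    (measurable_snd.comp measurable_snd)))).comp State.measurable_toProd).comp hw

end

include hd

theorem Draw.measurableSet_mem (i : Fin m) : MeasurableSet {a | i ∈ (d a).blocks} :=
  measurableSet_setOfPred.2
    (((measurable_pi_apply i).comp (measurable_fst.comp Draw.measurable_toProd)).comp hd)

theorem Draw.measurable_ξ (i : Fin m) (b : Fin B) : Measurable fun a => (d a).ξ i b :=
  ((measurable_pi_apply b).comp ((measurable_pi_apply i).comp
    ((measurable_fst.comp measurable_snd).comp Draw.measurable_toProd))).comp hd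

theorem Draw.measurable_ζ (i : Fin m) (b : Fin B) : Measurable fun a => (d a).ζ i b :=
  ((measurable_pi_apply b).comp ((measurable_pi_apply i).comp
    ((measurable_snd.comp measurable_snd).comp Draw.measurable_toProd))).comp hd

end Spaces

section Step

variable {A : Type*} {_ : MeasurableSpace A}

/-- A Carathéodory function, continuous in the point and measurable in the sample, is jointly
measurable. Random variables and random samples may therefore be inserted together. -/
theorem measurable_sample_eval {n d : ℕ} {S E : Type*} [MeasurableSpace S] [NormedAddCommGroup E]
    [MeasurableSpace E] [BorelSpace E] {L : ℝ}
    {h : S → Vec n → Vec d → E} (hl : ∀ s, LipJoint L (h s))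
    (hm : ∀ x y, Measurable fun s => h s x y) {X : A → Vec n} {Y : A → Vec d} {W : A → S}
    (hX : Measurable X) (hY : Measurable Y) (hW : Measurable W) :
    Measurable fun a => h (W a) (X a) (Y a) :=
  (measurable_uncurry_of_continuous_of_measurable (u := fun (w : Vec n × Vec d) s => h s w.1 w.2)
    (fun s => (hl s).continuous) fun w => hm w.1 w.2).comp ((hX.prodMk hY).prodMk hW)

theorem measurable_sample_eval_apply {n d k : ℕ} {S : Type*} [MeasurableSpace S] {L : ℝ}
    {h : S → Vec n → Vec d → Vec d →L[ℝ] Vec k} (hl : ∀ s, LipJoint L (h s))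
    (hm : ∀ x y v, Measurable fun s => h s x y v) {X : A → Vec n} {Y V : A → Vec d} {W : A → S}
    (hX : Measurable X) (hY : Measurable Y) (hV : Measurable V) (hW : Measurable W) :
    Measurable fun a => h (W a) (X a) (Y a) (V a) :=
  (measurable_uncurry_of_continuous_of_measurable
    (u := fun (w : (Vec n × Vec d) × Vec d) s => h s w.1.1 w.1.2 w.2)
    (fun s => ((hl s).continuous.comp continuous_fst).clm_apply continuous_snd)
    fun w => hm w.1.1 w.1.2 w.2).comp (((hX.prodMk hY).prodMk hV).prodMk hW)

theorem measurable_smul_vec {n : ℕ} {f : A → Vec n} (hf : Measurable f) (r : ℝ) :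
    Measurable fun a => r • f a :=
  hf.const_smul r

theorem measurable_smul_sum_vec {n : ℕ} {J : Type*} (s : Finset J) {f : J → A → Vec n}
    (hf : ∀ j, Measurable (f j)) (r : ℝ) : Measurable fun a => r • ∑ j ∈ s, f j a :=
  measurable_smul_vec (Finset.measurable_fun_sum _ fun j _ => hf j) r

theorem measurable_projBall {d : ℕ} (r : ℝ) : Measurable (projBall (d := d) r) := by
  refine Measurable.ite (measurableSet_le measurable_norm measurable_const) measurable_id ?_
  exact (measurable_const.div measurable_norm).smul measurable_id

theorem batchMean_apply {S : Type*} {n d : ℕ} (h : S → Vec d →L[ℝ] Vec n) (ξ : Fin B → S)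
    (v : Vec d) : batchMean h ξ v = batchMean (fun s => h s v) ξ := by
  simp [batchMean]

variable (hp : p.Assumptions c) {w w' : A → State p} (hw : Measurable w) (hw' : Measurable w')
  {d : A → Draw m B Ξ Z} (hd : Measurable d)
include hp hw hd

theorem measurable_gyBatch (i : Fin m) : Measurable fun a => gyBatch p (d a) (w a) i :=
  measurable_smul_sum_vec _ (fun b => measurable_sample_eval (hp.lip_gy i)
    (hp.measurable_gradY_gS i) (State.measurable_x hw) (State.measurable_y hw i)
    (Draw.measurable_ζ hd i b)) _

theorem measurable_phiBatch (i : Fin m) : Measurable fun a => phiBatch p (d a) (w a) i := by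
  simp only [phiBatch, batchMean_apply]
  refine Measurable.sub ?_ ?_
  · exact measurable_smul_sum_vec _ (fun b => measurable_sample_eval_apply (hp.lip_gyy i)
      (hp.measurable_hessYY_gS_apply i) (State.measurable_x hw) (State.measurable_y hw i)
      (State.measurable_v hw i) (Draw.measurable_ζ hd i b)) _
  · exact measurable_smul_sum_vec _ (fun b => measurable_sample_eval (hp.lip_fy i)
      (hp.measurable_gradY_fS i) (State.measurable_x hw) (State.measurable_y hw i)
      (Draw.measurable_ξ hd i b)) _

theorem measurable_gEst (I : ℕ) : Measurable fun a => gEst p I (d a) (w a) := by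
  simp only [gEst, batchMean_apply]
  refine measurable_smul_vec ?_ _
  -- The sum over a random set becomes a sum over all blocks with measurable indicators.
  have h1 : ∀ a, ∑ i ∈ (d a).blocks,
      (batchMean (fun ξ => gradX (p.fS i ξ) (w a).x ((w a).y i)) ((d a).ξ i)
        - batchMean (fun ζ => jacXY (p.gS i ζ) (w a).x ((w a).y i) ((w a).v i)) ((d a).ζ i))
      = ∑ i, if i ∈ (d a).blocks then
      (batchMean (fun ξ => gradX (p.fS i ξ) (w a).x ((w a).y i)) ((d a).ξ i)
        - batchMean (fun ζ => jacXY (p.gS i ζ) (w a).x ((w a).y i) ((w a).v i)) ((d a).ζ i))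
      else 0 := fun a => by
    rw [← Finset.sum_filter, Finset.filter_mem_eq_inter, Finset.univ_inter]
  simp only [h1]
  refine Finset.measurable_fun_sum _ fun i _ =>
    Measurable.ite (Draw.measurableSet_mem hd i) (Measurable.sub ?_ ?_) measurable_const
  · exact measurable_smul_sum_vec _ (fun b => measurable_sample_eval (hp.lip_fx i)
      (hp.measurable_gradX_fS i) (State.measurable_x hw) (State.measurable_y hw i)
      (Draw.measurable_ξ hd i b)) _
  · exact measurable_smul_sum_vec _ (fun b => measurable_sample_eval_apply (hp.lip_gxy i)
      (hp.measurable_jacXY_gS_apply i) (State.measurable_x hw) (State.measurable_y hw i)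
      (State.measurable_v hw i) (Draw.measurable_ζ hd i b)) _

include hw'

theorem measurable_step (r τ : ℝ) (I : ℕ) (q : StageParams) :
    Measurable fun a => step p r τ I q (d a) (w' a) (w a) := by
  have hz : Measurable fun a => (step p r τ I q (d a) (w' a) (w a)).z :=
    (measurable_smul_vec ((State.measurable_z hw).sub (measurable_gEst hp hw' hd I)) (1 - q.β)).add
      (measurable_gEst hp hw hd I)
  refine State.measurable_mk ((State.measurable_x hw).sub (measurable_smul_vec hz q.η))
    (fun i => (State.measurable_y hw i).sub (measurable_smul_vec (State.measurable_s hw i) _))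
    (fun i => (measurable_projBall r).comp
      ((State.measurable_v hw i).sub (measurable_smul_vec (State.measurable_u hw i) _)))
    (fun i => ?_) (fun i => ?_) hz
  · refine Measurable.ite (Draw.measurableSet_mem hd i) ?_ (State.measurable_s hw i)
    have h1 := measurable_gyBatch hp hw hd i
    exact ((measurable_smul_vec (State.measurable_s hw i) _).add (measurable_smul_vec h1 _)).add
      (measurable_smul_vec (h1.sub (measurable_gyBatch hp hw' hd i)) _)
  · refine Measurable.ite (Draw.measurableSet_mem hd i) ?_ (State.measurable_u hw i)
    have h1 := measurable_phiBatch hp hw hd i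
    exact ((measurable_smul_vec (State.measurable_u hw i) _).add (measurable_smul_vec h1 _)).add
      (measurable_smul_vec (h1.sub (measurable_phiBatch hp hw' hd i)) _)

end Step

section Errors

variable {A : Type*} {_ : MeasurableSpace A} (hp : p.Assumptions c) (hc : c.Valid)
  {w w' : A → State p} (hw : Measurable w) (hw' : Measurable w')
include hp hc

theorem continuous_F : Continuous p.F := (hp.differentiable_F hc).continuous

theorem continuous_ySol (i : Fin m) : Continuous (p.ySol i) :=
  (LipschitzWith.of_dist_le_mul (K := ⟨c.ratio, hc.ratio_nonneg⟩) fun x x' => by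
    rw [dist_eq_norm, dist_eq_norm]
    exact hp.norm_ySol_sub_le hc i x x').continuous

theorem continuous_vSol (i : Fin m) :
    Continuous fun w : Vec p.dx × Vec (p.dy i) => p.vSol i w.1 w.2 :=
  LipJoint.continuous (L := c.ratio) fun x y x' y' => hp.norm_vSol_sub_le hc i x x' y y'

theorem continuous_gradient_F : Continuous (gradient p.F) :=
  (LipschitzWith.of_dist_le_mul (K := ⟨c.LFc, hc.LFc_pos.le⟩) fun x x' => by
    rw [dist_eq_norm, dist_eq_norm]
    exact hp.norm_gradient_F_sub_le hc x x').continuous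

include hw

theorem measurable_F : Measurable fun a => p.F (w a).x :=
  (continuous_F hp hc).measurable.comp (State.measurable_x hw)

theorem measurable_norm_gradient_F : Measurable fun a => ‖gradient p.F (w a).x‖ :=
  ((continuous_gradient_F hp hc).measurable.comp (State.measurable_x hw)).norm

theorem measurable_errY : Measurable fun a => errY p (w a) :=
  (Finset.measurable_fun_sum _ fun i _ => ((State.measurable_y hw i).sub
    ((continuous_ySol hp hc i).measurable.comp (State.measurable_x hw))).norm.pow_const 2).const_mul _

theorem measurable_errV : Measurable fun a => errV p (w a) :=
  (Finset.measurable_fun_sum _ fun i _ => ((State.measurable_v hw i).sub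
    ((continuous_vSol hp hc i).measurable.comp
      ((State.measurable_x hw).prodMk (State.measurable_y hw i)))).norm.pow_const 2).const_mul _

omit hc

include hw'

omit hp in
theorem measurable_moved : Measurable fun a => moved p (w' a) (w a) :=
  (Finset.measurable_fun_sum _ fun i _ =>
    ((((State.measurable_x hw).sub (State.measurable_x hw')).norm.pow_const 2).add
    (((State.measurable_y hw i).sub (State.measurable_y hw' i)).norm.pow_const 2)).add
    (((State.measurable_v hw i).sub (State.measurable_v hw' i)).norm.pow_const 2)).const_mul _

theorem measurable_errS : Measurable fun a => errS p (w' a) (w a) :=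
  (Finset.measurable_fun_sum _ fun i _ => ((State.measurable_s hw i).sub
    ((hp.lipJoint_gradY_gBar i).continuous.measurable.comp
      ((State.measurable_x hw').prodMk (State.measurable_y hw' i)))).norm.pow_const 2).const_mul _

theorem measurable_errU : Measurable fun a => errU p (w' a) (w a) := by
  refine (Finset.measurable_fun_sum _ fun i _ => ((State.measurable_u hw i).sub
    ?_).norm.pow_const 2).const_mul _
  -- A deterministic operator field is an oracle with a one-point sample space.
  exact (measurable_sample_eval_apply (S := Unit) (h := fun _ => hessYY (p.gBar i))
    (fun _ => hp.lipJoint_hessYY_gBar i) (fun _ _ _ => measurable_const)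
    (State.measurable_x hw') (State.measurable_y hw' i) (State.measurable_v hw' i)
    (measurable_const (a := ()))).sub
    ((hp.lipJoint_gradY_fBar i).continuous.measurable.comp
      ((State.measurable_x hw').prodMk (State.measurable_y hw' i)))

theorem measurable_errZ : Measurable fun a => errZ p (w' a) (w a) := by
  have h1 : ∀ i, Measurable fun a => jacXY (p.gBar i) (w' a).x ((w' a).y i) ((w' a).v i) :=
    fun i => measurable_sample_eval_apply (S := Unit) (h := fun _ => jacXY (p.gBar i))
      (fun _ => hp.lipJoint_jacXY_gBar i) (fun _ _ _ => measurable_const)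
      (State.measurable_x hw') (State.measurable_y hw' i) (State.measurable_v hw' i)
      (measurable_const (a := ()))
  have h2 : ∀ i, Measurable fun a => gradX (p.fBar i) (w' a).x ((w' a).y i) := fun i =>
    (hp.lipJoint_gradX_fBar i).continuous.measurable.comp
      ((State.measurable_x hw').prodMk (State.measurable_y hw' i))
  exact ((State.measurable_z hw).sub (measurable_smul_sum_vec Finset.univ
    (fun i => (h2 i).sub (h1 i)) (m : ℝ)⁻¹)).norm.pow_const 2

end Errors

end BSVRB


/-! ### Constants of the potential and scalar inequalities -/

namespace BSVRB

section Constants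

namespace Consts

/-- Weight of the error of `v` in the potential. -/
noncomputable def potV (c : Consts) : ℝ := 2 / c.lam * (c.K + 2)

/-- Influence of the motion of `y` on the weighted error of `v`. -/
noncomputable def couple (c : Consts) : ℝ := 8 * c.potV * c.K / c.lam

/-- Weight of the error of `y` in the potential. -/
noncomputable def potY (c : Consts) : ℝ := 2 / c.lam * (c.K + 2 + 2 * c.K * c.couple)

/-- Influence of the error of `s` on the weighted error of `y`. -/
noncomputable def drift (c : Consts) : ℝ := 8 * c.potY / c.lam

/-- Weight of the errors of `s` and `u` in the potential. -/
noncomputable def potS (c : Consts) : ℝ := 2 * c.drift + 4 * c.couple + 2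

/-- Weight of the last displacement in the potential. -/
noncomputable def potD (c : Consts) : ℝ :=
  26 * c.potS * c.K + 12 * c.K + 4 * c.K * (c.drift + c.couple) + 2

/-- Ratio of the lower-level step sizes to `I √β / m`. -/
noncomputable def kap (c : Consts) : ℝ :=
  min (min (c.lam / (8 * c.Lphi ^ 2)) (c.lam / 2))
    (min (1 / c.lam) (min 1 (min (c.lam / c.K) (1 / (8 * c.potD * c.K)))))

/-- Bound for the squared upper-level step in terms of the lower-level ones. -/
noncomputable def stepCost (c : Consts) : ℝ :=
  (8 * c.potY * c.K + 8 * c.potV * c.K) / (c.lam * c.kap ^ 2) + c.potD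

/-- Upper bound for the ratio of the upper-level step size to `I √β / m`. -/
noncomputable def kapX (c : Consts) : ℝ := min (1 / (2 * c.LFc)) (1 / (4 * (c.stepCost + 1)))

/-- Size of the stationary noise. -/
noncomputable def noise (c : Consts) : ℝ := 4 * c.K * c.potS + 12 * c.K

theorem kap_le_one (c : Consts) : c.kap ≤ 1 :=
  (min_le_right _ _).trans ((min_le_right _ _).trans (min_le_left _ _))

end Consts

namespace Consts.Valid

variable {c : Consts} (hc : c.Valid)
include hc

theorem K_pos : 0 < c.K := zero_lt_one.trans_le hc.one_le_K

theorem potV_pos : 0 < c.potV := by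
  have := hc.K_pos
  have := hc.lam_pos
  unfold Consts.potV; positivity

theorem couple_pos : 0 < c.couple := by
  have := hc.K_pos
  have := hc.lam_pos
  have := hc.potV_pos
  unfold Consts.couple; positivity

theorem potY_pos : 0 < c.potY := by
  have := hc.K_pos
  have := hc.lam_pos
  have := hc.couple_pos
  unfold Consts.potY; positivity

theorem drift_pos : 0 < c.drift := by
  have := hc.lam_pos
  have := hc.potY_pos
  unfold Consts.drift; positivity

theorem potS_pos : 0 < c.potS := by
  have := hc.drift_pos
  have := hc.couple_pos
  unfold Consts.potS; positivity

theorem potD_pos : 0 < c.potD := by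
  have := hc.K_pos
  have := hc.drift_pos
  have := hc.couple_pos
  have := hc.potS_pos
  unfold Consts.potD; positivity

theorem noise_pos : 0 < c.noise := by
  have := hc.K_pos
  have := hc.potS_pos
  unfold Consts.noise; positivity

theorem potV_le_potY : c.potV ≤ c.potY := by
  have := hc.K_pos
  have := hc.lam_pos
  refine mul_le_mul_of_nonneg_left ?_ (by positivity)
  linarith [mul_pos hc.K_pos hc.couple_pos]

theorem Lphi_sq_pos : 0 < c.Lphi ^ 2 := by
  have := hc.Cgyy_pos
  refine pow_pos (Real.sqrt_pos.2 (lt_max_of_lt_right ?_)) 2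
  positivity

theorem kap_pos : 0 < c.kap := by
  have := hc.K_pos
  have := hc.lam_pos
  have := hc.potD_pos
  have := hc.Lphi_sq_pos
  exact lt_min (lt_min (by positivity) (by positivity))
    (lt_min (by positivity) (lt_min one_pos (lt_min (by positivity) (by positivity))))

theorem kap_mul_lam_le : c.kap * c.lam ≤ 1 :=
  (le_div_iff₀ hc.lam_pos).1 ((min_le_right _ _).trans (min_le_left _ _))

theorem kap_mul_K_le : c.kap * c.K ≤ c.lam :=
  (le_div_iff₀ hc.K_pos).1 ((min_le_right _ _).trans
    ((min_le_right _ _).trans ((min_le_right _ _).trans (min_le_left _ _))))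

/-- In one step y and v move by κρ times s and u. This keeps their weighted contribution to the
displacement below a fixed fraction of the decrease of the other errors. -/
theorem potD_mul_kap_sq_le : 8 * c.K * (c.potD * c.kap ^ 2) ≤ 1 := by
  have h1 : c.kap ≤ 1 / (8 * c.potD * c.K) := (min_le_right _ _).trans
    ((min_le_right _ _).trans ((min_le_right _ _).trans (min_le_right _ _)))
  have h2 := hc.K_pos
  have h3 := hc.potD_pos
  rw [le_div_iff₀ (by positivity)] at h1
  have h4 : c.kap ^ 2 ≤ c.kap := by nlinarith [hc.kap_pos, c.kap_le_one]
  nlinarith [mul_le_mul_of_nonneg_left h4 (mul_pos h3 h2).le]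

theorem stepCost_pos : 0 < c.stepCost := by
  have := hc.K_pos
  have := hc.lam_pos
  have := hc.potY_pos
  have := hc.potV_pos
  have := hc.potD_pos
  have := hc.kap_pos
  unfold Consts.stepCost; positivity

theorem kapX_pos : 0 < c.kapX := by
  have := hc.stepCost_pos
  have := hc.LFc_pos
  exact lt_min (by positivity) (by positivity)

theorem kapX_mul_LFc_le : c.kapX * c.LFc ≤ 1 / 2 := by
  have h := (le_div_iff₀ (mul_pos two_pos hc.LFc_pos)).1
    (min_le_left (1 / (2 * c.LFc)) (1 / (4 * (c.stepCost + 1))))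
  unfold Consts.kapX
  linarith

/-- The term -‖z‖²/4 of the descent inequality must pay for every effect of the motion of x, which
amounts to stepCost · (η/ρ)² ‖z‖². -/
theorem stepCost_mul_kapX_sq_le : c.stepCost * c.kapX ^ 2 ≤ 1 / 4 := by
  have h0 := hc.stepCost_pos
  have h1 : c.kapX ≤ 1 / (4 * (c.stepCost + 1)) := min_le_right _ _
  rw [le_div_iff₀ (by positivity)] at h1
  have h2 := hc.kapX_pos
  have h3 : c.kapX ≤ 1 := by nlinarith [mul_pos h2 h0]
  have h4 : c.kapX ^ 2 ≤ c.kapX := by nlinarith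
  nlinarith [mul_le_mul_of_nonneg_left h4 h0.le]

end Consts.Valid

end Constants

section Scalar

/-- The norms of s and u are traded for errors at the current variables, and those for lagged errors
and displacement, while n = ‖z‖² is cancelled by -n/4. In the decrease K + 2 of Y and V, the part K
pays for the gradient error, one unit is the gain, and the rest covers the `k₄` terms. The extra 2 K
k₁ of Y pays for the motion of y seen by the error of v. -/
theorem potential_bracket_le {K k₁ k₂ k₃ k₄ Y V S U D Sw Uw sN uN Y' V' D' Z' G n f f' η PA Pb Pe
    c₁ c₂ c₃ : ℝ} (hη : 0 ≤ η) (hK : 1 ≤ K) (hk₁ : 0 ≤ k₁) (hk₂ : 0 ≤ k₂) (hk₃ : 0 ≤ k₃)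
    (hk₄ : 0 ≤ k₄) (hY0 : 0 ≤ Y) (hV0 : 0 ≤ V) (hS0 : 0 ≤ S) (hU0 : 0 ≤ U) (hD0 : 0 ≤ D)
    (hn0 : 0 ≤ n) (h32 : k₃ ≤ k₂) (hk : 8 * K * k₄ ≤ 1)
    (hY : PA * Y' ≤ PA * Y - (K + 2 + 2 * K * k₁) * Y + k₂ * Sw + c₁ * n)
    (hV : Pb * V' ≤ Pb * V - (K + 2) * V + k₃ * Uw + c₂ * n + k₁ * sN)
    (hD : Pe * D' ≤ c₃ * n + k₄ * (sN + uN)) (hn : c₁ + c₂ + c₃ ≤ 1 / 4)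
    (hs : sN ≤ 2 * Sw + 2 * K * Y) (hu : uN ≤ 2 * Uw + 2 * K * V)
    (hSw : Sw ≤ 2 * S + 2 * K * D) (hUw : Uw ≤ 2 * U + 2 * K * D)
    (hf : f' ≤ f + η * (-(G / 2) - n / 4 + K * (Y + V) + Z')) :
    f' + η * (PA * Y' + Pb * V' + Pe * D') ≤ f + η * (PA * Y + Pb * V - Y - V
      + (2 * k₂ + 4 * k₁ + 1) * (S + U) + (4 * K * k₂ + 4 * K * k₁ + 1) * D + Z' - G / 2) := by
  have k4le : k₄ ≤ 1 / 8 := by nlinarith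
  have h1 := mul_le_mul_of_nonneg_left hs (add_nonneg hk₁ hk₄)
  have h2 := mul_le_mul_of_nonneg_left hu hk₄
  have h3 := mul_le_mul_of_nonneg_left hSw
    (by positivity : 0 ≤ k₂ + 2 * k₁ + 2 * k₄)
  have h4 := mul_le_mul_of_nonneg_left hUw (by positivity : 0 ≤ k₃ + 2 * k₄)
  have h5 := mul_le_mul_of_nonneg_right hk hY0
  have h6 := mul_le_mul_of_nonneg_right hk hV0
  have h7 := mul_le_mul_of_nonneg_right hk hD0
  have h8 := mul_le_mul_of_nonneg_right hn hn0
  have h9 := mul_le_mul_of_nonneg_right k4le hS0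
  have h10 := mul_le_mul_of_nonneg_right k4le hU0
  have h11 := mul_le_mul_of_nonneg_right h32 hU0
  have h12 := mul_le_mul_of_nonneg_right h32 (mul_nonneg (zero_le_one.trans hK) hD0)
  have h13 := mul_nonneg hk₁ hU0
  have key : (-(G / 2) - n / 4 + K * (Y + V) + Z') + (PA * Y' + Pb * V' + Pe * D')
      ≤ PA * Y + Pb * V - Y - V
      + (2 * k₂ + 4 * k₁ + 1) * (S + U) + (4 * K * k₂ + 4 * K * k₁ + 1) * D + Z' - G / 2 := by
    linarith
  linarith [mul_le_mul_of_nonneg_left key hη]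

/-- The weight cc/(βr) times the rate βr produces -cc, which turns the coefficient cc - 1 into -1.
For z the identity (2/β + 1)(1 - β) = 2/β - 1 - β plays the same part. All displacement terms are at
most of order 1/(r²β), which the weight e is large enough to cover. -/
theorem expected_bracket_le {K k cc e r β D S U Z iB iM : ℝ} (hK : 0 < K) (hcc : 0 < cc)
    (hr : 0 < r) (hr1 : r ≤ 1) (hβ : 0 < β) (hβ1 : β ≤ 1 / 2) (hD : 0 ≤ D) (hZ : 0 ≤ Z)
    (hi : iB ≤ iM) (hM : 0 ≤ iM) (he : 26 * cc * K + 12 * K + k + 1 ≤ e) (hk : 0 ≤ k) :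
    (cc - 1) * (S + U) + k * D
      + cc / (β * r) * (((1 - β * r) * S + 13 * K * (1 / r) * D + 2 * K * r * β ^ 2 * iB)
        + ((1 - β * r) * U + 13 * K * (1 / r) * D + 2 * K * r * β ^ 2 * iB))
      + (2 / β + 1) * ((1 - β) * Z + 4 * K * D + 4 * K * β ^ 2 * iM)
    ≤ e / (r ^ 2 * β) * D + cc / (β * r) * (S + U) + 2 / β * Z - (S + U + Z + D)
      + (4 * K * cc + 12 * K) * (β * iM) := by
  have e1 : cc / (β * r) * (((1 - β * r) * S + 13 * K * (1 / r) * D + 2 * K * r * β ^ 2 * iB)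
        + ((1 - β * r) * U + 13 * K * (1 / r) * D + 2 * K * r * β ^ 2 * iB))
      = cc / (β * r) * (S + U) - cc * (S + U) + 26 * cc * K * (1 / (r ^ 2 * β)) * D
        + 4 * K * cc * (β * iB) := by field_simp; ring
  have e2 : (2 / β + 1) * ((1 - β) * Z + 4 * K * D + 4 * K * β ^ 2 * iM)
      = 2 / β * Z - (1 + β) * Z + (2 + β) * (4 * K * ((1 / β) * D)) + (2 + β) * (4 * K * (β * iM)) := by
    field_simp; ring
  have hw : 1 / β ≤ 1 / (r ^ 2 * β) := by
    apply one_div_le_one_div_of_le (by positivity)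
    nlinarith [mul_pos hr hβ, mul_nonneg hr.le (sub_nonneg.2 hr1)]
  have hw1 : 1 ≤ 1 / (r ^ 2 * β) := by
    refine le_trans ?_ hw
    rw [le_div_iff₀ hβ]; linarith
  set w := 1 / (r ^ 2 * β) with hwd
  have e3 : e / (r ^ 2 * β) = e * w := by rw [hwd]; ring
  have a1 : (2 + β) * (4 * K * ((1 / β) * D)) ≤ 12 * K * (w * D) := by
    have h1 : (1 / β) * D ≤ w * D := mul_le_mul_of_nonneg_right hw hD
    have h2 : 0 ≤ (1 / β) * D := by positivity
    nlinarith [mul_le_mul_of_nonneg_left h1 hK.le, mul_nonneg hK.le h2]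
  have a2 : (2 + β) * (4 * K * (β * iM)) ≤ 12 * K * (β * iM) := by
    nlinarith [mul_nonneg hK.le (mul_nonneg hβ.le hM)]
  have a3 : 4 * K * cc * (β * iB) ≤ 4 * K * cc * (β * iM) := by gcongr
  have a4 := mul_le_mul_of_nonneg_right (mul_le_mul_of_nonneg_right he (zero_le_one.trans hw1)) hD
  have a5 : (k + 1) * D ≤ (k + 1) * (w * D) := by
    have : D ≤ w * D := by nlinarith
    gcongr
  rw [e1, e2, e3]
  nlinarith [mul_nonneg hβ.le hZ]

end Scalar

end BSVRB


/-! ### The potential and its pathwise one-step bound -/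

namespace BSVRB

section Lintegral

variable {Ω : Type*} [MeasurableSpace Ω] {pr : Measure Ω}

theorem lintegral_avg_le {m : ℕ} {f : Fin m → Ω → ℝ} (hf : ∀ i, Measurable (f i))
    (hf0 : ∀ i ω, 0 ≤ f i ω) {b : Fin m → ℝ} (hb : ∀ i, 0 ≤ b i)
    (h : ∀ i, ∫⁻ ω, ENNReal.ofReal (f i ω) ∂pr ≤ ENNReal.ofReal (b i)) :
    ∫⁻ ω, ENNReal.ofReal (avg fun i => f i ω) ∂pr ≤ ENNReal.ofReal (avg b) := by
  have hm : (0 : ℝ) ≤ (m : ℝ)⁻¹ := by positivity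
  simp only [avg, ENNReal.ofReal_mul hm]
  rw [lintegral_const_mul' _ _ ENNReal.ofReal_ne_top, ENNReal.ofReal_sum_of_nonneg fun i _ => hb i]
  refine mul_le_mul_right ?_ _
  simp only [ENNReal.ofReal_sum_of_nonneg fun i _ => hf0 i _]
  rw [lintegral_finsetSum _ fun i _ => (hf i).ennreal_ofReal]
  exact Finset.sum_le_sum fun i _ => h i

theorem lintegral_ofReal_add_le {f g : Ω → ℝ} (hf : Measurable f) (hf0 : ∀ ω, 0 ≤ f ω)
    (hg0 : ∀ ω, 0 ≤ g ω) {a b : ℝ} (ha : 0 ≤ a) (hb : 0 ≤ b)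
    (h : ∫⁻ ω, ENNReal.ofReal (f ω) ∂pr ≤ ENNReal.ofReal a)
    (h' : ∫⁻ ω, ENNReal.ofReal (g ω) ∂pr ≤ ENNReal.ofReal b) :
    ∫⁻ ω, ENNReal.ofReal (f ω + g ω) ∂pr ≤ ENNReal.ofReal (a + b) := by
  simp only [ENNReal.ofReal_add (hf0 _) (hg0 _)]
  rw [lintegral_add_left hf.ennreal_ofReal, ENNReal.ofReal_add ha hb]
  exact add_le_add h h'

theorem lintegral_ofReal_mul_le {f : Ω → ℝ} {a r : ℝ} (hr : 0 ≤ r)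
    (h : ∫⁻ ω, ENNReal.ofReal (f ω) ∂pr ≤ ENNReal.ofReal a) :
    ∫⁻ ω, ENNReal.ofReal (r * f ω) ∂pr ≤ ENNReal.ofReal (r * a) := by
  simp only [ENNReal.ofReal_mul hr]
  rw [lintegral_const_mul' _ _ ENNReal.ofReal_ne_top]
  exact mul_le_mul_right h _

theorem integrable_of_lintegral_ofReal_le {f : Ω → ℝ} (hf : Measurable f) (hf0 : ∀ ω, 0 ≤ f ω)
    {a : ℝ} (h : ∫⁻ ω, ENNReal.ofReal (f ω) ∂pr ≤ ENNReal.ofReal a) : Integrable f pr :=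
  (lintegral_ofReal_ne_top_iff_integrable hf.aestronglyMeasurable (.of_forall hf0)).1
    (ne_top_of_le_ne_top ENNReal.ofReal_ne_top h)

theorem integral_le_of_lintegral_ofReal_le {f : Ω → ℝ} (hf : Measurable f) (hf0 : ∀ ω, 0 ≤ f ω)
    {a : ℝ} (ha : 0 ≤ a) (h : ∫⁻ ω, ENNReal.ofReal (f ω) ∂pr ≤ ENNReal.ofReal a) :
    ∫ ω, f ω ∂pr ≤ a := by
  rw [integral_eq_lintegral_of_nonneg_ae (.of_forall hf0) hf.aestronglyMeasurable]
  exact ENNReal.toReal_le_of_le_ofReal ha h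

/-- `X` may be negative, so the truncation in `ENNReal.ofReal` cannot be applied termwise. The
estimate passes through the Bochner integral, and the sign of X + b comes out as a by-product. -/
theorem lintegral_le_of_le_const_add [IsProbabilityMeasure pr] {f g : Ω → ℝ} (hf : Measurable f)
    (hg : Measurable g) (hf0 : ∀ ω, 0 ≤ f ω) (hg0 : ∀ ω, 0 ≤ g ω) {X b : ℝ} (hb : 0 ≤ b)
    (hle : ∀ ω, f ω ≤ X + g ω) (h : ∫⁻ ω, ENNReal.ofReal (g ω) ∂pr ≤ ENNReal.ofReal b) :
    0 ≤ X + b ∧ ∫⁻ ω, ENNReal.ofReal (f ω) ∂pr ≤ ENNReal.ofReal (X + b) := by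
  have hgi := integrable_of_lintegral_ofReal_le hg hg0 h
  have hi : Integrable (fun ω => X + g ω) pr := (integrable_const X).add hgi
  have hfi : Integrable f pr := hi.mono' hf.aestronglyMeasurable
    (.of_forall fun ω => by rw [Real.norm_of_nonneg (hf0 ω)]; exact hle ω)
  have h1 : ∫ ω, f ω ∂pr ≤ X + b := by
    refine (integral_mono hfi hi hle).trans ?_
    rw [integral_add (integrable_const X) hgi, integral_const]
    simpa using integral_le_of_lintegral_ofReal_le hg hg0 hb h
  exact ⟨(integral_nonneg hf0).trans h1, by
    rw [← ofReal_integral_eq_lintegral_ofReal hfi (.of_forall hf0)]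
    exact ENNReal.ofReal_le_ofReal h1⟩

/-- Freezing: the past X is held fixed while the independent fresh draw Y is averaged. It takes the
place of conditional expectations. -/
theorem lintegral_prod_of_indepFun [IsProbabilityMeasure pr] {E F : Type*} [MeasurableSpace E]
    [MeasurableSpace F] {X : Ω → E} {Y : Ω → F} (hX : Measurable X) (hY : Measurable Y)
    (h : IndepFun X Y pr) {G : E → F → ℝ≥0∞} (hG : Measurable (Function.uncurry G)) :
    ∫⁻ ω, G (X ω) (Y ω) ∂pr = ∫⁻ ω, ∫⁻ ω', G (X ω) (Y ω') ∂pr ∂pr := by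
  have := Measure.isProbabilityMeasure_map (μ := pr) hY.aemeasurable
  have h1 : ∫⁻ ω, G (X ω) (Y ω) ∂pr
      = ∫⁻ w, Function.uncurry G w ∂(pr.map fun ω => (X ω, Y ω)) :=
    (lintegral_map hG (hX.prodMk hY)).symm
  rw [h1, (indepFun_iff_map_prod_eq_prod_map_map hX.aemeasurable hY.aemeasurable).1 h,
    lintegral_prod _ hG.aemeasurable, lintegral_map hG.lintegral_prod_right' hX]
  refine lintegral_congr fun ω => ?_
  exact lintegral_map (hG.comp measurable_prodMk_left) hY

end Lintegral

variable {m B I : ℕ} {Ξ Z Ω : Type*} [MeasurableSpace Ξ] [MeasurableSpace Z] {p : Problem m Ξ Z}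
  {c : Consts}

/-- The parameters of a stage as the analysis uses them. -/
structure StageOK (c : Consts) (τ : ℝ) (m I : ℕ) (q : StageParams) : Prop where
  β_pos : 0 < q.β
  β_le : q.β ≤ 1 / 2
  α_eq : q.α = q.β
  αbar_eq : q.αbar = q.β
  stepY_eq : τ * q.stepY = c.kap * (I / m * √q.β)
  stepV_eq : q.stepV = c.kap * (I / m * √q.β)
  η_pos : 0 < q.η
  η_le : q.η ≤ c.kapX * (I / m * √q.β)

/-- The potential of two successive tuples of variables. -/
noncomputable def potential (p : Problem m Ξ Z) (c : Consts) (I : ℕ) (q : StageParams)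
    (xstar : Vec p.dx) (a w : State p) : ℝ :=
  p.F w.x - p.F xstar + q.η * (c.potY / (c.kap * (I / m * √q.β)) * errY p w
    + c.potV / (c.kap * (I / m * √q.β)) * errV p w
    + c.potD / ((I / m) ^ 2 * q.β) * moved p a w
    + c.potS / (q.β * (I / m)) * (errS p a w + errU p a w) + 2 / q.β * errZ p a w)

/-- The decrease of the potential in one iteration, per unit of the step size. -/
noncomputable def gain (p : Problem m Ξ Z) (a w : State p) : ℝ :=
  ‖gradient p.F w.x‖ ^ 2 / 2 + (errY p w + errV p w + errS p a w + errU p a w + errZ p a w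
    + moved p a w)

theorem gain_nonneg (a w : State p) : 0 ≤ gain p a w := by
  have := errY_nonneg w
  have := errV_nonneg w
  have := errS_nonneg a w
  have := errU_nonneg a w
  have := errZ_nonneg a w
  have := moved_nonneg a w
  unfold gain; positivity

theorem potential_nonneg (hc : c.Valid) {τ : ℝ} {q : StageParams} (hq : StageOK c τ m I q)
    {xstar : Vec p.dx} (hmin : ∀ x, p.F xstar ≤ p.F x) (a w : State p) :
    0 ≤ potential p c I q xstar a w := by
  have := errY_nonneg w
  have := errV_nonneg w
  have := errS_nonneg a w
  have := errU_nonneg a w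
  have := errZ_nonneg a w
  have := moved_nonneg a w
  have := hc.potY_pos
  have := hc.potV_pos
  have := hc.potS_pos
  have := hc.potD_pos
  have := hc.kap_pos
  have := hq.η_pos
  have := hq.β_pos
  have := sub_nonneg.2 (hmin w.x)
  unfold potential; positivity

section OneStep

variable (hp : p.Assumptions c) (hc : c.Valid) {τ : ℝ} {q : StageParams} (hq : StageOK c τ m I q)
  (hI : 1 ≤ I) (hIm : I ≤ m)
include hp hc hq hI hIm

/-- This holds for every single draw. The new errors of s, u and z are left on the right-hand side,
to be averaged afterwards; everything else is controlled pathwise. -/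
theorem potential_step_le (xstar : Vec p.dx) (d : Draw m B Ξ Z) (a w : State p)
    (ha : ∀ i, ‖a.v i‖ ≤ c.V) (hw : ∀ i, ‖w.v i‖ ≤ c.V) :
    potential p c I q xstar w (step p c.V τ I q d a w)
      ≤ (p.F w.x - p.F xstar + q.η * (c.potY / (c.kap * (I / m * √q.β)) * errY p w
        + c.potV / (c.kap * (I / m * √q.β)) * errV p w - errY p w - errV p w
        + (c.potS - 1) * (errS p a w + errU p a w)
        + (4 * c.K * c.drift + 4 * c.K * c.couple + 1) * moved p a w
        - ‖gradient p.F w.x‖ ^ 2 / 2))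
        + q.η * (c.potS / (q.β * (I / m)) * (errS p w (step p c.V τ I q d a w)
          + errU p w (step p c.V τ I q d a w))
          + (2 / q.β + 1) * errZ p w (step p c.V τ I q d a w)) := by
  have hm : 1 ≤ m := hI.trans hIm
  have hr : (0 : ℝ) < I / m := by positivity
  have hβ := hq.β_pos
  have hρ : 0 < I / m * √q.β := by positivity
  have hκ := hc.kap_pos
  have hlam := hc.lam_pos
  have hK := hc.K_pos
  have hρsq : (I / m * √q.β) ^ 2 = ((I : ℝ) / m) ^ 2 * q.β := by
    rw [mul_pow, Real.sq_sqrt hβ.le]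
  have hρ1 : I / m * √q.β ≤ 1 := by
    have h1 : (I : ℝ) / m ≤ 1 := div_le_one_of_le₀ (by exact_mod_cast hIm) (by positivity)
    have h2 : √q.β ≤ 1 := Real.sqrt_le_one.2 (by linarith [hq.β_le])
    exact mul_le_one₀ h1 (Real.sqrt_nonneg _) h2
  have hηle := hq.η_le
  have hτ' := hq.stepY_eq
  have hv' := hq.stepV_eq
  unfold potential
  rw [← hρsq]
  set ρ : ℝ := I / m * √q.β with hρd
  -- The common step κρ of y and v. Since ρ ≤ 1, the smallness conditions on the step are inherited
  -- from those on κ.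
  have hh : 0 < c.kap * ρ := by positivity
  have hhK : c.kap * ρ * c.K ≤ c.lam := by
    nlinarith [hc.kap_mul_K_le, mul_nonneg (mul_nonneg hκ.le hK.le) (sub_nonneg.2 hρ1)]
  have hhl : c.kap * ρ * c.lam ≤ 2 := by
    nlinarith [hc.kap_mul_lam_le, mul_nonneg (mul_nonneg hκ.le hlam.le) (sub_nonneg.2 hρ1)]
  have hηL : q.η * c.LFc ≤ 1 / 2 := by
    have h1 : q.η ≤ c.kapX := by nlinarith [hc.kapX_pos]
    nlinarith [hc.kapX_mul_LFc_le, hc.LFc_pos]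
  have hY := errY_step_le hp hc τ I q d a w hh hτ' hhK hhl hm
  have hV := errV_step_le hp hc τ I q d a w hh hτ' hv' hhK hhl hm
  have hD := moved_step_le hc τ I q d a w hh hτ' hv' hm hw
  have hx := norm_step_x_sub_sq (c := c) τ I q d a w hq.η_pos.le
  have hF := F_descent hp hc w.x (step p c.V τ I q d a w).z hq.η_pos.le hηL
  have hg := gradient_F_error_le hp hc w hw
  have hs := avg_norm_s_sq_le hp hc w
  have hu := avg_norm_u_sq_le hp hc w
  have hSw := errS_self_le hp hc a w
  have hUw := errU_self_le hp hc a w ha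
  have hxF : (step p c.V τ I q d a w).x = w.x - q.η • (step p c.V τ I q d a w).z := rfl
  rw [← hxF] at hF
  set w' := step p c.V τ I q d a w with hw'
  rw [hx] at hY hV hD
  have hpY := hc.potY_pos
  have hpV := hc.potV_pos
  have hpD := hc.potD_pos
  have hη := hq.η_pos
  have h1 := potential_bracket_le (K := c.K) (k₁ := c.couple) (k₂ := c.drift)
    (k₃ := 8 * c.potV / c.lam) (k₄ := c.potD * c.kap ^ 2) (Y := errY p w) (V := errV p w)
    (S := errS p a w) (U := errU p a w) (D := moved p a w) (Sw := errS p w w) (Uw := errU p w w)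
    (sN := avg fun i => ‖w.s i‖ ^ 2) (uN := avg fun i => ‖w.u i‖ ^ 2) (Y' := errY p w')
    (V' := errV p w') (D' := moved p w w') (Z' := errZ p w w') (G := ‖gradient p.F w.x‖ ^ 2)
    (n := ‖w'.z‖ ^ 2) (f := p.F w.x - p.F xstar) (f' := p.F w'.x - p.F xstar) (η := q.η)
    (PA := c.potY / (c.kap * ρ)) (Pb := c.potV / (c.kap * ρ)) (Pe := c.potD / ρ ^ 2)
    (c₁ := 8 * c.potY * c.K / (c.lam * c.kap ^ 2) * (q.η / ρ) ^ 2)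
    (c₂ := 8 * c.potV * c.K / (c.lam * c.kap ^ 2) * (q.η / ρ) ^ 2)
    (c₃ := c.potD * (q.η / ρ) ^ 2)
    hη.le hc.one_le_K hc.couple_pos.le hc.drift_pos.le (by positivity) (by positivity)
    (errY_nonneg w) (errV_nonneg w) (errS_nonneg a w) (errU_nonneg a w) (moved_nonneg a w)
    (sq_nonneg _) ?_ hc.potD_mul_kap_sq_le ?_ ?_ ?_ ?_ hs hu hSw hUw ?_
  · have h2 : c.potS = 2 * c.drift + 4 * c.couple + 2 := rfl
    rw [h2] at *
    linarith
  · have := hc.potV_le_potY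
    rw [Consts.drift]
    gcongr
  · refine (mul_le_mul_of_nonneg_left hY (by positivity)).trans (le_of_eq ?_)
    -- The contraction rate κρλ/2 against the weight potY/(κρ) gives potY λ/2, independent of ρ. The
    -- definition of `potY` makes this equal to the decrease that is needed.
    have e : c.potY * c.lam / 2 = c.K + 2 + 2 * c.K * c.couple := by
      rw [Consts.potY]; field_simp
    rw [← e, Consts.drift]
    field_simp
  · refine (mul_le_mul_of_nonneg_left hV (by positivity)).trans (le_of_eq ?_)
    have e : c.potV * c.lam / 2 = c.K + 2 := by
      rw [Consts.potV]; field_simp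
    rw [← e, Consts.couple]
    field_simp
    ring
  · refine (mul_le_mul_of_nonneg_left hD (by positivity)).trans (le_of_eq ?_)
    field_simp
  · have h2 : q.η / ρ ≤ c.kapX := (div_le_iff₀ hρ).2 hηle
    have h3 : (q.η / ρ) ^ 2 ≤ c.kapX ^ 2 := by gcongr
    have h4 := mul_le_mul_of_nonneg_left h3 hc.stepCost_pos.le
    have h5 := hc.stepCost_mul_kapX_sq_le
    have h6 : 8 * c.potY * c.K / (c.lam * c.kap ^ 2) * (q.η / ρ) ^ 2
        + 8 * c.potV * c.K / (c.lam * c.kap ^ 2) * (q.η / ρ) ^ 2 + c.potD * (q.η / ρ) ^ 2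
        = c.stepCost * (q.η / ρ) ^ 2 := by
      rw [Consts.stepCost]; ring
    rw [h6]
    linarith
  · have h2 : ‖gradient p.F w.x - w'.z‖ ^ 2
        ≤ 2 * (c.K * (errY p w + errV p w)) + 2 * errZ p w w' := by
      have e : gradient p.F w.x - w'.z
          = (gradient p.F w.x - trackedGrad p w) + -(w'.z - trackedGrad p w) := by abel
      rw [e]
      refine (norm_add_sq_le_two _ _).trans ?_
      rw [norm_neg]
      have : errZ p w w' = ‖w'.z - trackedGrad p w‖ ^ 2 := rfl
      linarith
    have h3 := mul_le_mul_of_nonneg_left h2 hη.le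
    linarith

end OneStep

end BSVRB


/-! ### Expected estimator errors after one iteration -/

namespace BSVRB

variable {m B I : ℕ} {Ξ Z Ω : Type*} [MeasurableSpace Ξ] [MeasurableSpace Z] {p : Problem m Ξ Z}
  {c : Consts}

theorem phiBatch_eq (d : Draw m B Ξ Z) (w : State p) (i : Fin m) :
    phiBatch p d w i = batchMean (fun s : Ξ × Z => p.phS i s.1 s.2 w.x (w.y i) (w.v i))
      fun b => (d.ξ i b, d.ζ i b) := by
  rw [phiBatch, batchMean_apply]
  simp only [batchMean, Problem.phS, Finset.sum_sub_distrib, smul_sub]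

theorem gEst_eq (d : Draw m B Ξ Z) (w : State p) :
    gEst p I d w = (I : ℝ)⁻¹ • ∑ i ∈ d.blocks, batchMean
      (fun s : Ξ × Z => p.txS i s.1 s.2 w.x (w.y i) (w.v i)) fun b => (d.ξ i b, d.ζ i b) := by
  simp only [gEst, batchMean_apply]
  simp only [batchMean, Problem.txS, Finset.sum_sub_distrib, smul_sub]

variable {N : Noise m B Ξ Z Ω}

theorem Noise.measurable_draw_of {s : Set (DrawIdx m B)} {k t : ℕ}
    (hs : DrawIdx.now k t ⊆ s) : Measurable[N.sigmaOf s] fun ω => N.draw ω k t := by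
  have hb : Measurable[N.sigmaOf s, ⊤] (N.blocks k t) :=
    Measurable.of_comap_le (Noise.sigma_le_sigmaOf (N := N) (j := .blocks k t) (hs ⟨rfl, rfl⟩))
  refine Draw.measurable_mk (fun i => ?_)
    (fun i b => Noise.IsSampling.measurable_ξ (hs ⟨rfl, rfl⟩))
    (fun i b => Noise.IsSampling.measurable_ζ (hs ⟨rfl, rfl⟩))
  exact @Measurable.comp _ _ _ (N.sigmaOf s) ⊤ _ (fun A : Finset (Fin m) => i ∈ A) _
    measurable_from_top hb

variable [MeasurableSpace Ω] {pr : Measure Ω} {T : ℕ → ℕ}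

theorem Noise.IsSampling.measurable_draw (hN : N.IsSampling p I T pr) (k t : ℕ) :
    Measurable fun ω => N.draw ω k t :=
  (Noise.measurable_draw_of subset_rfl).mono (hN.sigmaOf_le _) le_rfl

variable [IsProbabilityMeasure pr] (hp : p.Assumptions c) (hc : c.Valid)
  (hN : N.IsSampling p I T pr) {τ : ℝ} {q : StageParams} (hq : StageOK c τ m I q) (hI : 1 ≤ I) (hIm : I ≤ m) (hB : 1 ≤ B)
  (k t : ℕ) (a w : State p)
include hp hc hN hq hI hIm hB

theorem lintegral_errS_step_le :
    ∫⁻ ω, ENNReal.ofReal (errS p w (step p c.V τ I q (N.draw ω k t) a w)) ∂pr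
      ≤ ENNReal.ofReal ((1 - q.β * (I / m)) * errS p a w + 13 * c.K * (1 / (I / m)) * moved p a w
        + 2 * c.K * (I / m) * q.β ^ 2 * (1 / B)) := by
  have hβ := hq.β_pos
  have hK := hc.K_pos
  have hm : 1 ≤ m := hI.trans hIm
  have hr1 : (I : ℝ) / m ≤ 1 := div_le_one_of_le₀ (by exact_mod_cast hIm) (by positivity)
  have hr : (0 : ℝ) < I / m := by positivity
  have h0 : 0 ≤ 1 - q.β * (I / m) := by nlinarith [hq.β_le]
  have hst : Measurable fun ω => step p c.V τ I q (N.draw ω k t) a w :=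
    measurable_step hp measurable_const measurable_const (hN.measurable_draw k t) _ _ _ _
  have h1 : ∀ i, ∫⁻ ω, ENNReal.ofReal (‖(step p c.V τ I q (N.draw ω k t) a w).s i
      - gradY (p.gBar i) w.x (w.y i)‖ ^ 2) ∂pr
      ≤ ENNReal.ofReal ((1 - q.β * (I / m)) * ‖w.s i - gradY (p.gBar i) a.x (a.y i)‖ ^ 2
        + (13 * c.K * (1 / (I / m)) * blockDist p a w i
        + 2 * c.K * (I / m) * q.β ^ 2 * (1 / B))) := fun i => by
    have := hp.isProbabilityMeasure_law i
    refine ((hN.isIteration k t).lintegral_msvr_le hI hIm hB i hK.le (blockDist_nonneg a w i)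
      (isOracle_gradY hp hc a w i) hβ hq.β_le (w.s i)).trans' (le_of_eq ?_) |>.trans (le_of_eq ?_)
    · simp only [step, hq.α_eq]
      rfl
    · rw [one_div_div, add_assoc]
  refine (lintegral_avg_le (fun i => ((State.measurable_s hst i).sub
    measurable_const).norm.pow_const 2) (fun i ω => sq_nonneg _) (fun i => ?_) h1).trans
    (le_of_eq ?_)
  · have := blockDist_nonneg a w i
    positivity
  · rw [avg_add, avg_mul_left, avg_add, avg_mul_left, avg_const hm, ← add_assoc]
    rfl

theorem lintegral_errU_step_le (ha : ∀ i, ‖a.v i‖ ≤ c.V) (hw : ∀ i, ‖w.v i‖ ≤ c.V) :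
    ∫⁻ ω, ENNReal.ofReal (errU p w (step p c.V τ I q (N.draw ω k t) a w)) ∂pr
      ≤ ENNReal.ofReal ((1 - q.β * (I / m)) * errU p a w + 13 * c.K * (1 / (I / m)) * moved p a w
        + 2 * c.K * (I / m) * q.β ^ 2 * (1 / B)) := by
  have hβ := hq.β_pos
  have hK := hc.K_pos
  have hm : 1 ≤ m := hI.trans hIm
  have hr1 : (I : ℝ) / m ≤ 1 := div_le_one_of_le₀ (by exact_mod_cast hIm) (by positivity)
  have hr : (0 : ℝ) < I / m := by positivity
  have h0 : 0 ≤ 1 - q.β * (I / m) := by nlinarith [hq.β_le]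
  have hst : Measurable fun ω => step p c.V τ I q (N.draw ω k t) a w :=
    measurable_step hp measurable_const measurable_const (hN.measurable_draw k t) _ _ _ _
  have h1 : ∀ i, ∫⁻ ω, ENNReal.ofReal (‖(step p c.V τ I q (N.draw ω k t) a w).u i
      - p.phBar i w.x (w.y i) (w.v i)‖ ^ 2) ∂pr
      ≤ ENNReal.ofReal ((1 - q.β * (I / m)) * ‖w.u i - p.phBar i a.x (a.y i) (a.v i)‖ ^ 2
        + (13 * c.K * (1 / (I / m)) * blockDist p a w i
        + 2 * c.K * (I / m) * q.β ^ 2 * (1 / B))) := fun i => by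
    have := hp.isProbabilityMeasure_law i
    refine ((hN.isIteration k t).lintegral_msvr_le hI hIm hB i hK.le (blockDist_nonneg a w i)
      (isOracle_ph hp hc a w i (ha i) (hw i)) hβ hq.β_le (w.u i)).trans' (le_of_eq ?_) |>.trans
      (le_of_eq ?_)
    · simp only [step, hq.αbar_eq, phiBatch_eq]
      rfl
    · rw [one_div_div, add_assoc]
  refine (lintegral_avg_le (fun i => ((State.measurable_u hst i).sub
    measurable_const).norm.pow_const 2) (fun i ω => sq_nonneg _) (fun i => ?_) h1).trans
    (le_of_eq ?_)
  · have := blockDist_nonneg a w i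
    positivity
  · rw [avg_add, avg_mul_left, avg_add, avg_mul_left, avg_const hm, ← add_assoc]
    rfl

/-- Unlike s and u, the single vector z is refreshed in every iteration, so its rate is β rather
than β I/m. -/
theorem lintegral_errZ_step_le (ha : ∀ i, ‖a.v i‖ ≤ c.V) (hw : ∀ i, ‖w.v i‖ ≤ c.V) :
    ∫⁻ ω, ENNReal.ofReal (errZ p w (step p c.V τ I q (N.draw ω k t) a w)) ∂pr
      ≤ ENNReal.ofReal ((1 - q.β) * errZ p a w + 4 * c.K * moved p a w
        + 4 * c.K * q.β ^ 2 * (1 / min (I : ℝ) B)) := by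
  have := hp.isProbabilityMeasure_law
  obtain ⟨e, he⟩ := exists_norm_txBar_sub_sq_le hp hc w hw
  refine ((hN.isIteration k t).lintegral_storm_le hI hIm hB hc.K_pos.le
    (blockDist_nonneg a w) (fun i => isOracle_tx hp hc a w i (ha i) (hw i)) e he hq.β_pos hq.β_le
    w.z).trans' (le_of_eq ?_)
  simp only [errZ, step, gEst_eq, trackedGrad_eq]
  rfl

end BSVRB


/-! ### Expected decrease of the potential -/

namespace BSVRB

variable {m B I : ℕ} {Ξ Z Ω : Type*} [MeasurableSpace Ξ] [MeasurableSpace Z] {p : Problem m Ξ Z}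
  {c : Consts}

section Measurability

variable {A : Type*} {_ : MeasurableSpace A} (hp : p.Assumptions c) (hc : c.Valid)
  {w w' : A → State p} (hw : Measurable w) (hw' : Measurable w')
include hp hc hw hw'

theorem measurable_gain : Measurable fun a => gain p (w' a) (w a) :=
  (((measurable_norm_gradient_F hp hc hw).pow_const 2).div_const 2).add
    ((((((measurable_errY hp hc hw).add (measurable_errV hp hc hw)).add
      (measurable_errS hp hw hw')).add (measurable_errU hp hw hw')).add
      (measurable_errZ hp hw hw')).add (measurable_moved hw hw'))

theorem measurable_potential (q : StageParams) (xstar : Vec p.dx) :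
    Measurable fun a => potential p c I q xstar (w' a) (w a) :=
  ((measurable_F hp hc hw).sub_const _).add
    (((((((measurable_errY hp hc hw).const_mul _).add
      ((measurable_errV hp hc hw).const_mul _)).add ((measurable_moved hw hw').const_mul _)).add
      (((measurable_errS hp hw hw').add (measurable_errU hp hw hw')).const_mul _)).add
      ((measurable_errZ hp hw hw').const_mul _)).const_mul _)

end Measurability

variable {N : Noise m B Ξ Z Ω} [MeasurableSpace Ω] {pr : Measure Ω} {T : ℕ → ℕ}
  [IsProbabilityMeasure pr] (hp : p.Assumptions c) (hc : c.Valid)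
  (hN : N.IsSampling p I T pr) {τ : ℝ} {q : StageParams} (hq : StageOK c τ m I q)
  (hI : 1 ≤ I) (hIm : I ≤ m) (hB : 1 ≤ B) {xstar : Vec p.dx} (hmin : ∀ x, p.F xstar ≤ p.F x)
  (k : ℕ)
include hp hc hN hq hI hIm hB hmin

/-- The pathwise bound is averaged over the draws with `a` and `w` fixed. The gain appears as a
summand on the left because subtraction in `ℝ≥0∞` is truncated. -/
theorem lintegral_potential_step_le (t : ℕ) (a w : State p) (ha : ∀ i, ‖a.v i‖ ≤ c.V)
    (hw : ∀ i, ‖w.v i‖ ≤ c.V) :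
    ∫⁻ ω, ENNReal.ofReal (potential p c I q xstar w (step p c.V τ I q (N.draw ω k t) a w)) ∂pr
      + ENNReal.ofReal (q.η * gain p a w)
      ≤ ENNReal.ofReal (potential p c I q xstar a w)
        + ENNReal.ofReal (q.η * (c.noise * (q.β * (1 / min (I : ℝ) B)))) := by
  have hβ := hq.β_pos
  have hη := hq.η_pos
  have hK := hc.K_pos
  have hS := hc.potS_pos
  have hm : 1 ≤ m := hI.trans hIm
  have hr1 : (I : ℝ) / m ≤ 1 := div_le_one_of_le₀ (by exact_mod_cast hIm) (by positivity)
  have hr : (0 : ℝ) < I / m := by positivity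
  have h0 : 0 ≤ 1 - q.β * (I / m) := by nlinarith [hq.β_le]
  have h0' : 0 ≤ 1 - q.β := by linarith [hq.β_le]
  have hM : 0 < min (I : ℝ) B := lt_min (by exact_mod_cast hI) (by exact_mod_cast hB)
  have hst : Measurable fun ω => step p c.V τ I q (N.draw ω k t) a w :=
    measurable_step hp measurable_const measurable_const (hN.measurable_draw k t) _ _ _ _
  have hS0 := errS_nonneg a w
  have hU0 := errU_nonneg a w
  have hZ0 := errZ_nonneg a w
  have hD0 := moved_nonneg a w
  have mS := measurable_errS hp hst (measurable_const (a := w))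
  have mU := measurable_errU hp hst (measurable_const (a := w))
  have mZ := measurable_errZ hp hst (measurable_const (a := w))
  have hSU := lintegral_ofReal_add_le mS (fun _ => errS_nonneg _ _) (fun _ => errU_nonneg _ _)
    (by positivity) (by positivity)
    (lintegral_errS_step_le hp hc hN hq hI hIm hB k t a w)
    (lintegral_errU_step_le hp hc hN hq hI hIm hB k t a w ha hw)
  have hall := lintegral_ofReal_mul_le hη.le (lintegral_ofReal_add_le ((mS.add mU).const_mul
    (c.potS / (q.β * (I / m)))) (fun _ => mul_nonneg (by positivity)
      (add_nonneg (errS_nonneg _ _) (errU_nonneg _ _)))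
    (fun _ => mul_nonneg (by positivity) (errZ_nonneg _ _)) (by positivity) (by positivity)
    (lintegral_ofReal_mul_le (r := c.potS / (q.β * (I / m))) (by positivity) hSU)
    (lintegral_ofReal_mul_le (r := 2 / q.β + 1) (by positivity)
      (lintegral_errZ_step_le hp hc hN hq hI hIm hB k t a w ha hw)))
  obtain ⟨h1, h2⟩ := lintegral_le_of_le_const_add
    (measurable_potential hp hc hst (measurable_const (a := w)) q xstar)
    ((((mS.add mU).const_mul _).add (mZ.const_mul _)).const_mul _)
    (fun ω => potential_nonneg hc hq hmin _ _)
    (fun ω => mul_nonneg hη.le (add_nonneg (mul_nonneg (by positivity)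
      (add_nonneg (errS_nonneg _ _) (errU_nonneg _ _)))
      (mul_nonneg (by positivity) (errZ_nonneg _ _)))) (by positivity)
    (fun ω => potential_step_le hp hc hq hI hIm xstar (N.draw ω k t) a w ha hw) hall
  refine (add_le_add_left h2 _).trans ?_
  rw [← ENNReal.ofReal_add h1 (mul_nonneg hη.le (gain_nonneg a w)),
    ← ENNReal.ofReal_add (potential_nonneg hc hq hmin a w)
      (mul_nonneg hη.le (mul_nonneg hc.noise_pos.le (by positivity)))]
  refine ENNReal.ofReal_le_ofReal ?_
  have hi : (1 : ℝ) / B ≤ 1 / min (I : ℝ) B := one_div_le_one_div_of_le hM (min_le_right _ _)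
  have hb := mul_le_mul_of_nonneg_left (expected_bracket_le (K := c.K) (k := 4 * c.K * c.drift
    + 4 * c.K * c.couple + 1) (cc := c.potS) (e := c.potD) (r := I / m) (β := q.β)
    (D := moved p a w) (S := errS p a w) (U := errU p a w) (Z := errZ p a w) hK hS hr hr1 hβ
    hq.β_le hD0 hZ0 hi (by positivity) (by rw [Consts.potD]; linarith)
    (by have := hc.drift_pos; have := hc.couple_pos; positivity)) hη.le
  unfold potential gain Consts.noise
  linarith

end BSVRB


/-! ### Telescoping over a stage and the uniform output time -/

namespace BSVRB

variable {m B I : ℕ} {Ξ Z Ω : Type*} [MeasurableSpace Ξ] [MeasurableSpace Z] {p : Problem m Ξ Z}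
  {c : Consts}

theorem measurable_eval_nat {A E : Type*} {_ : MeasurableSpace A} {_ : MeasurableSpace E}
    {f : ℕ → A → E} (hf : ∀ n, Measurable (f n)) {t : A → ℕ} (ht : Measurable t) :
    Measurable fun a => f (t a) a :=
  (measurable_from_prod_countable_left (f := fun w : A × ℕ => f w.2 w.1) hf).comp
    (measurable_id.prodMk ht)

theorem norm_pairAt_v_le (hc : c.Valid) (τ : ℝ) (q : StageParams) (d : ℕ → Draw m B Ξ Z)
    {θ : State p} (hθ : ∀ i, ‖θ.v i‖ ≤ c.V) (n : ℕ) :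
    (∀ i, ‖(pairAt p c.V τ I q d θ n).1.v i‖ ≤ c.V)
      ∧ ∀ i, ‖(pairAt p c.V τ I q d θ n).2.v i‖ ≤ c.V := by
  induction n with
  | zero => exact ⟨hθ, hθ⟩
  | succ n ih => exact ⟨ih.2, fun i => norm_step_v_le τ I q _ _ _ hc i⟩

variable {N : Noise m B Ξ Z Ω} {τ : ℝ} {q : StageParams} {k : ℕ} {θ : Ω → State p}

/-- Pair number n involves only the iterations 1, …, n of the stage. This adaptedness makes draw n +
1 independent of it. -/
theorem measurable_pairAt_past (hp : p.Assumptions c) (τ : ℝ) (q : StageParams)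
    (hθ : Measurable[N.sigmaOf (DrawIdx.past k 1)] θ) (n : ℕ) :
    Measurable[N.sigmaOf (DrawIdx.past k (n + 1))]
      fun ω => pairAt p c.V τ I q (N.draw ω k) (θ ω) n := by
  induction n with
  | zero => exact Measurable.prodMk hθ hθ
  | succ n ih =>
    have h1 := ih.mono (Noise.sigmaOf_mono (DrawIdx.past_subset_succ k (n + 1))) le_rfl
    have hd : Measurable[N.sigmaOf (DrawIdx.past k (n + 1 + 1))] fun ω => N.draw ω k (n + 1) :=
      Noise.measurable_draw_of (DrawIdx.now_subset_past k (n + 1))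
    have h2 := measurable_snd.comp h1
    exact Measurable.prodMk h2 (measurable_step hp h2 (measurable_fst.comp h1) hd c.V τ I q)

variable [MeasurableSpace Ω] {pr : Measure Ω} {T : ℕ → ℕ}
  [IsProbabilityMeasure pr] (hp : p.Assumptions c) (hc : c.Valid)
  (hN : N.IsSampling p I T pr) (hq : StageOK c τ m I q)
  (hI : 1 ≤ I) (hIm : I ≤ m) (hB : 1 ≤ B) {xstar : Vec p.dx} (hmin : ∀ x, p.F xstar ≤ p.F x)
  (hθ : Measurable[N.sigmaOf (DrawIdx.past k 1)] θ) (hv : ∀ ω i, ‖(θ ω).v i‖ ≤ c.V)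

omit [IsProbabilityMeasure pr] in
theorem Noise.IsSampling.measurable_pairAt (hN : N.IsSampling p I T pr) (hp : p.Assumptions c)
    (hθ : Measurable[N.sigmaOf (DrawIdx.past k 1)] θ) (τ : ℝ) (q : StageParams) (n : ℕ) :
    Measurable fun ω => pairAt p c.V τ I q (N.draw ω k) (θ ω) n :=
  (measurable_pairAt_past hp τ q hθ n).mono (hN.sigmaOf_le _) le_rfl

section
include hp hc hN hq hI hIm hB hmin hθ hv

/-- By independence the inequality for fixed variables may be integrated over the random pair. The
ball constraint on v, which it presupposes, holds along every trajectory. -/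
theorem lintegral_potential_succ_le (n : ℕ) :
    ∫⁻ ω, ENNReal.ofReal (potential p c I q xstar
        (pairAt p c.V τ I q (N.draw ω k) (θ ω) (n + 1)).1
        (pairAt p c.V τ I q (N.draw ω k) (θ ω) (n + 1)).2) ∂pr
      + ∫⁻ ω, ENNReal.ofReal (q.η * gain p (pairAt p c.V τ I q (N.draw ω k) (θ ω) n).1
        (pairAt p c.V τ I q (N.draw ω k) (θ ω) n).2) ∂pr
      ≤ ∫⁻ ω, ENNReal.ofReal (potential p c I q xstar
        (pairAt p c.V τ I q (N.draw ω k) (θ ω) n).1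
        (pairAt p c.V τ I q (N.draw ω k) (θ ω) n).2) ∂pr
        + ENNReal.ofReal (q.η * (c.noise * (q.β * (1 / min (I : ℝ) B)))) := by
  set W : Ω → State p × State p := fun ω => pairAt p c.V τ I q (N.draw ω k) (θ ω) n with hW
  have hWm : Measurable W := hN.measurable_pairAt hp hθ τ q n
  have hind : IndepFun W (fun ω => N.draw ω k (n + 1)) pr :=
    hN.indepFun (DrawIdx.disjoint_past_now k (n + 1)) (measurable_pairAt_past hp τ q hθ n)
      (Noise.measurable_draw_of subset_rfl)
  have hG : Measurable (Function.uncurry fun (w : State p × State p) (d : Draw m B Ξ Z) =>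
      ENNReal.ofReal (potential p c I q xstar w.2 (step p c.V τ I q d w.1 w.2))) := by
    have h2 : Measurable fun a : (State p × State p) × Draw m B Ξ Z => a.1.2 :=
      measurable_snd.comp measurable_fst
    have h1 : Measurable fun a : (State p × State p) × Draw m B Ξ Z => a.1.1 :=
      measurable_fst.comp measurable_fst
    exact (measurable_potential hp hc (measurable_step hp h2 h1 measurable_snd c.V τ I q) h2 q
      xstar).ennreal_ofReal
  have hF := lintegral_prod_of_indepFun hWm (hN.measurable_draw k (n + 1)) hind hG
  have hgm : Measurable fun ω => ENNReal.ofReal (q.η * gain p (W ω).1 (W ω).2) :=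
    ((measurable_gain hp hc (measurable_snd.comp hWm)
      (measurable_fst.comp hWm)).const_mul _).ennreal_ofReal
  calc _ = ∫⁻ ω, (∫⁻ ω', ENNReal.ofReal (potential p c I q xstar (W ω).2
          (step p c.V τ I q (N.draw ω' k (n + 1)) (W ω).1 (W ω).2)) ∂pr
        + ENNReal.ofReal (q.η * gain p (W ω).1 (W ω).2)) ∂pr := by
        rw [lintegral_add_right _ hgm, ← hF]
        rfl
    _ ≤ ∫⁻ ω, (ENNReal.ofReal (potential p c I q xstar (W ω).1 (W ω).2)
        + ENNReal.ofReal (q.η * (c.noise * (q.β * (1 / min (I : ℝ) B))))) ∂pr := by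
        refine lintegral_mono fun ω => ?_
        have h := norm_pairAt_v_le (I := I) hc τ q (N.draw ω k) (hv ω) n
        exact lintegral_potential_step_le hp hc hN hq hI hIm hB hmin k (n + 1) _ _ h.1 h.2
    _ = _ := by
        rw [lintegral_add_right _ measurable_const, lintegral_const, measure_univ, mul_one]

theorem sum_lintegral_gain_le (n : ℕ) :
    ∑ t ∈ Finset.range n, ∫⁻ ω, ENNReal.ofReal
        (q.η * gain p (pairAt p c.V τ I q (N.draw ω k) (θ ω) t).1
          (pairAt p c.V τ I q (N.draw ω k) (θ ω) t).2) ∂pr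
      ≤ ∫⁻ ω, ENNReal.ofReal (potential p c I q xstar (θ ω) (θ ω)) ∂pr
        + n * ENNReal.ofReal (q.η * (c.noise * (q.β * (1 / min (I : ℝ) B)))) := by
  have key : ∀ n : ℕ, ∫⁻ ω, ENNReal.ofReal (potential p c I q xstar
        (pairAt p c.V τ I q (N.draw ω k) (θ ω) n).1
        (pairAt p c.V τ I q (N.draw ω k) (θ ω) n).2) ∂pr
      + ∑ t ∈ Finset.range n, ∫⁻ ω, ENNReal.ofReal
        (q.η * gain p (pairAt p c.V τ I q (N.draw ω k) (θ ω) t).1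
          (pairAt p c.V τ I q (N.draw ω k) (θ ω) t).2) ∂pr
      ≤ ∫⁻ ω, ENNReal.ofReal (potential p c I q xstar (θ ω) (θ ω)) ∂pr
        + n * ENNReal.ofReal (q.η * (c.noise * (q.β * (1 / min (I : ℝ) B)))) := by
    intro n
    induction n with
    | zero => simp [pairAt]
    | succ n ih =>
      have h := lintegral_potential_succ_le hp hc hN hq hI hIm hB hmin hθ hv n
      rw [Finset.sum_range_succ, Nat.cast_succ, add_mul, one_mul, ← add_assoc]
      calc _ = _ := add_right_comm _ _ _
        _ ≤ _ := add_le_add_left h _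
        _ = _ := add_right_comm _ _ _
        _ ≤ _ := (add_le_add_left ih _).trans_eq (add_assoc _ _ _)
  exact le_add_self.trans (key n)

end

section
include hN

theorem Noise.IsSampling.ae_tout (hk : 1 ≤ k) (hT : 1 ≤ T k) :
    ∀ᵐ ω ∂pr, N.tout k ω ∈ Finset.Icc 1 (T k) := by
  have h1 : pr (⋃ t ∈ Finset.Icc 1 (T k), N.tout k ⁻¹' {t}) = 1 := by
    rw [measure_biUnion_finset (fun A _ A' _ hne => by
        refine Disjoint.preimage _ ?_
        simpa using hne) (fun t _ => hN.meas_tout k (measurableSet_singleton t)),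
      Finset.sum_congr rfl fun t ht => hN.law_tout k hk t ht,
      Finset.sum_const, Nat.card_Icc, nsmul_eq_mul, Nat.add_sub_cancel]
    exact ENNReal.mul_inv_cancel (by exact_mod_cast (by omega : T k ≠ 0))
      (ENNReal.natCast_ne_top _)
  have h2 := (mem_ae_iff_prob_eq_one (Finset.measurableSet_biUnion _
    fun t _ => hN.meas_tout k (measurableSet_singleton t))).2 h1
  filter_upwards [h2] with ω hω
  simpa using hω

/-- Averaging over the uniform output time. -/
theorem Noise.IsSampling.lintegral_tout (hk : 1 ≤ k) (hT : 1 ≤ T k) {g : ℕ → Ω → ℝ≥0∞}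
    (hg : ∀ n, Measurable[N.sigmaOf (DrawIdx.past k (n + 1))] (g n)) :
    ∫⁻ ω, g (N.tout k ω - 1) ω ∂pr
      = ((T k : ℕ) : ℝ≥0∞)⁻¹ * ∑ n ∈ Finset.range (T k), ∫⁻ ω, g n ω ∂pr := by
  have hgm : ∀ n, Measurable (g n) := fun n => (hg n).mono (hN.sigmaOf_le _) le_rfl
  have hms : ∀ t, MeasurableSet (N.tout k ⁻¹' {t}) :=
    fun t => hN.meas_tout k (measurableSet_singleton t)
  have hout : Measurable[N.sigmaOf {.out k}] (N.tout k) :=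
    Measurable.of_comap_le (Noise.sigma_le_sigmaOf (N := N) (j := .out k) rfl)
  -- Output time t selects pair number t - 1, so n runs through 0, …, T - 1 and is matched with the
  -- event that the output time is n + 1.
  have h1 : ∀ᵐ ω ∂pr, g (N.tout k ω - 1) ω = ∑ n ∈ Finset.range (T k),
      (N.tout k ⁻¹' {n + 1}).indicator 1 ω * g n ω := by
    filter_upwards [hN.ae_tout hk hT] with ω hω
    rw [Finset.mem_Icc] at hω
    rw [Finset.sum_eq_single_of_mem (N.tout k ω - 1) (Finset.mem_range.2 (by omega))]
    · have : N.tout k ω = N.tout k ω - 1 + 1 := by omega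
      simp [Set.indicator, ← this]
    · intro n _ hn
      have : N.tout k ω ≠ n + 1 := by omega
      simp [Set.indicator, this]
  have hmi : ∀ n, Measurable fun ω => (N.tout k ⁻¹' {n + 1}).indicator 1 ω * g n ω :=
    fun n => (measurable_one.indicator (hms _)).mul (hgm n)
  rw [lintegral_congr_ae h1, lintegral_finsetSum _ fun n _ => hmi n, Finset.mul_sum]
  refine Finset.sum_congr rfl fun n hn => ?_
  -- The output time of stage k is not among the past draws within stage k, so it is independent of
  -- the trajectory that it samples.
  have hi : IndepFun ((N.tout k ⁻¹' {n + 1}).indicator (1 : Ω → ℝ≥0∞)) (g n) pr := by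
    refine hN.indepFun (s := {.out k}) (t := DrawIdx.past k (n + 1)) ?_ ?_ (hg n)
    · rw [Set.disjoint_singleton_left]
      simp [DrawIdx.past]
    · exact Measurable.indicator (f := fun _ => (1 : ℝ≥0∞)) measurable_const
        (hout (measurableSet_singleton (n + 1)))
  have h2 := lintegral_mul_eq_lintegral_mul_lintegral_of_indepFun
    (measurable_one.indicator (hms (n + 1))) (hgm n) hi
  simp only [Pi.mul_apply] at h2
  rw [h2, lintegral_indicator_one (hms _),
    hN.law_tout k hk _ (Finset.mem_Icc.2 ⟨by omega, by have := Finset.mem_range.1 hn; omega⟩)]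

end

/-- Ratio of the initial potential to the initial errors. -/
noncomputable def Consts.initial (c : Consts) : ℝ := (c.potY + c.potV) / c.kap + c.potS + 2

theorem Consts.Valid.initial_pos (hc : c.Valid) : 0 < c.initial := by
  have := hc.potY_pos
  have := hc.potV_pos
  have := hc.potS_pos
  have := hc.kap_pos
  unfold Consts.initial; positivity

-- A stage starts with two equal tuples, so the displacement and its large weight 1/ρ² do not enter.
-- The other weights are at most of order (m/I)/β, since β ≤ √β.
omit [MeasurableSpace Ω] in
include hc hq hI hIm in
theorem potential_self_le (w : State p) :
    potential p c I q xstar w w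
      ≤ (p.F w.x - p.F xstar) + q.η * (c.initial * ((m / I) / q.β)) * totalError p w := by
  have hβ := hq.β_pos
  have hr1 : (I : ℝ) / m ≤ 1 := div_le_one_of_le₀ (by exact_mod_cast hIm) (by positivity)
  have hm : 1 ≤ m := hI.trans hIm
  have hr : (0 : ℝ) < I / m := by positivity
  have hκ := hc.kap_pos
  have hY := errY_nonneg w
  have hV := errV_nonneg w
  have hS := errS_nonneg w w
  have hU := errU_nonneg w w
  have hZ := errZ_nonneg w w
  have hpY := hc.potY_pos
  have hpV := hc.potV_pos
  have hpS := hc.potS_pos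
  have hI0 : (0 : ℝ) < I := by exact_mod_cast hI
  have hm0 : (0 : ℝ) < m := by exact_mod_cast hm
  have er : (m : ℝ) / I = 1 / (I / m) := by rw [one_div_div]
  rw [totalError_eq, potential, moved_self, er]
  set r : ℝ := (I : ℝ) / m
  have hsq : q.β ≤ √q.β := by
    rw [Real.le_sqrt' hβ]
    nlinarith [hq.β_le]
  have h1 : ∀ a : ℝ, 0 < a → a / (c.kap * (r * √q.β)) ≤ a / c.kap * (1 / r / q.β) := fun a ha => by
    have e : a / c.kap * (1 / r / q.β) = a / (c.kap * (r * q.β)) := by field_simp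
    rw [e]
    gcongr
  have hJ : 0 ≤ 1 / r / q.β := by positivity
  have h2 : c.potS / (q.β * r) = c.potS * (1 / r / q.β) := by field_simp
  have h3 : 2 / q.β ≤ 2 * (1 / r / q.β) := by
    have : 1 ≤ 1 / r := by rw [le_div_iff₀ hr]; linarith
    have : 1 / q.β ≤ 1 / r / q.β := by gcongr
    calc _ = 2 * (1 / q.β) := by ring
      _ ≤ _ := by gcongr
  have hη := hq.η_pos
  rw [add_le_add_iff_left, mul_assoc]
  refine mul_le_mul_of_nonneg_left ?_ hη.le
  have i1 := mul_le_mul_of_nonneg_right (h1 _ hpY) hY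
  have i2 := mul_le_mul_of_nonneg_right (h1 _ hpV) hV
  have i3 := mul_le_mul_of_nonneg_right h3 hZ
  rw [h2]
  set J := 1 / r / q.β
  have e : c.initial * J = c.potY / c.kap * J + c.potV / c.kap * J + c.potS * J + 2 * J := by
    rw [Consts.initial]; ring
  rw [e]
  have n1 : 0 ≤ c.potY / c.kap * J := by positivity
  have n2 : 0 ≤ c.potV / c.kap * J := by positivity
  have n3 : 0 ≤ c.potS * J := by positivity
  have n4 : 0 ≤ 2 * J := by positivity
  nlinarith [mul_nonneg n1 hV, mul_nonneg n1 hS, mul_nonneg n1 hU, mul_nonneg n1 hZ,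
    mul_nonneg n2 hY, mul_nonneg n2 hS, mul_nonneg n2 hU, mul_nonneg n2 hZ,
    mul_nonneg n3 hY, mul_nonneg n3 hV, mul_nonneg n3 hZ,
    mul_nonneg n4 hY, mul_nonneg n4 hV, mul_nonneg n4 hS, mul_nonneg n4 hU]

end BSVRB


/-! ### The effect of one stage -/

namespace BSVRB

variable {m B I : ℕ} {Ξ Z Ω : Type*} [MeasurableSpace Ξ] [MeasurableSpace Z] {p : Problem m Ξ Z}
  {c : Consts}

theorem totalError_nonneg (w : State p) : 0 ≤ totalError p w := by
  rw [totalError_eq]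
  have := errY_nonneg w
  have := errV_nonneg w
  have := errS_nonneg w w
  have := errU_nonneg w w
  have := errZ_nonneg w w
  positivity

/-- This makes restarting possible: the quantity that bounds the objective gap at the output also
bounds the initial errors of the next stage. -/
theorem totalError_le_gain (hp : p.Assumptions c) (hc : c.Valid) (a w : State p)
    (ha : ∀ i, ‖a.v i‖ ≤ c.V) : totalError p w ≤ 6 * c.K * gain p a w := by
  refine (totalError_le hp hc a w ha).trans ?_
  have hK := hc.one_le_K
  have hY := errY_nonneg w
  have hV := errV_nonneg w
  have hS := errS_nonneg a w
  have hU := errU_nonneg a w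
  have hZ := errZ_nonneg a w
  have hG : 0 ≤ ‖gradient p.F w.x‖ ^ 2 / 2 := by positivity
  have h1 : 0 ≤ c.K - 1 := by linarith
  unfold gain
  nlinarith [mul_nonneg h1 hY, mul_nonneg h1 hV, mul_nonneg h1 hS, mul_nonneg h1 hU,
    mul_nonneg h1 hZ, mul_nonneg h1 hG]

theorem Problem.PL.sub_le_gain {μ : ℝ} {xstar : Vec p.dx} (h : p.PL μ xstar) (hμ : 0 < μ)
    (a w : State p) : p.F w.x - p.F xstar ≤ 2 / μ * gain p a w := by
  have h1 := h.pl w.x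
  have hY := errY_nonneg w
  have hV := errV_nonneg w
  have hS := errS_nonneg a w
  have hU := errU_nonneg a w
  have hZ := errZ_nonneg a w
  have hD := moved_nonneg a w
  rw [div_mul_eq_mul_div, le_div_iff₀ hμ]
  unfold gain
  linarith

variable {N : Noise m B Ξ Z Ω} {τ : ℝ} {q : StageParams} {k : ℕ} {θ : Ω → State p}

theorem norm_iterate_v_le (hc : c.Valid) (τ : ℝ) (q : StageParams) (d : ℕ → Draw m B Ξ Z)
    {θ : State p} (hθ : ∀ i, ‖θ.v i‖ ≤ c.V) (t : ℕ) (i : Fin m) :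
    ‖(iterate p c.V τ I q d θ t).v i‖ ≤ c.V :=
  (norm_pairAt_v_le hc τ q d hθ (t - 1)).2 i

theorem measurable_pairAt_tout (hp : p.Assumptions c) (τ : ℝ) (q : StageParams)
    (hθ : Measurable[N.sigmaOf (DrawIdx.past k 1)] θ) :
    Measurable[N.sigmaOf (DrawIdx.past (k + 1) 1)]
      fun ω => pairAt p c.V τ I q (N.draw ω k) (θ ω) (N.tout k ω - 1) := by
  have hout : Measurable[N.sigmaOf (DrawIdx.past (k + 1) 1)] (N.tout k) :=
    Measurable.of_comap_le (Noise.sigma_le_sigmaOf (N := N) (j := .out k) (Nat.lt_succ_self k))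
  exact measurable_eval_nat (fun n => (measurable_pairAt_past hp τ q hθ n).mono
    (Noise.sigmaOf_mono (DrawIdx.past_subset_next k (n + 1))) le_rfl)
    ((measurable_of_countable fun n : ℕ => n - 1).comp hout)

variable [MeasurableSpace Ω] {pr : Measure Ω} {T : ℕ → ℕ}
  [IsProbabilityMeasure pr] (hp : p.Assumptions c) (hc : c.Valid)
  (hN : N.IsSampling p I T pr) (hq : StageOK c τ m I q)
  (hI : 1 ≤ I) (hIm : I ≤ m) (hB : 1 ≤ B) {xstar : Vec p.dx}
  (hθ : Measurable[N.sigmaOf (DrawIdx.past k 1)] θ) (hv : ∀ ω i, ‖(θ ω).v i‖ ≤ c.V)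
  (hk : 1 ≤ k) (hT : 1 ≤ T k) {x y : ℝ} (hx0 : 0 ≤ x) (hy0 : 0 ≤ y)
  (hx : ∫⁻ ω, ENNReal.ofReal (p.F (θ ω).x - p.F xstar) ∂pr ≤ ENNReal.ofReal x)
  (hy : ∫⁻ ω, ENNReal.ofReal (totalError p (θ ω)) ∂pr ≤ ENNReal.ofReal y)

/-- The bound for the expected gain at the output of a stage of length `T`, whose initial
objective gap and initial total error are bounded by `x` and `y` in expectation. -/
noncomputable def stageBound (c : Consts) (m I B : ℕ) (q : StageParams) (T : ℕ) (x y : ℝ) : ℝ :=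
  x / (q.η * T) + c.initial * ((m / I) / q.β) * y / T + c.noise * (q.β * (1 / min (I : ℝ) B))

include hp hc hN hq hI hIm hB hθ hv hk hT hx0 hy0 hx hy

/-- The telescoped inequality divided by ηT. The final potential has been dropped, and the uniform
output time turns the average over the stage into an expectation. -/
theorem lintegral_gain_out_le (hmin : ∀ x, p.F xstar ≤ p.F x) :
    ∫⁻ ω, ENNReal.ofReal (gain p
        (pairAt p c.V τ I q (N.draw ω k) (θ ω) (N.tout k ω - 1)).1
        (pairAt p c.V τ I q (N.draw ω k) (θ ω) (N.tout k ω - 1)).2) ∂pr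
      ≤ ENNReal.ofReal (stageBound c m I B q (T k) x y) := by
  have hη := hq.η_pos
  have hβ := hq.β_pos
  have hn := hc.noise_pos
  have hi := hc.initial_pos
  have hT0 : (0 : ℝ) < T k := by exact_mod_cast hT
  have hM : 0 < min (I : ℝ) B := lt_min (by exact_mod_cast hI) (by exact_mod_cast hB)
  have hθm : Measurable θ := hθ.mono (hN.sigmaOf_le _) le_rfl
  have h1 := hN.lintegral_tout hk hT (g := fun n ω => ENNReal.ofReal (gain p
    (pairAt p c.V τ I q (N.draw ω k) (θ ω) n).1 (pairAt p c.V τ I q (N.draw ω k) (θ ω) n).2))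
    fun n => (measurable_gain hp hc (measurable_snd.comp (measurable_pairAt_past hp τ q hθ n))
      (measurable_fst.comp (measurable_pairAt_past hp τ q hθ n))).ennreal_ofReal
  have h2 := sum_lintegral_gain_le hp hc hN hq hI hIm hB hmin hθ hv (T k)
  simp only [ENNReal.ofReal_mul hη.le] at h2
  simp only [lintegral_const_mul' _ _ ENNReal.ofReal_ne_top] at h2
  rw [← Finset.mul_sum] at h2
  have h3 : ∫⁻ ω, ENNReal.ofReal (potential p c I q xstar (θ ω) (θ ω)) ∂pr
      ≤ ENNReal.ofReal (x + q.η * (c.initial * ((m / I) / q.β)) * y) := by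
    refine (lintegral_mono fun ω => ENNReal.ofReal_le_ofReal
      (potential_self_le hc hq hI hIm (xstar := xstar) (θ ω))).trans ?_
    exact lintegral_ofReal_add_le ((measurable_F hp hc hθm).sub_const _)
      (fun ω => sub_nonneg.2 (hmin _))
      (fun ω => mul_nonneg (by positivity) (totalError_nonneg _)) hx0 (by positivity) hx
      (lintegral_ofReal_mul_le (by positivity) hy)
  rw [h1]
  set S := ∑ n ∈ Finset.range (T k), ∫⁻ ω, ENNReal.ofReal (gain p
    (pairAt p c.V τ I q (N.draw ω k) (θ ω) n).1
    (pairAt p c.V τ I q (N.draw ω k) (θ ω) n).2) ∂pr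
  have h4 : ENNReal.ofReal q.η * S ≤ ENNReal.ofReal (x + q.η * (c.initial * ((m / I) / q.β)) * y
      + T k * (q.η * (c.noise * (q.β * (1 / min (I : ℝ) B))))) := by
    refine h2.trans ((add_le_add_left h3 _).trans (le_of_eq (Eq.symm ?_)))
    rw [ENNReal.ofReal_add (by positivity) (by positivity), ENNReal.ofReal_mul hT0.le,
      ENNReal.ofReal_natCast, ENNReal.ofReal_mul hη.le]
  have h5 : ((T k : ℕ) : ℝ≥0∞)⁻¹ * S
      = ENNReal.ofReal (1 / (q.η * T k)) * (ENNReal.ofReal q.η * S) := by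
    rw [← mul_assoc, ← ENNReal.ofReal_mul (by positivity)]
    congr 1
    have : 1 / (q.η * T k) * q.η = ((T k : ℕ) : ℝ)⁻¹ := by field_simp
    rw [this, ENNReal.ofReal_inv_of_pos hT0, ENNReal.ofReal_natCast]
  rw [h5]
  refine (mul_le_mul_right h4 _).trans (le_of_eq ?_)
  rw [← ENNReal.ofReal_mul (by positivity)]
  congr 1
  rw [stageBound]
  field_simp

theorem lintegral_stage_le {μ : ℝ} (hμ : 0 < μ) (hPL : p.PL μ xstar) {x' y' : ℝ}
    (hx' : 2 / μ * stageBound c m I B q (T k) x y ≤ x')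
    (hy' : 6 * c.K * stageBound c m I B q (T k) x y ≤ y') :
    ∫⁻ ω, ENNReal.ofReal (p.F (iterate p c.V τ I q (N.draw ω k) (θ ω) (N.tout k ω)).x
        - p.F xstar) ∂pr ≤ ENNReal.ofReal x'
      ∧ ∫⁻ ω, ENNReal.ofReal (totalError p
        (iterate p c.V τ I q (N.draw ω k) (θ ω) (N.tout k ω))) ∂pr ≤ ENNReal.ofReal y' := by
  have hK := hc.K_pos
  have h := lintegral_gain_out_le hp hc hN hq hI hIm hB hθ hv hk hT hx0 hy0 hx hy hPL.isMin
  constructor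
  · refine le_trans (lintegral_mono fun ω => ENNReal.ofReal_le_ofReal
      (hPL.sub_le_gain hμ _ _)) ((lintegral_ofReal_mul_le (by positivity) h).trans
        (ENNReal.ofReal_le_ofReal hx'))
  · refine le_trans (lintegral_mono fun ω => ENNReal.ofReal_le_ofReal
      (totalError_le_gain hp hc _ _ (norm_pairAt_v_le hc τ q (N.draw ω k) (hv ω) _).1))
      ((lintegral_ofReal_mul_le (by positivity) h).trans (ENNReal.ofReal_le_ofReal hy'))

end BSVRB


/-! ### Choice of the stage constants -/

namespace BSVRB

/-- The constants in the choice of the parameters. -/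
noncomputable def Consts.stageConsts (c : Consts) (τ : ℝ) : RConsts where
  LF := c.LFc
  Ctau := c.kap ^ 2
  -- This choice makes τ τ_k equal to the step of v, so that y and v move with the same step size.
  C8 := (1 / τ) ^ 2
  -- The factor 6K converts gain into total error; in noise + 1 the one leaves room for the initial
  -- terms of the first stage.
  C9 := 6 * c.K * (c.noise + 1)
  C10 := c.kapX ^ 2
  -- With this factor the two initial terms of `stageBound` together use με/(12K), half of the
  -- budget of a later stage.
  cT := 24 * c.K * (1 + c.initial)

/-- Lower bound for the ratio of the upper-level step size to `I √β / m`. -/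
noncomputable def Consts.kapLow (c : Consts) (τ : ℝ) : ℝ :=
  c.kapX * min (min (c.kap / τ) c.kap) 1

variable {c : Consts} (hc : c.Valid) {τ : ℝ} (hτ : 0 < τ)
include hc hτ

theorem Consts.Valid.stageConsts_pos : (c.stageConsts τ).Pos where
  LF_pos := hc.LFc_pos
  Ctau_pos := pow_pos hc.kap_pos 2
  C8_pos := by simp only [Consts.stageConsts]; positivity
  C9_pos := by
    have := hc.K_pos
    have := hc.noise_pos
    simp only [Consts.stageConsts]; positivity
  C10_pos := pow_pos hc.kapX_pos 2
  cT_pos := by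
    have := hc.K_pos
    have := hc.initial_pos
    simp only [Consts.stageConsts]; positivity

theorem Consts.Valid.kapLow_pos : 0 < c.kapLow τ := by
  have := hc.kap_pos
  exact mul_pos hc.kapX_pos (lt_min (lt_min (by positivity) (by positivity)) one_pos)

variable {m I : ℕ} (hI : 1 ≤ I) (hIm : I ≤ m) {q : StageParams}
include hI hIm

/-- As κ ≤ 1, the squared step of v is the active entry of the minimum, and `C8` cancels the factor
τ. -/
theorem step_sizes_of_eq (hβ : 0 < q.β) (hα : q.α = q.β)
    (hv : q.stepV = c.kap * (I / m * √q.β))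
    (hy : q.stepY = √(c.stageConsts τ).C8
      * √(min (q.stepV ^ 2) ((I : ℝ) ^ 2 * q.α / (m : ℝ) ^ 2))) :
    τ * q.stepY = c.kap * (I / m * √q.β) := by
  have hm : (0 : ℝ) < m := by exact_mod_cast hI.trans hIm
  have hρ : (0 : ℝ) < I / m * √q.β := by positivity
  have hκ := hc.kap_pos
  have e : (I : ℝ) ^ 2 * q.α / (m : ℝ) ^ 2 = (I / m * √q.β) ^ 2 := by
    rw [hα, mul_pow, Real.sq_sqrt hβ.le]; ring
  have h1 : min (q.stepV ^ 2) ((I / m * √q.β) ^ 2) = q.stepV ^ 2 := by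
    refine min_eq_left ?_
    rw [hv]
    have : c.kap * (I / m * √q.β) ≤ I / m * √q.β := mul_le_of_le_one_left hρ.le c.kap_le_one
    gcongr
  rw [hy, e, h1, Consts.stageConsts, Real.sqrt_sq (by positivity), Real.sqrt_sq (by
    rw [hv]; positivity), hv]
  field_simp

/-- In the minimum defining the step of v all other entries are at least κ by the choice of `kap`,
and ρ ≤ 1, so the entry κρ is active; likewise the cap 1/(2L_F) on η is inactive. The lower bound
for η uses √m ≥ 1. -/
theorem FirstStage.stageOK {c₁ μ : ℝ} {B : ℕ} (h : FirstStage c (c.stageConsts τ) c₁ μ m I B q) :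
    StageOK c τ m I q ∧ c.kapLow τ * (I / m * √q.β) ≤ q.η := by
  have hm1 : (1 : ℝ) ≤ m := by exact_mod_cast hI.trans hIm
  have hm : (0 : ℝ) < m := by linarith
  have hβ := h.β_pos
  have hρ : (0 : ℝ) < I / m * √q.β := by positivity
  have hκ := hc.kap_pos
  have hκX := hc.kapX_pos
  have hr1 : (I : ℝ) / m ≤ 1 := div_le_one_of_le₀ (by exact_mod_cast hIm) (by positivity)
  have hρ1 : I / m * √q.β ≤ 1 :=
    mul_le_one₀ hr1 (Real.sqrt_nonneg _) (Real.sqrt_le_one.2 (by linarith [h.β_le]))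
  have hκρ : c.kap * (I / m * √q.β) ≤ c.kap := mul_le_of_le_one_right hκ.le hρ1
  have hv : q.stepV = c.kap * (I / m * √q.β) := by
    rw [h.stepV_eq, h.αbar_eq]
    have e : √(c.stageConsts τ).Ctau * I * √q.β / m = c.kap * (I / m * √q.β) := by
      rw [Consts.stageConsts, Real.sqrt_sq hκ.le]; ring
    rw [e, min_eq_right, min_eq_right]
    · exact hκρ.trans ((min_le_right _ _).trans (min_le_left _ _))
    · exact (min_le_right _ _).trans (hκρ.trans (min_le_left _ _))
  have hy := step_sizes_of_eq hc hτ hI hIm hβ h.α_eq hv h.stepY_eq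
  have hsq : 1 ≤ √(m : ℝ) := Real.one_le_sqrt.2 hm1
  have e1 : √q.α * I / m = I / m * √q.β := by rw [h.α_eq]; ring
  have e2 : q.stepY = c.kap / τ * (I / m * √q.β) := by
    rw [div_mul_eq_mul_div, ← hy]; field_simp
  have hη : q.η = c.kapX * min (min (√(m : ℝ) * q.stepY) (√(m : ℝ) * q.stepV))
      (I / m * √q.β) := by
    rw [h.η_eq, e1, min_eq_right]
    · rw [Consts.stageConsts, Real.sqrt_sq hκX.le]
    · rw [Consts.stageConsts, Real.sqrt_sq hκX.le, le_div_iff₀ (mul_pos two_pos hc.LFc_pos)]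
      have h1 : c.kapX * min (min (√(m : ℝ) * q.stepY) (√(m : ℝ) * q.stepV)) (I / m * √q.β)
          ≤ c.kapX * 1 := mul_le_mul_of_nonneg_left ((min_le_right _ _).trans hρ1) hκX.le
      nlinarith [hc.kapX_mul_LFc_le, hc.LFc_pos]
  have hlow : c.kapLow τ * (I / m * √q.β) ≤ q.η := by
    rw [hη, Consts.kapLow, mul_assoc]
    refine mul_le_mul_of_nonneg_left ?_ hκX.le
    rw [min_mul_of_nonneg _ _ hρ.le, min_mul_of_nonneg _ _ hρ.le, one_mul, ← e2, ← hv]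
    have h1 : 0 ≤ q.stepY := by rw [e2]; positivity
    have h2 : 0 ≤ q.stepV := by rw [hv]; positivity
    exact min_le_min (min_le_min (le_mul_of_one_le_left h1 hsq) (le_mul_of_one_le_left h2 hsq))
      le_rfl
  exact ⟨⟨hβ, h.β_le, h.α_eq, h.αbar_eq, hy, hv,
    (mul_pos (hc.kapLow_pos hτ) hρ).trans_le hlow, by
      rw [hη]; exact mul_le_mul_of_nonneg_left (min_le_right _ _) hκX.le⟩, hlow⟩

theorem LaterStage.stageOK {μ ε : ℝ} {B : ℕ} (h : LaterStage (c.stageConsts τ) μ ε m I B q)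
    (hβ2 : q.β ≤ 1 / 2) : StageOK c τ m I q := by
  have hm1 : (1 : ℝ) ≤ m := by exact_mod_cast hI.trans hIm
  have hm : (0 : ℝ) < m := by linarith
  have hβ := h.β_pos
  have hρ : (0 : ℝ) < I / m * √q.β := by positivity
  have hκ := hc.kap_pos
  have hκX := hc.kapX_pos
  have hv : q.stepV = c.kap * (I / m * √q.β) := by
    rw [← pow_left_inj₀ h.stepV_nonneg (by positivity) two_ne_zero, h.stepV_eq, h.αbar_eq,
      Consts.stageConsts, mul_pow, mul_pow, Real.sq_sqrt hβ.le]
    ring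
  have hy := step_sizes_of_eq hc hτ hI hIm hβ h.α_eq hv h.stepY_eq
  have e1 : q.α * (I : ℝ) ^ 2 / (m : ℝ) ^ 2 = (I / m * √q.β) ^ 2 := by
    rw [h.α_eq, mul_pow, Real.sq_sqrt hβ.le]; ring
  have hη : q.η = c.kapX
      * √(min (min (m * q.stepY ^ 2) (m * q.stepV ^ 2)) ((I / m * √q.β) ^ 2)) := by
    rw [h.η_eq, e1, Consts.stageConsts, Real.sqrt_sq hκX.le]
  have hy0 : 0 < q.stepY := by
    have : 0 < τ * q.stepY := by rw [hy]; positivity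
    exact pos_of_mul_pos_right this hτ.le
  have hv0 : 0 < q.stepV := by rw [hv]; positivity
  refine ⟨hβ, hβ2, h.α_eq, h.αbar_eq, hy, hv, ?_, ?_⟩
  · rw [hη]
    refine mul_pos hκX (Real.sqrt_pos.2 (lt_min (lt_min ?_ ?_) ?_)) <;> positivity
  · rw [hη]
    refine mul_le_mul_of_nonneg_left ?_ hκX.le
    rw [← Real.sqrt_sq hρ.le]
    refine Real.sqrt_le_sqrt (le_trans (min_le_right _ _) (le_of_eq ?_))
    rw [Real.sqrt_sq hρ.le]

end BSVRB


/-! ### Halving induction over the stages -/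

namespace BSVRB

variable {m B I : ℕ} {Ξ Z Ω : Type*} [MeasurableSpace Ξ] [MeasurableSpace Z] {p : Problem m Ξ Z}
  {c : Consts}

/-- A gradient step of length 1/(2L_F) shows 3‖∇F‖² ≤ 8L_F (F(x) - F(x*)). Together with the PL
inequality this gives μ ≤ 8L_F/3 as soon as the gap is positive. It keeps c₁ independent of μ. -/
theorem Problem.PL.le_of_lt {μ : ℝ} {xstar x : Vec p.dx} (hPL : p.PL μ xstar)
    (hp : p.Assumptions c) (hc : c.Valid) (hx : p.F xstar < p.F x) : μ ≤ 3 * c.LFc := by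
  have hL := hc.LFc_pos
  have h1 := F_descent hp hc x (gradient p.F x) (η := 1 / (2 * c.LFc)) (by positivity)
    (by field_simp; exact le_rfl)
  rw [sub_self, norm_zero] at h1
  have h2 := hPL.isMin (x - (1 / (2 * c.LFc)) • gradient p.F x)
  have h3 := hPL.pl x
  have h4 : 3 / (8 * c.LFc) * ‖gradient p.F x‖ ^ 2 ≤ p.F x - p.F xstar := by
    have e : 3 / (8 * c.LFc) * ‖gradient p.F x‖ ^ 2 = 1 / (2 * c.LFc) / 2 * ‖gradient p.F x‖ ^ 2
      + 1 / (2 * c.LFc) / 4 * ‖gradient p.F x‖ ^ 2 := by field_simp; ring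
    rw [e]
    linarith
  rw [div_mul_eq_mul_div, div_le_iff₀ (by positivity)] at h4
  have h5 : 0 < p.F x - p.F xstar := sub_pos.2 hx
  refine le_of_mul_le_mul_right ?_ h5
  nlinarith

theorem epsStage_succ (C : RConsts) (μ : ℝ) (I B : ℕ) (q : StageParams) {k : ℕ} (hk : 1 ≤ k) :
    epsStage C μ I B q k = 2 * epsStage C μ I B q (k + 1) := by
  obtain ⟨j, rfl⟩ := Nat.exists_eq_add_of_le' hk
  simp only [epsStage, Nat.add_sub_cancel, pow_succ]
  field_simp

theorem epsStage_le {C : RConsts} {μ : ℝ} {I B : ℕ} {q : StageParams} {ε : ℝ} (hε : 0 < ε) {K : ℕ}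
    (hK : 1 ≤ K) (h1 : 0 < epsStage C μ I B q 1)
    (h : 1 + Real.logb 2 (epsStage C μ I B q 1 / ε) ≤ K) : epsStage C μ I B q K ≤ ε := by
  have e : epsStage C μ I B q K = epsStage C μ I B q 1 / 2 ^ (K - 1) := by simp [epsStage]
  have h2 : Real.logb 2 (epsStage C μ I B q 1 / ε) ≤ ((K - 1 : ℕ) : ℝ) := by
    rw [Nat.cast_sub hK, Nat.cast_one]; linarith
  rw [Real.logb_le_iff_le_rpow one_lt_two (div_pos h1 hε), Real.rpow_natCast,
    div_le_iff₀ hε] at h2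
  rw [e, div_le_iff₀ (by positivity)]
  linarith

section Bounds

variable {τ μ : ℝ} {q : StageParams} (hc : c.Valid) (hτ : 0 < τ) (hμ : 0 < μ) (hI : 1 ≤ I)
  (hIm : I ≤ m) (hB : 1 ≤ B)
include hc hμ hI hB

omit hc in
theorem epsStage_one_eq {C : RConsts} (hα : q.α = q.β) (hαbar : q.αbar = q.β) :
    μ * epsStage C μ I B q 1 = 21 * C.C9 * (q.β * (1 / min (I : ℝ) B)) := by
  have hM : 0 < min (I : ℝ) B := lt_min (by exact_mod_cast hI) (by exact_mod_cast hB)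
  rw [epsStage, hα, hαbar, Nat.sub_self, pow_zero]
  field_simp
  ring

include hτ hIm

omit hB in
theorem FirstStage.T_pos {c₁ : ℝ} (hc₁ : 0 < c₁)
    (h : FirstStage c (c.stageConsts τ) c₁ μ m I B q) : 1 ≤ q.T := by
  obtain ⟨hq, -⟩ := h.stageOK hc hτ hI hIm
  have hη := hq.η_pos
  have h1 : 0 < (q.T : ℝ) := lt_of_lt_of_le (mul_pos hc₁ (lt_max_of_lt_left
    (lt_max_of_lt_left (by positivity)))) h.T_ge
  exact_mod_cast h1

/-- Only the middle entry of the bound for T_1 is used. Being of order (m/I) min{I, B}/(μβ²), it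
brings both initial terms down to the level β/min{I, B} of the noise, with a factor μR/c₁ that μ ≤
3L_F controls. -/
theorem FirstStage.stageBound_le {c₁ R : ℝ} (hR : 0 ≤ R) (hμL : μ ≤ 3 * c.LFc)
    (hc₁ : 0 < c₁) (hc₁R : 3 * c.LFc * R * (1 / c.kapLow τ + c.initial) ≤ c₁)
    (h : FirstStage c (c.stageConsts τ) c₁ μ m I B q) :
    stageBound c m I B q q.T R R ≤ (c.noise + 1) * (q.β * (1 / min (I : ℝ) B)) := by
  obtain ⟨hq, hlow⟩ := h.stageOK hc hτ hI hIm
  have hM : 0 < min (I : ℝ) B := lt_min (by exact_mod_cast hI) (by exact_mod_cast hB)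
  have hT := h.T_pos hc hτ hμ hI hIm hc₁
  have hm : (0 : ℝ) < m := by exact_mod_cast hI.trans hIm
  have hT0 : (0 : ℝ) < q.T := by exact_mod_cast hT
  have hβ := h.β_pos
  have hk := hc.kapLow_pos hτ
  have hi := hc.initial_pos
  have hη := hq.η_pos
  have hTge : c₁ * ((m : ℝ) / I * (min (I : ℝ) B / (μ * q.β ^ 2))) ≤ q.T :=
    (mul_le_mul_of_nonneg_left ((le_max_right _ _).trans (le_max_left _ _)) hc₁.le).trans h.T_ge
  have hsq : q.β ≤ √q.β := by
    rw [Real.le_sqrt' hβ]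
    nlinarith [hq.β_le]
  set M := min (I : ℝ) B
  have h1 : R / (q.η * q.T) ≤ R * μ / (c.kapLow τ * c₁) * (q.β * (1 / M)) := by
    have h2 : c.kapLow τ * c₁ * M / (μ * q.β) ≤ q.η * q.T := by
      calc c.kapLow τ * c₁ * M / (μ * q.β)
          = c.kapLow τ * (I / m * q.β) * (c₁ * ((m : ℝ) / I * (M / (μ * q.β ^ 2)))) := by
            field_simp
        _ ≤ c.kapLow τ * (I / m * √q.β) * q.T := by gcongr
        _ ≤ q.η * q.T := by gcongr
    calc R / (q.η * q.T) ≤ R / (c.kapLow τ * c₁ * M / (μ * q.β)) :=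
          div_le_div_of_nonneg_left hR (by positivity) h2
      _ = _ := by field_simp
  have h3 : c.initial * ((m / I) / q.β) * R / q.T
      ≤ c.initial * R * μ / c₁ * (q.β * (1 / M)) := by
    calc _ ≤ c.initial * ((m / I) / q.β) * R / (c₁ * ((m : ℝ) / I * (M / (μ * q.β ^ 2)))) :=
          div_le_div_of_nonneg_left (by positivity) (by positivity) hTge
      _ = _ := by field_simp
  have h4 : R * μ / (c.kapLow τ * c₁) + c.initial * R * μ / c₁ ≤ 1 := by
    have e : R * μ / (c.kapLow τ * c₁) + c.initial * R * μ / c₁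
        = μ * (R * (1 / c.kapLow τ + c.initial)) / c₁ := by field_simp
    rw [e, div_le_one hc₁]
    refine le_trans ?_ hc₁R
    rw [mul_assoc (3 * c.LFc)]
    gcongr
  have h5 := mul_le_mul_of_nonneg_right h4 (by positivity : 0 ≤ q.β * (1 / M))
  rw [stageBound]
  linarith

omit hμ hB in
theorem LaterStage.T_pos {ε : ℝ} (h : LaterStage (c.stageConsts τ) μ ε m I B q) : 1 ≤ q.T := by
  have hβ := h.β_pos
  have hm : (0 : ℝ) < m := by exact_mod_cast hI.trans hIm
  have h1 : 0 < (q.T : ℝ) := lt_of_lt_of_le (mul_pos (hc.stageConsts_pos hτ).cT_pos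
    (lt_max_of_lt_left (lt_max_of_lt_right (by positivity)))) h.T_ge
  exact_mod_cast h1

/-- The stage starts from the guarantee of its predecessor, whose accuracy is 2ε. Half of the budget
με/(6K) goes to the initial terms, through the first two entries of the bound for T, and half to the
noise, through the bound on β. -/
theorem LaterStage.stageBound_le {ε : ℝ} (hε : 0 < ε)
    (h : LaterStage (c.stageConsts τ) μ ε m I B q) (hβ2 : q.β ≤ 1 / 2) :
    stageBound c m I B q q.T (2 * ε) (μ * (2 * ε)) ≤ μ * ε / (6 * c.K) := by
  have hq := h.stageOK hc hτ hI hIm hβ2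
  have hM : 0 < min (I : ℝ) B := lt_min (by exact_mod_cast hI) (by exact_mod_cast hB)
  have hT := h.T_pos hc hτ hI hIm
  have hm : (0 : ℝ) < m := by exact_mod_cast hI.trans hIm
  have hT0 : (0 : ℝ) < q.T := by exact_mod_cast hT
  have hβ := h.β_pos
  have hi := hc.initial_pos
  have hη := hq.η_pos
  have hK := hc.K_pos
  have hn := hc.noise_pos
  have hcT : 0 < (c.stageConsts τ).cT := (hc.stageConsts_pos hτ).cT_pos
  have hT1 : (c.stageConsts τ).cT * (1 / (μ * q.η)) ≤ q.T :=
    (mul_le_mul_of_nonneg_left ((le_max_left _ _).trans (le_max_left _ _)) hcT.le).trans h.T_ge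
  have hT2 : (c.stageConsts τ).cT * ((m : ℝ) / I * (1 / q.β)) ≤ q.T :=
    (mul_le_mul_of_nonneg_left ((le_max_right _ _).trans (le_max_left _ _)) hcT.le).trans h.T_ge
  have hβle := h.β_le
  set M := min (I : ℝ) B
  have e9 : (c.stageConsts τ).C9 = 6 * c.K * (c.noise + 1) := rfl
  have eT : (c.stageConsts τ).cT = 24 * c.K * (1 + c.initial) := rfl
  have h1 : 2 * ε / (q.η * q.T) ≤ 2 * μ * ε / (c.stageConsts τ).cT := by
    calc _ ≤ 2 * ε / (q.η * ((c.stageConsts τ).cT * (1 / (μ * q.η)))) := by gcongr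
      _ = _ := by field_simp
  have h2 : c.initial * ((m / I) / q.β) * (μ * (2 * ε)) / q.T
      ≤ 2 * μ * ε * c.initial / (c.stageConsts τ).cT := by
    calc _ ≤ c.initial * ((m / I) / q.β) * (μ * (2 * ε))
          / ((c.stageConsts τ).cT * ((m : ℝ) / I * (1 / q.β))) :=
          div_le_div_of_nonneg_left (by positivity) (by positivity) hT2
      _ = _ := by field_simp
  have h3 : c.noise * (q.β * (1 / M)) ≤ μ * ε / (12 * c.K) := by
    have h4 : q.β * (1 / M) ≤ μ * ε / (21 * (c.stageConsts τ).C9) := by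
      rw [mul_one_div, div_le_iff₀ hM, div_mul_eq_mul_div]
      exact hβle
    calc _ ≤ c.noise * (μ * ε / (21 * (c.stageConsts τ).C9)) := by gcongr
      _ ≤ _ := by
        rw [e9, mul_div_assoc', div_le_div_iff₀ (by positivity) (by positivity)]
        have : 0 ≤ μ * ε * c.K := by positivity
        nlinarith [mul_nonneg this hn.le]
  have h5 : 2 * μ * ε / (c.stageConsts τ).cT + 2 * μ * ε * c.initial / (c.stageConsts τ).cT
      = μ * ε / (12 * c.K) := by
    rw [eT]; field_simp; ring
  have h6 : μ * ε / (6 * c.K) = μ * ε / (12 * c.K) + μ * ε / (12 * c.K) := by field_simp; norm_num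
  rw [stageBound, h6]
  linarith

end Bounds

variable [MeasurableSpace Ω] {pr : Measure Ω} [IsProbabilityMeasure pr] {N : Noise m B Ξ Z Ω}

omit [MeasurableSpace Ω] in
theorem output_measurable_and_norm_le {I : ℕ} (hp : p.Assumptions c) (hc : c.Valid) (τ : ℝ)
    (q : ℕ → StageParams) {θ : State p} (hθ : ∀ i, ‖θ.v i‖ ≤ c.V) (k : ℕ) :
    Measurable[N.sigmaOf (DrawIdx.past (k + 1) 1)] (output p c.V τ I q N θ k)
      ∧ ∀ ω i, ‖(output p c.V τ I q N θ k ω).v i‖ ≤ c.V := by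
  induction k with
  | zero => exact ⟨measurable_const, fun _ => hθ⟩
  | succ k ih =>
    exact ⟨measurable_snd.comp (measurable_pairAt_tout hp τ (q (k + 1)) ih.1),
      fun ω i => norm_iterate_v_le hc τ _ _ (ih.2 ω) _ i⟩

/-- Two invariants are carried from stage to stage, gap at most ε_k and total error at most μ ε_k.
Both follow from one bound on the expected gain, because K ≥ 1 makes the factor 6K dominate the
factor 2 of the PL inequality. -/
theorem output_bounds (hp : p.Assumptions c) (hc : c.Valid) {τ : ℝ} (hτ : 0 < τ) {μ R c₁ : ℝ}
    (hμ : 0 < μ) {xstar : Vec p.dx} (hPL : p.PL μ xstar) (hR : 0 ≤ R) (hc₁ : 0 < c₁)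
    (hc₁R : 3 * c.LFc * R * (1 / c.kapLow τ + c.initial) ≤ c₁) (hμL : μ ≤ 3 * c.LFc)
    (hI : 1 ≤ I) (hIm : I ≤ m) (hB : 1 ≤ B) {q : ℕ → StageParams}
    (h1 : FirstStage c (c.stageConsts τ) c₁ μ m I B (q 1))
    (h2 : ∀ k, 2 ≤ k → LaterStage (c.stageConsts τ) μ
      (epsStage (c.stageConsts τ) μ I B (q 1) k) m I B (q k))
    {θ : State p} (hθ : ∀ i, ‖θ.v i‖ ≤ c.V) (hF : p.F θ.x - p.F xstar ≤ R)
    (hE : totalError p θ ≤ R) (hN : N.IsSampling p I (fun k => (q k).T) pr) {k : ℕ} (hk : 1 ≤ k) :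
    ∫⁻ ω, ENNReal.ofReal (p.F (output p c.V τ I q N θ k ω).x - p.F xstar) ∂pr
        ≤ ENNReal.ofReal (epsStage (c.stageConsts τ) μ I B (q 1) k)
      ∧ ∫⁻ ω, ENNReal.ofReal (totalError p (output p c.V τ I q N θ k ω)) ∂pr
        ≤ ENNReal.ofReal (μ * epsStage (c.stageConsts τ) μ I B (q 1) k) := by
  have hM : 0 < min (I : ℝ) B := lt_min (by exact_mod_cast hI) (by exact_mod_cast hB)
  have hK := hc.one_le_K
  have hn := hc.noise_pos
  have e9 : (c.stageConsts τ).C9 = 6 * c.K * (c.noise + 1) := rfl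
  have he1 := epsStage_one_eq (C := c.stageConsts τ) hμ hI hB h1.α_eq h1.αbar_eq
  have hβ1 := h1.β_pos
  obtain ⟨hq1, -⟩ := h1.stageOK hc hτ hI hIm
  have hout := output_measurable_and_norm_le (N := N) (I := I) hp hc τ q hθ
  induction k, hk using Nat.le_induction with
  | base =>
    have hS := h1.stageBound_le hc hτ hμ hI hIm hB hR hμL hc₁ hc₁R
    have hb : 0 ≤ (c.noise + 1) * ((q 1).β * (1 / min (I : ℝ) B)) := by positivity
    refine lintegral_stage_le hp hc hN hq1 hI hIm hB (hout 0).1 (hout 0).2 le_rfl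
      (h1.T_pos hc hτ hμ hI hIm hc₁) hR hR ?_ ?_ hμ hPL ?_ ?_
    · refine (lintegral_mono fun _ => ENNReal.ofReal_le_ofReal hF).trans (le_of_eq ?_)
      rw [lintegral_const, measure_univ, mul_one]
    · refine (lintegral_mono fun _ => ENNReal.ofReal_le_ofReal hE).trans (le_of_eq ?_)
      rw [lintegral_const, measure_univ, mul_one]
    · rw [div_mul_eq_mul_div, div_le_iff₀ hμ, mul_comm _ μ, he1, e9]
      nlinarith [mul_nonneg (sub_nonneg.2 hK) hb]
    · rw [he1, e9]
      nlinarith [mul_nonneg (zero_le_one.trans hK) hb]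
  | succ k hk ih =>
    have hL := h2 (k + 1) (by omega)
    have he := epsStage_succ (c.stageConsts τ) μ I B (q 1) hk
    set ε := epsStage (c.stageConsts τ) μ I B (q 1) (k + 1) with hεd
    -- The admissible bound on β in stage k + 1 is exactly β_1/2^k. Hence β ≤ 1/2 persists, as the
    -- estimator bounds require.
    have hε0 : μ * ε * min (I : ℝ) B / (21 * (c.stageConsts τ).C9) = (q 1).β / 2 ^ k := by
      have e : ε = epsStage (c.stageConsts τ) μ I B (q 1) 1 / 2 ^ k := by
        simp [hεd, epsStage]
      have h9 : (c.stageConsts τ).C9 ≠ 0 := (hc.stageConsts_pos hτ).C9_pos.ne'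
      rw [e, mul_div_assoc', he1]
      field_simp
    have hε : 0 < ε := by
      have h9 := (hc.stageConsts_pos hτ).C9_pos
      have h3 : 0 < μ * ε * min (I : ℝ) B / (21 * (c.stageConsts τ).C9) := by
        rw [hε0]; positivity
      rw [div_pos_iff_of_pos_right (by positivity), mul_pos_iff_of_pos_right hM] at h3
      exact pos_of_mul_pos_right h3 hμ.le
    have hβ2 : (q (k + 1)).β ≤ 1 / 2 := by
      refine hL.β_le.trans ?_
      rw [hε0]
      exact (div_le_self hβ1.le (one_le_pow₀ one_le_two)).trans h1.β_le
    have hS := hL.stageBound_le hc hτ hμ hI hIm hB hε hβ2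
    rw [he] at ih
    refine lintegral_stage_le hp hc hN (hL.stageOK hc hτ hI hIm hβ2) hI hIm hB (hout k).1
      (hout k).2 (by omega) (hL.T_pos hc hτ hI hIm) (by positivity) (by positivity)
      ih.1 ih.2 hμ hPL ?_ ?_
    · rw [div_mul_eq_mul_div, div_le_iff₀ hμ]
      rw [le_div_iff₀ (by positivity)] at hS
      have : 0 < μ * ε := by positivity
      by_contra hcon
      push Not at hcon
      nlinarith
    · rw [le_div_iff₀ (by positivity)] at hS
      linarith

end BSVRB

/-! ### Assembly of the theorem -/

theorem mainTheorem4
    (c : BSVRB.Consts) (hc : c.Valid) (τ : ℝ) (hτ : 0 < τ) (hτ' : τ ≤ 2 / (3 * c.Lg)) :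
    ∃ C : BSVRB.RConsts, C.Pos ∧
      ∀ R : ℝ, 0 ≤ R → ∃ c₁ : ℝ, 0 < c₁ ∧
        ∀ (m I B : ℕ), 1 ≤ I → I ≤ m → 1 ≤ B →
        ∀ (Ξ Z Ω : Type*) [MeasurableSpace Ξ] [MeasurableSpace Z] [MeasurableSpace Ω]
          (pr : Measure Ω) [IsProbabilityMeasure pr]
          (p : BSVRB.Problem m Ξ Z) (_ : p.Assumptions c)
          (μ : ℝ) (_ : 0 < μ) (xstar : BSVRB.Vec p.dx) (_ : p.PL μ xstar)
          (q : ℕ → BSVRB.StageParams)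
          (_ : BSVRB.FirstStage c C c₁ μ m I B (q 1))
          (_ : ∀ k, 2 ≤ k →
            BSVRB.LaterStage C μ (BSVRB.epsStage C μ I B (q 1) k) m I B (q k))
          (θ : BSVRB.State p) (_ : ∀ i, ‖θ.v i‖ ≤ c.V)
          (_ : p.F θ.x - p.F xstar ≤ R) (_ : BSVRB.totalError p θ ≤ R)
          (N : BSVRB.Noise m B Ξ Z Ω) (_ : N.IsSampling p I (fun k => (q k).T) pr),
          (Differentiable ℝ p.F ∧
            ∀ x x', ‖gradient p.F x - gradient p.F x'‖ ≤ C.LF * ‖x - x'‖) ∧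
          ∀ ε : ℝ, 0 < ε →
            ∀ K : ℕ, 1 ≤ K → 1 + Real.logb 2 (BSVRB.epsStage C μ I B (q 1) 1 / ε) ≤ K →
              Integrable
                (fun ω => p.F (BSVRB.output p c.V τ I q N θ K ω).x - p.F xstar) pr ∧
              ∫ ω, (p.F (BSVRB.output p c.V τ I q N θ K ω).x - p.F xstar) ∂pr ≤ ε := by
  refine ⟨c.stageConsts τ, hc.stageConsts_pos hτ, fun R hR =>
    -- The summand 1 keeps c₁ positive when R = 0.
    ⟨3 * c.LFc * R * (1 / c.kapLow τ + c.initial) + 1, ?_, ?_⟩⟩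
  · have := hc.LFc_pos
    have := hc.kapLow_pos hτ
    have := hc.initial_pos
    positivity
  intro m I B hI hIm hB Ξ Z Ω _ _ _ pr _ p hp μ hμ xstar hPL q h1 h2 θ hθ hF hE N hN
  refine ⟨⟨hp.differentiable_F hc, hp.norm_gradient_F_sub_le hc⟩, fun ε hε K hK hKε => ?_⟩
  -- If F is constant, the PL condition leaves μ unbounded and the stage estimates are unavailable,
  -- but then the gap is identically zero.
  by_cases hconst : ∃ x, p.F xstar < p.F x
  · obtain ⟨x, hx⟩ := hconst
    have hL := hc.LFc_pos
    have hk := hc.kapLow_pos hτ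
    have hi := hc.initial_pos
    have hb := (BSVRB.output_bounds hp hc hτ hμ hPL hR (by positivity) (lt_add_one _).le
      (hPL.le_of_lt hp hc hx) hI hIm hB h1 h2 hθ hF hE hN hK).1
    have hm : Measurable fun ω => p.F (BSVRB.output p c.V τ I q N θ K ω).x - p.F xstar :=
      (BSVRB.measurable_F hp hc ((BSVRB.output_measurable_and_norm_le hp hc τ q hθ K).1.mono
        (hN.sigmaOf_le _) le_rfl)).sub_const _
    have h0 : ∀ ω, 0 ≤ p.F (BSVRB.output p c.V τ I q N θ K ω).x - p.F xstar :=
      fun ω => sub_nonneg.2 (hPL.isMin _)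
    have hε1 : 0 < BSVRB.epsStage (c.stageConsts τ) μ I B (q 1) 1 := by
      have hM : 0 < min (I : ℝ) B := lt_min (by exact_mod_cast hI) (by exact_mod_cast hB)
      have h9 := (hc.stageConsts_pos hτ).C9_pos
      have hβ := h1.β_pos
      have h3 : 0 < μ * BSVRB.epsStage (c.stageConsts τ) μ I B (q 1) 1 := by
        rw [BSVRB.epsStage_one_eq hμ hI hB h1.α_eq h1.αbar_eq]
        positivity
      exact pos_of_mul_pos_right h3 hμ.le
    exact ⟨BSVRB.integrable_of_lintegral_ofReal_le hm h0 hb,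
      BSVRB.integral_le_of_lintegral_ofReal_le hm h0 hε.le
        (hb.trans (ENNReal.ofReal_le_ofReal (BSVRB.epsStage_le hε hK hε1 hKε)))⟩
  · push Not at hconst
    have h0 : ∀ x, p.F x - p.F xstar = 0 := fun x =>
      sub_eq_zero.2 (le_antisymm (hconst x) (hPL.isMin x))
    simp only [h0]
    exact ⟨integrable_zero _ _ _, by simpa using hε.le⟩
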